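/- **Setting.** Let $\mathcal Y$ be a connected smooth manifold, $\mathscr H_1,\mathscr H_2\to\mathcal Y$ smooth Hilbert space bundles (with atlases of unitary trivializations), and $\mathscr D\to\mathcal Y$ a smooth Hilbert space bundle continuously embedded in $\mathscr H_1$ with fiberwise dense image, such that the trivializations of $\mathscr H_1$ restrict to smooth trivializations of $\mathscr D$; the model spaces are $H_1,H_2,\mathcal D$. Let $\Sigma\subset\mathbb C$ be open and connected and let $\mathscr P_y(\sigma):\mathscr D_y\subset\mathscr H_{1,y}\to\mathscr H_{2,y}$, $(y,\sigma)\in\mathcal Y\times\Sigma$, be closed Fredholm operators forming a smooth bundle homomorphism, holomorphic in $\sigma$, such that for each $y$ some $\mathscr P_y(\sigma)$ is invertible. Put $\operatorname{sing}_b(\mathscr P_y)=\{\sigma\in\Sigma:\mathscr P_y(\sigma)\text{ is not invertible}\}$ and $\operatorname{sing}_e(\mathscr P)=\{(y,\sigma):\sigma\in\operatorname{sing}_b(\mathscr P_y)\}$. Assume that $\operatorname{sing}_b(\mathscr P_y)$ is finite for each $y$ and that $\operatorname{sing}_e(\mathscr P)$ is closed in $\mathcal Y\times\mathbb C$. For $V\subset\mathbb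 C$ open and $f$ meromorphic on $V$ with finitely many poles there, let $\mathfrak s_V(f)$ be the sum of the singular (principal) parts of $f$ at its poles in $V$, a meromorphic function on $\mathbb C$. For a holomorphic family of operators $Q(\sigma)$, $\sigma\in V$, let $\ker(V,Q)=\{\mathfrak s_V(\phi):\phi \text{ meromorphic on }V,\ Q\phi\text{ holomorphic on }V\}$. Let $\mathscr K_y=\ker(\Sigma,\mathscr P_y)$, and for $U\subset\mathcal Y$ open let $\mathscr B^\infty(U;\mathscr K)$ be the space of all $\phi=(\phi_y)_{y\in U}$, $\phi_y\in\mathscr K_y$, which in the trivializations are smooth $\mathcal D$-valued functions on $(U\times\mathbb C)\setminus\operatorname{sing}_e(\mathscr P)$, holomorphic in $\sigma$. **Construction.** Fix $y_0\in\mathcal Y$ and trivializations near $y_0$; write $\mathcal P_y(\sigma):\mathcal D\subset H_1\to H_2$ for $\mathscr P$ in these. Let $\sigma_1,\dots,\sigma_S$ be the points of $\operatorname{sing}_b(\mathscr P_{y_0})$, $D_{s,r}=\{|\sigma-\sigma_s|<r\}$, $K_s=\ker\mathcal P_{y_0}(\sigma_s)$, $R_s=\operatorname{ran}\mathcal P_{y_0}(\sigma_s)$,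 $K_s^\perp$ the orthogonal of $K_s$ in $\mathcal D$ for the inner product of $H_1$, $R_s^\perp$ the orthogonal of $R_s$ in $H_2$. Write $\mathcal P_y(\sigma)=\begin{bmatrix}\mathfrak p^1_{s,1}&\mathfrak p^1_{s,2}\\ \mathfrak p^2_{s,1}&\mathfrak p^2_{s,2}\end{bmatrix}:K_s\oplus K_s^\perp\to R_s^\perp\oplus R_s$ and, where $\mathfrak p^2_{s,2}$ is invertible, $\mathfrak P_s=\mathfrak p^1_{s,1}-\mathfrak p^1_{s,2}(\mathfrak p^2_{s,2})^{-1}\mathfrak p^2_{s,1}:K_s\to R_s^\perp$. Call $(\varepsilon,U)$ *admissible* if $\varepsilon>0$, $U$ is a connected open neighborhood of $y_0$ over which the trivializations are defined, and (1) the discs $D_{s,2\varepsilon}$ are pairwise disjoint and contained in $\Sigma$; (2) $\mathfrak p^2_{s,2}(y_0,\sigma)$ is invertible for $\sigma\in D_{s,2\varepsilon}$; (3) $\mathfrak p^2_{s,2}(y,\sigma)$ is invertible for $(y,\sigma)\in U\times D_{s,\varepsilon}$; (4) $\operatorname{sing}_b(\mathscr P_y)\subset\bigcup_s D_{s,\varepsilon/2}$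 for $y\in U$. Let $\mathfrak K_{s,y}=\ker(D_{s,\varepsilon},\mathfrak P_s(y,\cdot))$. A *canonical system of root functions* at $\sigma_s$ consists of $\phi^{K_s}_{j,0}\in\mathfrak K_{s,y_0}$, $j=1,\dots,J_s$, with pole only at $\sigma_s$, of order $L_{s,j}\ge1$, such that (a) the functions $\mathfrak s_{D_{s,\varepsilon}}\big((\sigma-\sigma_s)^\ell\phi^{K_s}_{j,0}\big)$, $1\le j\le J_s$, $0\le\ell<L_{s,j}$, form a basis of $\mathfrak K_{s,y_0}$; (b) the values of $(\sigma-\sigma_s)^{L_{s,j}}\phi^{K_s}_{j,0}$ at $\sigma_s$ form a basis of $K_s$; (c) the functions $\beta_{s,j}=\mathfrak P_s(y_0,\cdot)\phi^{K_s}_{j,0}$ are holomorphic in $D_{s,\varepsilon}$ and their values at $\sigma_s$ form a basis of $R_s^\perp$. Given canonical systems at all $\sigma_s$ define, for $y\in U$, $$\phi^{K_s}_{j,\ell}(y,\cdot)=\mathfrak s_{D_{s,\varepsilon}}\big((\sigma-\sigma_s)^\ell\,\mathfrak P_s(y,\sigma)^{-1}\beta_{s,j}(\sigma)\big),\qquad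 \phi^s_{j,\ell}=\phi^{K_s}_{j,\ell}-\mathfrak s_{D_{s,\varepsilon}}\big((\mathfrak p^2_{s,2})^{-1}\mathfrak p^2_{s,1}\phi^{K_s}_{j,\ell}\big).$$ **Theorem 5.1.** (i) If the sets $\operatorname{sing}_b(\mathscr P_y)$ with $y$ near $y_0$ lie in a common bounded set (for instance if $\Sigma$ is bounded), then for every sufficiently small $\varepsilon>0$ and every neighborhood $N$ of $y_0$ there is $U\subset N$ with $(\varepsilon,U)$ admissible. (ii) Let $(\varepsilon,U)$ be admissible. Canonical systems of root functions exist at all $\sigma_s$. For any choice of them: - there is $U'\subset U$ with $(\varepsilon,U')$ admissible and such that, with $U'$ in place of $U$, (5) the $\phi^{K_s}_{j,\ell}(y,\cdot)$ form a basis of $\mathfrak K_{s,y}$ for each $y\in U$ and each $s$; - if (5) holds for $U$, then the $\phi^s_{j,\ell}$ are elements of $\mathscr B^\infty(U;\mathscr K)$ giving a basis of $\mathscr K_y$ for each $y\in U$, and every $\phi\in\mathscr B^\infty(U;\mathscr K)$ can be written $\phi=\sum_{s,j,\ell}f^{j,\ell}_s\phi^s_{j,\ell}$ over $U$ with smooth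 functions $f^{j,\ell}_s:U\to\mathbb C$. -/

import Mathlib

open Set Filter Topology
open scoped Manifold ContDiff InnerProductSpace

noncomputable section

namespace KernelBundle

/-! ### Singular parts of vector-valued meromorphic functions -/

section Meromorphic

variable {E F : Type*} [NormedAddCommGroup E] [NormedSpace ℂ E]
  [NormedAddCommGroup F] [NormedSpace ℂ F]

/-- The meromorphic function `f` has only removable singularities in `V`: near every point of `V`
it agrees, off the point, with a function holomorphic at the point. Values of a meromorphic
function at isolated points are thus disregarded. -/
def ExtendsHolomorphically (V : Set ℂ) (f : ℂ → E) : Prop :=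
  ∀ p ∈ V, ∃ g : ℂ → E, AnalyticAt ℂ g p ∧ f =ᶠ[𝓝[≠] p] g

/-- The finite sum of principal parts `∑ₚ ∑ₖ c p k / (σ - p) ^ (k + 1)`. At a pole `p` the terms
belonging to `p` are given the value `0`, so that the expression is linear in `c` everywhere. -/
def principalSum (c : ℂ →₀ ℕ →₀ E) (σ : ℂ) : E :=
  c.sum fun p a => a.sum fun k v => ((σ - p)⁻¹) ^ (k + 1) • v

/-- `g` is the sum of the singular parts of `f` at its (finitely many) poles in `V`. -/
def IsSingularPart (V : Set ℂ) (f g : ℂ → E) : Prop :=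
  ∃ c : ℂ →₀ ℕ →₀ E, (c.support : Set ℂ) ⊆ V ∧ g = principalSum c ∧
    ExtendsHolomorphically V (f - g)

open Classical in
/-- `𝔰_V(f)`: the sum of the singular parts of `f` at its poles in `V`, a meromorphic function
on `ℂ` (and `0` if there is no such finite sum). -/
def singularPart (V : Set ℂ) (f : ℂ → E) : ℂ → E :=
  if h : ∃ g, IsSingularPart V f g then h.choose else 0

theorem principalSum_zero : principalSum (0 : ℂ →₀ ℕ →₀ E) = 0 := by
  funext σ; simp [principalSum]

theorem principalSum_add (c d : ℂ →₀ ℕ →₀ E) :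
    principalSum (c + d) = principalSum c + principalSum d := by
  classical
  funext σ
  simp only [principalSum, Pi.add_apply]
  refine Finsupp.sum_add_index' (fun p => by simp) (fun p a b => ?_)
  exact Finsupp.sum_add_index' (fun k => by simp) (fun k v w => by simp)

theorem principalSum_smul (z : ℂ) (c : ℂ →₀ ℕ →₀ E) :
    principalSum (z • c) = z • principalSum c := by
  funext σ
  simp only [principalSum, Pi.smul_apply]
  rw [Finsupp.sum_smul_index' (fun p => by simp), Finsupp.smul_sum]
  refine Finsupp.sum_congr fun p _ => ?_
  rw [Finsupp.sum_smul_index' (fun k => by simp), Finsupp.smul_sum]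
  exact Finsupp.sum_congr fun k _ => smul_comm _ _ _

theorem ExtendsHolomorphically.add {V : Set ℂ} {f g : ℂ → E} (hf : ExtendsHolomorphically V f)
    (hg : ExtendsHolomorphically V g) : ExtendsHolomorphically V (f + g) := fun p hp => by
  obtain ⟨f', hf', ef⟩ := hf p hp
  obtain ⟨g', hg', eg⟩ := hg p hp
  exact ⟨f' + g', hf'.add hg', ef.add eg⟩

theorem ExtendsHolomorphically.smul {V : Set ℂ} {f : ℂ → E} (z : ℂ)
    (hf : ExtendsHolomorphically V f) : ExtendsHolomorphically V (z • f) := fun p hp => by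
  obtain ⟨f', hf', ef⟩ := hf p hp
  exact ⟨z • f', hf'.const_smul, ef.mono fun x hx => by simp [hx]⟩

/-- For a family `Q σ : E → F` of operators, the space of all `𝔰_V(φ)`, where `φ` is an `E`-valued
meromorphic function on `V` such that `Q φ` is holomorphic on `V`. -/
def kernelSpace (V : Set ℂ) (Q : ℂ → E →L[ℂ] F) : Submodule ℂ (ℂ → E) where
  carrier := {g | ∃ φ : ℂ → E, MeromorphicOn φ V ∧
    ExtendsHolomorphically V (fun σ => Q σ (φ σ)) ∧ IsSingularPart V φ g}
  zero_mem' := by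
    refine ⟨0, fun p _ => MeromorphicAt.const 0 p, fun p _ => ⟨0, analyticAt_const, ?_⟩, 0, ?_, ?_, ?_⟩
    · exact Eventually.of_forall fun x => by simp
    · simp
    · exact principalSum_zero.symm
    · exact fun p _ => ⟨0, analyticAt_const, Eventually.of_forall fun x => by simp⟩
  add_mem' := by
    rintro g g' ⟨φ, hφ, hQ, c, hc, rfl, hs⟩ ⟨φ', hφ', hQ', c', hc', rfl, hs'⟩
    classical
    refine ⟨φ + φ', hφ.add hφ', ?_, c + c', ?_, (principalSum_add c c').symm, ?_⟩
    · have := hQ.add hQ'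
      intro p hp
      obtain ⟨h, h1, h2⟩ := this p hp
      exact ⟨h, h1, h2.mono fun x hx => by simpa using hx⟩
    · intro p hp
      rcases Finset.mem_union.1 (Finsupp.support_add hp) with h | h
      · exact hc h
      · exact hc' h
    · have := hs.add hs'
      rwa [show φ + φ' - (principalSum c + principalSum c')
        = φ - principalSum c + (φ' - principalSum c') by abel]
  smul_mem' := by
    rintro z g ⟨φ, hφ, hQ, c, hc, rfl, hs⟩
    refine ⟨z • φ, fun p hp => (MeromorphicAt.const z p).smul (hφ p hp), ?_, z • c, ?_,
      (principalSum_smul z c).symm, ?_⟩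
    · intro p hp
      obtain ⟨h, h1, h2⟩ := hQ.smul z p hp
      exact ⟨h, h1, h2.mono fun x hx => by simpa using hx⟩
    · exact fun p hp => hc (Finsupp.support_smul hp)
    · rw [← smul_sub]
      exact hs.smul z

/-- The family `v` is a basis of the subspace `K`. -/
def IsBasisOf {X ι : Type*} [AddCommGroup X] [Module ℂ X] (K : Submodule ℂ X) (v : ι → X) : Prop :=
  LinearIndependent ℂ v ∧ Submodule.span ℂ (range v) = K

/-- A canonical system of root functions at `σ₀` for a family `Q` of maps between
finite-dimensional spaces on the disc of radius `ε` about `σ₀`. -/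
structure CanonicalSystem (Q : ℂ → E →L[ℂ] F) (σ₀ : ℂ) (ε : ℝ) where
  /-- number of root functions -/
  J : ℕ
  /-- pole orders -/
  L : Fin J → ℕ
  L_pos : ∀ j, 0 < L j
  /-- the functions `φ_{j,0}` -/
  φ : Fin J → ℂ → E
  mem : ∀ j, φ j ∈ kernelSpace (Metric.ball σ₀ ε) Q
  /-- the only pole is `σ₀` … -/
  analyticAt : ∀ j, ∀ σ ≠ σ₀, AnalyticAt ℂ (φ j) σ
  /-- … and its order there is `L j` -/
  order : ∀ j, meromorphicOrderAt (φ j) σ₀ = ((-(L j : ℤ) : ℤ) : WithTop ℤ)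
  /-- the functions `𝔰((σ - σ₀) ^ ℓ φ_{j,0})`, `0 ≤ ℓ < L j`, form a basis of the kernel space -/
  basis : IsBasisOf (kernelSpace (Metric.ball σ₀ ε) Q)
    (fun i : Σ j : Fin J, Fin (L j) =>
      singularPart (Metric.ball σ₀ ε) fun σ => (σ - σ₀) ^ (i.2 : ℕ) • φ i.1 σ)
  /-- the values of `(σ - σ₀) ^ L j φ_{j,0}` at `σ₀` form a basis of `E` -/
  leading : ∃ b : Module.Basis (Fin J) ℂ E,
    ∀ j, Tendsto (fun σ => (σ - σ₀) ^ L j • φ j σ) (𝓝[≠] σ₀) (𝓝 (b j))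
  /-- the holomorphic functions `β_j = Q φ_{j,0}` -/
  β : Fin J → ℂ → F
  β_analytic : ∀ j, AnalyticOnNhd ℂ (β j) (Metric.ball σ₀ ε)
  β_eq : ∀ j, ∀ σ ∈ Metric.ball σ₀ ε, σ ≠ σ₀ → β j σ = Q σ (φ j σ)
  /-- the values of the `β_j` at `σ₀` form a basis of `F` -/
  β_basis : ∃ b : Module.Basis (Fin J) ℂ F, ∀ j, b j = β j σ₀

end Meromorphic

/-! ### Block decomposition with respect to a reference operator -/

section Blocks

variable {F₁ F₂ D₀ : Type*}
  [NormedAddCommGroup F₁] [InnerProductSpace ℂ F₁]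
  [NormedAddCommGroup F₂] [InnerProductSpace ℂ F₂] [CompleteSpace F₂]
  [NormedAddCommGroup D₀] [InnerProductSpace ℂ D₀]

/-- The elements of `D₀` orthogonal to `ker A₀` with respect to the inner product of `F₁`, where
`D₀` is embedded in `F₁` by `ι₀`. -/
def kerPerp (ι₀ : D₀ →L[ℂ] F₁) (A₀ : D₀ →L[ℂ] F₂) : Submodule ℂ D₀ :=
  ((A₀.ker.map (ι₀ : D₀ →ₗ[ℂ] F₁))ᗮ).comap (ι₀ : D₀ →ₗ[ℂ] F₁)

/- The blocks of `A : ker A₀ ⊕ (ker A₀)^⊥ → (ran A₀)^⊥ ⊕ ran A₀`. The second summand of the target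
is written `A₀.rangeᗮᗮ`, which is `A₀.range` when the latter is closed. -/

/-- Block `ker A₀ → (ran A₀)^⊥` of `A`. -/
def block₁₁ (A₀ A : D₀ →L[ℂ] F₂) : A₀.ker →L[ℂ] A₀.rangeᗮ :=
  A₀.rangeᗮ.orthogonalProjectionOnto ∘L A ∘L A₀.ker.subtypeL

/-- Block `(ker A₀)^⊥ → (ran A₀)^⊥` of `A`. -/
def block₁₂ (ι₀ : D₀ →L[ℂ] F₁) (A₀ A : D₀ →L[ℂ] F₂) : kerPerp ι₀ A₀ →L[ℂ] A₀.rangeᗮ :=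
  A₀.rangeᗮ.orthogonalProjectionOnto ∘L A ∘L (kerPerp ι₀ A₀).subtypeL

/-- Block `ker A₀ → ran A₀` of `A`. -/
def block₂₁ (A₀ A : D₀ →L[ℂ] F₂) : A₀.ker →L[ℂ] A₀.rangeᗮᗮ :=
  A₀.rangeᗮᗮ.orthogonalProjectionOnto ∘L A ∘L A₀.ker.subtypeL

/-- Block `(ker A₀)^⊥ → ran A₀` of `A`. -/
def block₂₂ (ι₀ : D₀ →L[ℂ] F₁) (A₀ A : D₀ →L[ℂ] F₂) : kerPerp ι₀ A₀ →L[ℂ] A₀.rangeᗮᗮ :=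
  A₀.rangeᗮᗮ.orthogonalProjectionOnto ∘L A ∘L (kerPerp ι₀ A₀).subtypeL

/-- The Schur complement `a₁₁ - a₁₂ a₂₂⁻¹ a₂₁ : ker A₀ → (ran A₀)^⊥`. -/
def schurComplement (ι₀ : D₀ →L[ℂ] F₁) (A₀ A : D₀ →L[ℂ] F₂) : A₀.ker →L[ℂ] A₀.rangeᗮ :=
  block₁₁ A₀ A - block₁₂ ι₀ A₀ A ∘L (block₂₂ ι₀ A₀ A).inverse ∘L block₂₁ A₀ A

end Blocks

/-! ### Smooth Hilbert space bundles -/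

section Bundles

/-- A fiberwise unitary trivialization, over an open set, of a family of Hilbert spaces. (The
values of `map` off `base` are irrelevant.) -/
structure UnitaryTriv {Y : Type*} [TopologicalSpace Y]
    (F : Type*) [NormedAddCommGroup F] [InnerProductSpace ℂ F]
    (E : Y → Type*) [∀ y, NormedAddCommGroup (E y)] [∀ y, InnerProductSpace ℂ (E y)] where
  base : Set Y
  isOpen_base : IsOpen base
  map : ∀ y, E y ≃ₗᵢ[ℂ] F

/-- A smooth Hilbert space bundle with fibers `E y` and model `F`: an atlas of unitary
trivializations with smooth transition functions. -/
structure HilbertBundle (n : ℕ) (Y : Type*) [TopologicalSpace Y]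
    [ChartedSpace (EuclideanSpace ℝ (Fin n)) Y]
    (F : Type*) [NormedAddCommGroup F] [InnerProductSpace ℂ F]
    (E : Y → Type*) [∀ y, NormedAddCommGroup (E y)] [∀ y, InnerProductSpace ℂ (E y)] where
  atlas : Set (UnitaryTriv F E)
  cover : ∀ y, ∃ e ∈ atlas, y ∈ e.base
  smooth : ∀ e ∈ atlas, ∀ e' ∈ atlas, ContMDiffOn (𝓡 n) 𝓘(ℝ, F →L[ℂ] F) ∞
    (fun y => (((e.map y).symm.trans (e'.map y)).toContinuousLinearEquiv : F →L[ℂ] F))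
    (e.base ∩ e'.base)

/-- A unitary trivialization of the bundle with fibers `H₁ y` which restricts to a trivialization of
the family of subspaces `D y`, embedded by `ι y : D y → H₁ y`; on the model, `D₀` is embedded in
`F₁` by `ι₀`. -/
structure PairTriv {Y : Type*} [TopologicalSpace Y]
    {F₁ : Type*} [NormedAddCommGroup F₁] [InnerProductSpace ℂ F₁]
    {D₀ : Type*} [NormedAddCommGroup D₀] [InnerProductSpace ℂ D₀]
    {H₁ : Y → Type*} [∀ y, NormedAddCommGroup (H₁ y)] [∀ y, InnerProductSpace ℂ (H₁ y)]
    {D : Y → Type*} [∀ y, NormedAddCommGroup (D y)] [∀ y, InnerProductSpace ℂ (D y)]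
    (ι : ∀ y, D y →L[ℂ] H₁ y) (ι₀ : D₀ →L[ℂ] F₁) extends UnitaryTriv F₁ H₁ where
  mapD : ∀ y, D y ≃L[ℂ] D₀
  compat : ∀ y ∈ base, ∀ d, ι₀ (mapD y d) = map y (ι y d)

/-- A smooth Hilbert space bundle with fibers `H₁ y` together with a smooth Hilbert space bundle
with fibers `D y`, continuously embedded in it with fiberwise dense image, such that the
trivializations of the former restrict to smooth trivializations of the latter. -/
structure HilbertPairBundle (n : ℕ) (Y : Type*) [TopologicalSpace Y]
    [ChartedSpace (EuclideanSpace ℝ (Fin n)) Y]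
    (F₁ : Type*) [NormedAddCommGroup F₁] [InnerProductSpace ℂ F₁]
    (D₀ : Type*) [NormedAddCommGroup D₀] [InnerProductSpace ℂ D₀]
    (H₁ : Y → Type*) [∀ y, NormedAddCommGroup (H₁ y)] [∀ y, InnerProductSpace ℂ (H₁ y)]
    (D : Y → Type*) [∀ y, NormedAddCommGroup (D y)] [∀ y, InnerProductSpace ℂ (D y)] where
  ι : ∀ y, D y →L[ℂ] H₁ y
  ι_injective : ∀ y, Function.Injective (ι y)
  ι_dense : ∀ y, DenseRange (ι y)
  /-- the embedding of the model of `D` in the model of `H₁` -/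
  ι₀ : D₀ →L[ℂ] F₁
  atlas : Set (PairTriv ι ι₀)
  cover : ∀ y, ∃ e ∈ atlas, y ∈ e.base
  smooth : ∀ e ∈ atlas, ∀ e' ∈ atlas, ContMDiffOn (𝓡 n) 𝓘(ℝ, F₁ →L[ℂ] F₁) ∞
    (fun y => (((e.map y).symm.trans (e'.map y)).toContinuousLinearEquiv : F₁ →L[ℂ] F₁))
    (e.base ∩ e'.base)
  smoothD : ∀ e ∈ atlas, ∀ e' ∈ atlas, ContMDiffOn (𝓡 n) 𝓘(ℝ, D₀ →L[ℂ] D₀) ∞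
    (fun y => ((e.mapD y).symm.trans (e'.mapD y) : D₀ →L[ℂ] D₀))
    (e.base ∩ e'.base)

end Bundles

/-! ### Holomorphic Fredholm families, their kernel spaces and local frames -/

/-- A smooth family `P y σ : D y ⊂ H₁ y → H₂ y`, `(y, σ) ∈ Y × Sig`, of closed Fredholm operators
depending holomorphically on `σ`, such that for every `y` some `P y σ` is invertible, only finitely
many are not, and the set of all `(y, σ)` with `P y σ` not invertible is closed in `Y × ℂ`. -/
structure FredholmFamily (n : ℕ) (Y : Type*) [TopologicalSpace Y]
    [ChartedSpace (EuclideanSpace ℝ (Fin n)) Y]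
    (F₁ : Type*) [NormedAddCommGroup F₁] [InnerProductSpace ℂ F₁]
    (F₂ : Type*) [NormedAddCommGroup F₂] [InnerProductSpace ℂ F₂]
    (D₀ : Type*) [NormedAddCommGroup D₀] [InnerProductSpace ℂ D₀]
    (H₁ : Y → Type*) [∀ y, NormedAddCommGroup (H₁ y)] [∀ y, InnerProductSpace ℂ (H₁ y)]
    (H₂ : Y → Type*) [∀ y, NormedAddCommGroup (H₂ y)] [∀ y, InnerProductSpace ℂ (H₂ y)]
    (D : Y → Type*) [∀ y, NormedAddCommGroup (D y)] [∀ y, InnerProductSpace ℂ (D y)] where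
  /-- the bundle `H₁` with its subbundle `D` -/
  B₁ : HilbertPairBundle n Y F₁ D₀ H₁ D
  /-- the bundle `H₂` -/
  B₂ : HilbertBundle n Y F₂ H₂
  Sig : Set ℂ
  isOpen_Sig : IsOpen Sig
  isConnected_Sig : IsConnected Sig
  P : ∀ y, ℂ → D y →L[ℂ] H₂ y
  smooth : ∀ e₁ ∈ B₁.atlas, ∀ e₂ ∈ B₂.atlas,
    ContMDiffOn ((𝓡 n).prod 𝓘(ℝ, ℂ)) 𝓘(ℝ, D₀ →L[ℂ] F₂) ∞
      (fun p : Y × ℂ => ((e₂.map p.1).toContinuousLinearEquiv : H₂ p.1 →L[ℂ] F₂) ∘L P p.1 p.2 ∘L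
        ((e₁.mapD p.1).symm : D₀ →L[ℂ] D p.1))
      ((e₁.base ∩ e₂.base) ×ˢ Sig)
  holomorphic : ∀ y, DifferentiableOn ℂ (P y) Sig
  /-- closedness of `P y σ` as an unbounded operator in `H₁ y` with domain `D y` -/
  closed : ∀ y, ∀ σ ∈ Sig, IsClosed (range fun d : D y => (B₁.ι y d, P y σ d))
  fredholm : ∀ y, ∀ σ ∈ Sig, (P y σ).IsFredholm
  exists_invertible : ∀ y, ∃ σ ∈ Sig, (P y σ).IsInvertible
  finite_sing : ∀ y, {σ ∈ Sig | ¬ (P y σ).IsInvertible}.Finite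
  isClosed_sing : IsClosed {p : Y × ℂ | p.2 ∈ Sig ∧ ¬ (P p.1 p.2).IsInvertible}

namespace FredholmFamily

variable {n : ℕ} {Y : Type*} [TopologicalSpace Y] [ChartedSpace (EuclideanSpace ℝ (Fin n)) Y]
  {F₁ : Type*} [NormedAddCommGroup F₁] [InnerProductSpace ℂ F₁]
  {F₂ : Type*} [NormedAddCommGroup F₂] [InnerProductSpace ℂ F₂] [CompleteSpace F₂]
  {D₀ : Type*} [NormedAddCommGroup D₀] [InnerProductSpace ℂ D₀]
  {H₁ : Y → Type*} [∀ y, NormedAddCommGroup (H₁ y)] [∀ y, InnerProductSpace ℂ (H₁ y)]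
  {H₂ : Y → Type*} [∀ y, NormedAddCommGroup (H₂ y)] [∀ y, InnerProductSpace ℂ (H₂ y)]
  {D : Y → Type*} [∀ y, NormedAddCommGroup (D y)] [∀ y, InnerProductSpace ℂ (D y)]
  (S : FredholmFamily n Y F₁ F₂ D₀ H₁ H₂ D)

/-- `sing_b(P_y)`: the points `σ ∈ Sig` where `P y σ` is not invertible. -/
def singB (y : Y) : Set ℂ := {σ ∈ S.Sig | ¬ (S.P y σ).IsInvertible}

/-- `sing_e(P)`: the pairs `(y, σ)` with `σ ∈ sing_b(P_y)`. -/
def singE : Set (Y × ℂ) := {p | p.2 ∈ S.singB p.1}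

instance fintypeSingB (y : Y) : Fintype (S.singB y) := (S.finite_sing y).fintype

/-- The fiber `K_y` of the kernel bundle. -/
def K (y : Y) : Submodule ℂ (ℂ → D y) := kernelSpace S.Sig (S.P y)

/-- `B^∞(U; K)`: the sections `φ` of `K` over `U` which, in the trivializations, are smooth
functions of `(y, σ) ∉ sing_e(P)`, `y ∈ U`, `σ ∈ ℂ`, holomorphic in `σ`. (The values of `φ y` for
`y ∉ U` are irrelevant.) -/
def smoothSections (U : Set Y) : Set (∀ y, ℂ → D y) :=
  {φ | (∀ y ∈ U, φ y ∈ S.K y) ∧ (∀ y ∈ U, DifferentiableOn ℂ (φ y) (S.singB y)ᶜ) ∧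
    ∀ e ∈ S.B₁.atlas, ContMDiffOn ((𝓡 n).prod 𝓘(ℝ, ℂ)) 𝓘(ℝ, D₀) ∞
      (fun p : Y × ℂ => e.mapD p.1 (φ p.1 p.2)) {p | p.1 ∈ U ∩ e.base ∧ p ∉ S.singE}}

variable (e₁ : PairTriv S.B₁.ι S.B₁.ι₀) (e₂ : UnitaryTriv F₂ H₂) (y₀ : Y)

/-- The family `P y σ`, viewed in trivializations as a family of operators `D₀ → F₂`. -/
def loc (y : Y) (σ : ℂ) : D₀ →L[ℂ] F₂ :=
  ((e₂.map y).toContinuousLinearEquiv : H₂ y →L[ℂ] F₂) ∘L S.P y σ ∘L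
    ((e₁.mapD y).symm : D₀ →L[ℂ] D y)

/-- The space `K_s = ker P_{y₀}(σ_s)`, in trivializations. -/
abbrev Ks (s : ℂ) : Submodule ℂ D₀ := (S.loc e₁ e₂ y₀ s).ker

/-- The space `R_s^⊥` orthogonal to the range `R_s` of `P_{y₀}(σ_s)`, in trivializations. -/
abbrev RsPerp (s : ℂ) : Submodule ℂ F₂ := (S.loc e₁ e₂ y₀ s).rangeᗮ

/-- The reduction of `P y σ` to a family of maps `K_s → R_s^⊥` by means of the Schur complement. -/
def reduced (s : ℂ) (y : Y) (σ : ℂ) : S.Ks e₁ e₂ y₀ s →L[ℂ] S.RsPerp e₁ e₂ y₀ s :=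
  schurComplement S.B₁.ι₀ (S.loc e₁ e₂ y₀ s) (S.loc e₁ e₂ y σ)

/-- The block `K_s^⊥ → R_s` of `P y σ`. -/
def corner (s : ℂ) (y : Y) (σ : ℂ) :
    kerPerp S.B₁.ι₀ (S.loc e₁ e₂ y₀ s) →L[ℂ] (S.RsPerp e₁ e₂ y₀ s)ᗮ :=
  block₂₂ S.B₁.ι₀ (S.loc e₁ e₂ y₀ s) (S.loc e₁ e₂ y σ)

/-- The conditions on `ε` and on the neighborhood `U` of `y₀` under which the local frame is
constructed. -/
structure Admissible (ε : ℝ) (U : Set Y) : Prop where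
  ε_pos : 0 < ε
  isOpen : IsOpen U
  isConnected : IsConnected U
  mem : y₀ ∈ U
  subset₁ : U ⊆ e₁.base
  subset₂ : U ⊆ e₂.base
  disjoint : (S.singB y₀).PairwiseDisjoint fun s => Metric.ball s (2 * ε)
  ball_subset : ∀ s ∈ S.singB y₀, Metric.ball s (2 * ε) ⊆ S.Sig
  corner_base : ∀ s ∈ S.singB y₀, ∀ σ ∈ Metric.ball s (2 * ε),
    (S.corner e₁ e₂ y₀ s y₀ σ).IsInvertible
  corner : ∀ s ∈ S.singB y₀, ∀ y ∈ U, ∀ σ ∈ Metric.ball s ε,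
    (S.corner e₁ e₂ y₀ s y σ).IsInvertible
  sing_subset : ∀ y ∈ U, S.singB y ⊆ ⋃ s ∈ S.singB y₀, Metric.ball s (ε / 2)

/-- A choice, for each `s ∈ sing_b(P_{y₀})`, of a canonical system of root functions for the
reduced family at `y₀`. -/
abbrev RootSystems (ε : ℝ) : Type _ :=
  ∀ s : S.singB y₀, CanonicalSystem (S.reduced e₁ e₂ y₀ s y₀) (s : ℂ) ε

variable {S e₁ e₂ y₀} {ε : ℝ} (C : S.RootSystems e₁ e₂ y₀ ε)

/-- The indices `(j, ℓ)` belonging to the point `s`. -/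
abbrev LocalIndex (s : S.singB y₀) : Type := Σ j : Fin (C s).J, Fin ((C s).L j)

/-- The indices `(s, j, ℓ)`. -/
abbrev FrameIndex : Type := Σ s : S.singB y₀, LocalIndex C s

/-- The space `𝔎_{s,y}`: the kernel space of the reduced family at `y` on the disc of radius `ε`
about `s`. -/
def reducedK (e₁ : PairTriv S.B₁.ι S.B₁.ι₀) (e₂ : UnitaryTriv F₂ H₂) (y₀ : Y) (ε : ℝ) (s : ℂ)
    (y : Y) : Submodule ℂ (ℂ → S.Ks e₁ e₂ y₀ s) :=
  kernelSpace (Metric.ball s ε) (S.reduced e₁ e₂ y₀ s y)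

/-- The functions `φ^{K_s}_{j,ℓ}(y, ·) = 𝔰((σ - σ_s) ^ ℓ 𝔓_s(y, σ)⁻¹ β_{s,j}(σ))`. -/
def reducedFrame (s : S.singB y₀) (i : LocalIndex C s) (y : Y) : ℂ → S.Ks e₁ e₂ y₀ s :=
  singularPart (Metric.ball (s : ℂ) ε) fun σ =>
    (σ - (s : ℂ)) ^ (i.2 : ℕ) • (S.reduced e₁ e₂ y₀ s y σ).inverse ((C s).β i.1 σ)

/-- The functions `φ^s_{j,ℓ}(y, ·) = φ^{K_s}_{j,ℓ} - 𝔰(p₂₂⁻¹ p₂₁ φ^{K_s}_{j,ℓ})`, viewed as functions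
with values in the fiber `D y`. -/
def frame (i : FrameIndex C) (y : Y) : ℂ → D y := fun σ =>
  (e₁.mapD y).symm
    ((reducedFrame C i.1 i.2 y σ : D₀) -
      singularPart (Metric.ball (i.1 : ℂ) ε)
        (fun ζ => (((S.corner e₁ e₂ y₀ i.1 y ζ).inverse
          (block₂₁ (S.loc e₁ e₂ y₀ i.1) (S.loc e₁ e₂ y ζ) (reducedFrame C i.1 i.2 y ζ)) :
            kerPerp S.B₁.ι₀ (S.loc e₁ e₂ y₀ i.1)) : D₀)) σ)

/-- For every `y ∈ U` and every `s` the `φ^{K_s}_{j,ℓ}(y, ·)` form a basis of `𝔎_{s,y}`. -/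
def ReducedBasisOn (U : Set Y) : Prop :=
  ∀ y ∈ U, ∀ s : S.singB y₀,
    IsBasisOf (reducedK e₁ e₂ y₀ ε (s : ℂ) y) fun i : LocalIndex C s => reducedFrame C s i y

end FredholmFamily

end KernelBundle

end

/-! Near `σ_s` the Schur complement replaces the Fredholm family by a holomorphic family `𝔓_s` of
maps between the finite-dimensional spaces `K_s` and `R_s^⊥`. The lift `k ↦ k - p₂₂⁻¹ p₂₁ k`
(`schurLift`) carries `𝔓_s` to `𝒫_y`, and the projection onto `K_s` along `K_s^⊥` undoes it. Modulo
holomorphic functions the two are inverse to each other on functions that `𝒫_y` makes holomorphic.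
For `y ∈ U` all singular points lie in disjoint discs about the `σ_s`, so an element of `𝒦_y` is a
sum of local pieces, and bases of the spaces `𝔎_{s,y}` lift to a basis of `𝒦_y`
(`kerProj_mem_reducedK`, `exists_eq_sum_locFrame`, `linearIndependent_locFrame`).

Root functions at `y₀`: multiplication by `σ - σ_s` followed by `𝔰` is a nilpotent endomorphism of
the finite-dimensional space `𝔎_{s,y₀}`, and the first vectors of its Jordan chains form a canonical
system. The bases of `K_s` and `R_s^⊥` come from its kernel and its range, because `𝔓_s(y₀, σ_s) =
0` (`exists_canonicalSystem`).

Stability in `y`: the functions `𝔰(𝔓⁻¹ bᵢ)` form a basis of the kernel space exactly when every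
element of the disc algebra is uniquely of the form `∑ cᵢ bᵢ + 𝔓 u` with `u` in the disc algebra.
This is bijectivity of a bounded operator between Banach spaces. With the `bᵢ` fixed, the operator
depends continuously on `𝔓` in the sup norm, so bijectivity survives small changes of `y`
(`bijective_of_isBasisOf`, `isBasisOf_of_bijective`, `exists_isBasisOf_of_close`).

Smoothness: the frame functions are `𝔰(𝒫_y⁻¹ (σ - σ_s)^ℓ β_{s,j})`
(`isSingularPart_inverse_locFrame`), and a singular part is given by Cauchy integrals over a fixed
circle avoiding all singular points (`contMDiffAt_singularPart`). Coefficients of a smooth section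
are recovered from finitely many functionals evaluated at nonsingular points, by inverting a smooth
matrix which is the identity at the point considered (`contMDiffAt_coefficients`). -/

noncomputable section

namespace KernelBundle

/-! ### Calculus of removable singularities, principal parts and singular parts. -/

section SingularParts

variable {E F : Type*} [NormedAddCommGroup E] [NormedSpace ℂ E]
  [NormedAddCommGroup F] [NormedSpace ℂ F]

/-! ### Removable singularities -/

/-- `f` has at most a removable singularity at `p`. -/
def ExtendsAt (f : ℂ → E) (p : ℂ) : Prop := ∃ g : ℂ → E, AnalyticAt ℂ g p ∧ f =ᶠ[𝓝[≠] p] g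

namespace ExtendsAt

variable {f f' : ℂ → E} {p : ℂ}

theorem add (hf : ExtendsAt f p) (hf' : ExtendsAt f' p) : ExtendsAt (f + f') p := by
  obtain ⟨g, hg, e⟩ := hf
  obtain ⟨g', hg', e'⟩ := hf'
  exact ⟨g + g', hg.add hg', e.add e'⟩

theorem neg (hf : ExtendsAt f p) : ExtendsAt (-f) p := by
  obtain ⟨g, hg, e⟩ := hf
  exact ⟨-g, hg.neg, e.neg⟩

theorem sub (hf : ExtendsAt f p) (hf' : ExtendsAt f' p) : ExtendsAt (f - f') p := by
  rw [sub_eq_add_neg]; exact hf.add hf'.neg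

theorem congr (hf : ExtendsAt f p) (h : f' =ᶠ[𝓝[≠] p] f) : ExtendsAt f' p := by
  obtain ⟨g, hg, e⟩ := hf
  exact ⟨g, hg, h.trans e⟩

theorem meromorphicAt (hf : ExtendsAt f p) : MeromorphicAt f p := by
  obtain ⟨g, hg, e⟩ := hf
  exact hg.meromorphicAt.congr e.symm

theorem smul {u : ℂ → ℂ} (hu : AnalyticAt ℂ u p) (hf : ExtendsAt f p) :
    ExtendsAt (fun σ => u σ • f σ) p := by
  obtain ⟨g, hg, e⟩ := hf
  exact ⟨fun σ => u σ • g σ, hu.smul hg, e.mono fun σ h => by simp [h]⟩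

theorem _root_.AnalyticAt.operator_apply {A : ℂ → E →L[ℂ] F} {g : ℂ → E} {p : ℂ}
    (hA : AnalyticAt ℂ A p) (hg : AnalyticAt ℂ g p) : AnalyticAt ℂ (fun σ => A σ (g σ)) p :=
  (ContinuousLinearMap.id ℂ (E →L[ℂ] F)).analyticAt_bilinear _ |>.comp₂ hA hg

theorem clm_apply {A : ℂ → E →L[ℂ] F} (hA : AnalyticAt ℂ A p) (hf : ExtendsAt f p) :
    ExtendsAt (fun σ => A σ (f σ)) p := by
  obtain ⟨g, hg, e⟩ := hf
  exact ⟨fun σ => A σ (g σ), hA.operator_apply hg, e.mono fun σ h => by simp [h]⟩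

theorem clm (L : E →L[ℂ] F) (hf : ExtendsAt f p) : ExtendsAt (fun σ => L (f σ)) p :=
  hf.clm_apply (A := fun _ => L) analyticAt_const

end ExtendsAt

theorem _root_.AnalyticAt.extendsAt {f : ℂ → E} {p : ℂ} (hf : AnalyticAt ℂ f p) :
    ExtendsAt f p := ⟨f, hf, EventuallyEq.rfl⟩

/-- Division of a holomorphic function by `σ - p` at a zero `p`. -/
theorem extendsAt_inv_smul {f : ℂ → E} {p : ℂ} (hf : AnalyticAt ℂ f p) (h0 : f p = 0) :
    ExtendsAt (fun σ => (σ - p)⁻¹ • f σ) p := by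
  obtain ⟨q, hq⟩ := hf
  refine ⟨dslope f p, hq.has_fpower_series_dslope_fslope.analyticAt, ?_⟩
  filter_upwards [self_mem_nhdsWithin] with z hz
  rw [dslope_of_ne _ hz, slope_def_module, h0, sub_zero]

namespace ExtendsHolomorphically

variable {V W : Set ℂ} {f f' : ℂ → E}

theorem mono (hf : ExtendsHolomorphically V f) (h : W ⊆ V) : ExtendsHolomorphically W f :=
  fun p hp => hf p (h hp)

theorem sub (hf : ExtendsHolomorphically V f) (hf' : ExtendsHolomorphically V f') :
    ExtendsHolomorphically V (f - f') := fun p hp => ExtendsAt.sub (hf p hp) (hf' p hp)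

end ExtendsHolomorphically

/-- A function with removable singularities in an open set is, away from its
singularities, equal to a holomorphic function. -/
theorem ExtendsHolomorphically.exists_analyticOnNhd [CompleteSpace E] {V : Set ℂ} {f : ℂ → E}
    (hf : ExtendsHolomorphically V f) :
    ∃ g : ℂ → E, AnalyticOnNhd ℂ g V ∧ ∀ p ∈ V, ContinuousAt f p → g p = f p := by
  -- The punctured limit equals the value at `p` of any local holomorphic extension, so the local
  -- extensions glue without a choice.
  refine ⟨fun p => limUnder (𝓝[≠] p) f, fun p hp => ?_, fun p hp hc => ?_⟩
  · obtain ⟨g, hg, e⟩ := hf p hp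
    refine hg.congr ?_
    have h1 : ∀ᶠ q in 𝓝 p, AnalyticAt ℂ g q := hg.eventually_analyticAt
    have h2 : ∀ᶠ q in 𝓝[≠] p, ∀ᶠ z in 𝓝 q, f z = g z := by
      have h3 : ∀ᶠ q in 𝓝[≠] p, ∀ᶠ z in 𝓝[{p}ᶜ] q, f z = g z :=
        eventually_eventually_nhdsWithin.2 e
      filter_upwards [h3, self_mem_nhdsWithin] with q hq hqp
      rwa [isOpen_compl_singleton.nhdsWithin_eq hqp] at hq
    have h4 : ∀ᶠ q in 𝓝 p, f =ᶠ[𝓝[≠] q] g := by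
      rw [eventually_nhdsWithin_iff] at h2
      filter_upwards [h2] with q hq
      by_cases hqp : q = p
      · rw [hqp]; exact e
      · exact (hq hqp).filter_mono nhdsWithin_le_nhds
    filter_upwards [h1, h4] with q hq hq'
    exact (((hq.continuousAt.tendsto.mono_left nhdsWithin_le_nhds).congr' hq'.symm).limUnder_eq).symm
  · exact (hc.tendsto.mono_left nhdsWithin_le_nhds).limUnder_eq

/-! ### Finite sums of principal parts -/

@[simp] theorem principalSum_single (p : ℂ) (a : ℕ →₀ E) (σ : ℂ) :
    principalSum (Finsupp.single p a) σ = a.sum fun k v => ((σ - p)⁻¹) ^ (k + 1) • v := by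
  rw [principalSum, Finsupp.sum_single_index (by simp)]

theorem principalSum_eq_add_erase (c : ℂ →₀ ℕ →₀ E) (p : ℂ) :
    principalSum c = principalSum (Finsupp.single p (c p)) + principalSum (c.erase p) := by
  rw [← principalSum_add, Finsupp.single_add_erase]

theorem principalSum_neg (c : ℂ →₀ ℕ →₀ E) : principalSum (-c) = -principalSum c := by
  rw [← neg_one_smul ℂ c, principalSum_smul, neg_one_smul]

theorem principalSum_sub (c d : ℂ →₀ ℕ →₀ E) :
    principalSum (c - d) = principalSum c - principalSum d := by
  rw [sub_eq_add_neg, principalSum_add, principalSum_neg, sub_eq_add_neg]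

theorem principalSum_sum {ι : Type*} (s : Finset ι) (c : ι → ℂ →₀ ℕ →₀ E) :
    principalSum (∑ i ∈ s, c i) = ∑ i ∈ s, principalSum (c i) := by
  classical
  induction s using Finset.induction_on with
  | empty => simp [principalSum_zero]
  | insert a s ha ih => rw [Finset.sum_insert ha, Finset.sum_insert ha, principalSum_add, ih]

theorem analyticAt_principalSum {c : ℂ →₀ ℕ →₀ E} {σ : ℂ} (h : σ ∉ c.support) :
    AnalyticAt ℂ (principalSum c) σ := by
  unfold principalSum
  refine Finset.analyticAt_fun_sum _ fun p hp => Finset.analyticAt_fun_sum _ fun k _ => ?_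
  have : σ - p ≠ 0 := sub_ne_zero.2 fun e => h (e ▸ hp)
  exact ((((analyticAt_id.sub analyticAt_const).inv this).pow _).smul analyticAt_const)

theorem meromorphicAt_principalSum (c : ℂ →₀ ℕ →₀ E) (σ : ℂ) :
    MeromorphicAt (principalSum c) σ := by
  unfold principalSum
  refine MeromorphicAt.fun_sum fun p hp => MeromorphicAt.fun_sum fun k _ => ?_
  exact ((((MeromorphicAt.id σ).sub (MeromorphicAt.const p σ)).inv).pow _).smul
    (MeromorphicAt.const _ σ)

/-- A sum of principal parts has a removable singularity only where it has no principal part. -/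
theorem eq_zero_of_extendsAt_principalSum {c : ℂ →₀ ℕ →₀ E} {p : ℂ}
    (h : ExtendsAt (principalSum c) p) : c p = 0 := by
  have h' : ExtendsAt (principalSum (Finsupp.single p (c p))) p := by
    have := h.sub (analyticAt_principalSum (c := c.erase p) (σ := p) (by simp)).extendsAt
    rwa [principalSum_eq_add_erase c p, add_sub_cancel_right] at this
  generalize c p = a at h'
  by_contra ha
  obtain ⟨g, hg, e⟩ := h'
  have hne : a.support.Nonempty := Finsupp.support_nonempty_iff.2 ha
  set N := a.support.max' hne with hN
  have hNm : N ∈ a.support := Finset.max'_mem _ _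
  have t1 : Tendsto (fun σ => a.sum fun k v => (σ - p) ^ (N - k) • v) (𝓝[≠] p) (𝓝 (a N)) := by
    have hc : Continuous (fun σ => a.sum fun k v => (σ - p) ^ (N - k) • v) := by
      unfold Finsupp.sum; fun_prop
    have : (a.sum fun k v => (p - p) ^ (N - k) • v) = a N := by
      rw [Finsupp.sum, Finset.sum_eq_single N]
      · simp
      · intro k hk hkN
        have : k < N := lt_of_le_of_ne (Finset.le_max' _ _ hk) hkN
        rw [sub_self, zero_pow (by omega), zero_smul]
      · exact fun h => absurd hNm h
    rw [← this]
    exact (hc.tendsto p).mono_left nhdsWithin_le_nhds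
  have t2 : Tendsto (fun σ => (σ - p) ^ (N + 1) • g σ) (𝓝[≠] p) (𝓝 0) := by
    have hc : ContinuousAt (fun σ => (σ - p) ^ (N + 1) • g σ) p :=
      ContinuousAt.smul (by fun_prop) hg.continuousAt
    have := hc.tendsto.mono_left (nhdsWithin_le_nhds (s := {p}ᶜ))
    simpa using this
  have t3 : (fun σ => (σ - p) ^ (N + 1) • g σ) =ᶠ[𝓝[≠] p]
      fun σ => a.sum fun k v => (σ - p) ^ (N - k) • v := by
    filter_upwards [e, self_mem_nhdsWithin] with σ hσ hσp
    rw [← hσ, principalSum_single, Finsupp.smul_sum]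
    refine Finsupp.sum_congr fun k hk => ?_
    have h0 : σ - p ≠ 0 := sub_ne_zero.2 hσp
    have hkN : k ≤ N := Finset.le_max' _ _ hk
    rw [smul_smul, inv_pow, show N + 1 = (N - k) + (k + 1) by omega, pow_add, mul_assoc,
      mul_inv_cancel₀ (pow_ne_zero _ h0), mul_one]
  have := tendsto_nhds_unique (t2.congr' t3) t1
  exact (Finsupp.mem_support_iff.1 hNm) this.symm

/-- The support condition is essential: principal parts at points outside `V` are holomorphic on `V`
and would go unnoticed. -/
theorem eq_zero_of_extendsHolomorphically_principalSum {V : Set ℂ} {c : ℂ →₀ ℕ →₀ E}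
    (hc : (c.support : Set ℂ) ⊆ V) (h : ExtendsHolomorphically V (principalSum c)) : c = 0 := by
  ext1 p
  by_cases hp : p ∈ V
  · exact eq_zero_of_extendsAt_principalSum (h p hp)
  · exact Finsupp.notMem_support_iff.1 fun h => hp (hc h)

theorem clm_principalSum (L : E →L[ℂ] F) (c : ℂ →₀ ℕ →₀ E) (σ : ℂ) :
    L (principalSum c σ) =
      principalSum (c.mapRange (Finsupp.mapRange L (map_zero L)) (by simp)) σ := by
  classical
  simp only [principalSum]
  rw [Finsupp.sum_mapRange_index (fun p => by simp), map_finsuppSum]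
  refine Finsupp.sum_congr fun p _ => ?_
  rw [Finsupp.sum_mapRange_index (fun p => by simp), map_finsuppSum]
  exact Finsupp.sum_congr fun k _ => by simp

/-! ### Singular parts -/

/-- The difference of two candidates is a sum of principal parts in `V` with removable
singularities, hence zero. Most later identities between singular parts are proved this way: both
sides are exhibited as the singular part of one function. -/
theorem IsSingularPart.unique {V : Set ℂ} {f g g' : ℂ → E} (h : IsSingularPart V f g)
    (h' : IsSingularPart V f g') : g = g' := by
  classical
  obtain ⟨c, hc, rfl, e⟩ := h
  obtain ⟨c', hc', rfl, e'⟩ := h'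
  have h0 : c' - c = 0 := by
    refine eq_zero_of_extendsHolomorphically_principalSum (V := V) (fun p hp => ?_) ?_
    · rcases Finset.mem_union.1 (Finsupp.support_sub hp) with h | h
      exacts [hc' h, hc h]
    · have := e.sub e'
      rw [principalSum_sub]
      rwa [sub_sub_sub_cancel_left] at this
  rw [sub_eq_zero.1 h0]

theorem IsSingularPart.singularPart_eq {V : Set ℂ} {f g : ℂ → E} (h : IsSingularPart V f g) :
    singularPart V f = g := by
  have : ∃ g, IsSingularPart V f g := ⟨g, h⟩
  rw [singularPart, dif_pos this]
  exact this.choose_spec.unique h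

namespace IsSingularPart

variable {V W : Set ℂ} {f f' g g' : ℂ → E}

theorem add (h : IsSingularPart V f g) (h' : IsSingularPart V f' g') :
    IsSingularPart V (f + f') (g + g') := by
  classical
  obtain ⟨c, hc, rfl, e⟩ := h
  obtain ⟨c', hc', rfl, e'⟩ := h'
  refine ⟨c + c', fun p hp => ?_, (principalSum_add c c').symm, ?_⟩
  · rcases Finset.mem_union.1 (Finsupp.support_add hp) with h | h
    exacts [hc h, hc' h]
  · rw [add_sub_add_comm]; exact e.add e'

theorem const_smul (z : ℂ) (h : IsSingularPart V f g) : IsSingularPart V (z • f) (z • g) := by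
  obtain ⟨c, hc, rfl, e⟩ := h
  exact ⟨z • c, fun p hp => hc (Finsupp.support_smul hp), (principalSum_smul z c).symm, by
    rw [← smul_sub]; exact e.smul z⟩

theorem of_extends (h : ExtendsHolomorphically V f) : IsSingularPart V f 0 :=
  ⟨0, by simp, principalSum_zero.symm, by rwa [sub_zero]⟩

theorem sum {ι : Type*} (s : Finset ι) {f g : ι → ℂ → E} (h : ∀ i ∈ s, IsSingularPart V (f i) (g i)) :
    IsSingularPart V (∑ i ∈ s, f i) (∑ i ∈ s, g i) := by
  classical
  induction s using Finset.induction_on with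
  | empty => exact of_extends fun p _ => ⟨0, analyticAt_const, EventuallyEq.rfl⟩
  | insert a s ha ih =>
    rw [Finset.sum_insert ha, Finset.sum_insert ha]
    exact (h a (by simp)).add (ih fun i hi => h i (by simp [hi]))

/-- Only the class of a function modulo functions holomorphic on `V` matters. -/
theorem congr_sub (h : IsSingularPart V f g) (e : ExtendsHolomorphically V (f' - f)) :
    IsSingularPart V f' g := by
  have := h.add (of_extends e)
  rwa [add_zero, add_sub_cancel] at this

theorem congr (h : IsSingularPart V f g) (e : ∀ p ∈ V, f' =ᶠ[𝓝[≠] p] f) :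
    IsSingularPart V f' g := by
  obtain ⟨c, hc, hg, e'⟩ := h
  exact ⟨c, hc, hg, fun p hp => ExtendsAt.congr (e' p hp) ((e p hp).sub EventuallyEq.rfl)⟩

theorem extends_sub (h : IsSingularPart V f g) : ExtendsHolomorphically V (f - g) := by
  obtain ⟨c, hc, hg, e'⟩ := h
  exact e'

theorem extends_of_zero (h : IsSingularPart V f 0) : ExtendsHolomorphically V f := by
  simpa using h.extends_sub

/-- Truncating before the multiplication discards only a holomorphic term, whose product with `u` is
again holomorphic. -/
theorem smul_of_analytic {u : ℂ → ℂ} {k : ℂ → E} (hu : ∀ p ∈ V, AnalyticAt ℂ u p)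
    (h : IsSingularPart V f g) (h' : IsSingularPart V (fun σ => u σ • g σ) k) :
    IsSingularPart V (fun σ => u σ • f σ) k :=
  h'.congr_sub fun p hp => ExtendsAt.congr (ExtendsAt.smul (hu p hp) (h.extends_sub p hp))
    (Eventually.of_forall fun σ => by simp [smul_sub])

theorem clm (L : E →L[ℂ] F) (h : IsSingularPart V f g) :
    IsSingularPart V (fun σ => L (f σ)) (fun σ => L (g σ)) := by
  obtain ⟨c, hc, rfl, e⟩ := h
  refine ⟨c.mapRange (Finsupp.mapRange L (map_zero L)) (by simp),
    fun p hp => hc (Finsupp.support_mapRange hp), funext fun σ => clm_principalSum L c σ, ?_⟩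
  intro p hp
  refine ExtendsAt.congr (ExtendsAt.clm L (e p hp)) (Eventually.of_forall fun σ => ?_)
  simp

theorem meromorphicAt (h : IsSingularPart V f g) {p : ℂ} (hp : p ∈ V) : MeromorphicAt f p := by
  obtain ⟨c, hc, rfl, e⟩ := h
  have := (ExtendsAt.meromorphicAt (e p hp)).add (meromorphicAt_principalSum c p)
  rwa [sub_add_cancel] at this

theorem principalSum {c : ℂ →₀ ℕ →₀ E} (hc : (c.support : Set ℂ) ⊆ V) :
    IsSingularPart V (principalSum c) (principalSum c) :=
  ⟨c, hc, rfl, fun p _ => by rw [sub_self]; exact ⟨0, analyticAt_const, EventuallyEq.rfl⟩⟩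

theorem self (h : IsSingularPart V f g) : IsSingularPart V g g := by
  obtain ⟨c, hc, rfl, e⟩ := h
  exact principalSum hc

/-- The singular part is holomorphic where the function is, and outside of the domain. -/
theorem analyticAt (h : IsSingularPart V f g) {p : ℂ} (hp : p ∈ V → ExtendsAt f p) :
    AnalyticAt ℂ g p := by
  obtain ⟨c, hc, rfl, e⟩ := h
  refine analyticAt_principalSum fun hpc => ?_
  have hpV := hc hpc
  have := (hp hpV).sub (e p hpV)
  rw [sub_sub_cancel] at this
  exact (Finsupp.mem_support_iff.1 hpc) (eq_zero_of_extendsAt_principalSum this)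

/-- The singular part over a larger set on which no further singularities occur. -/
theorem mono (h : IsSingularPart V f g) (hVW : V ⊆ W) (hf : ∀ p ∈ W \ V, ExtendsAt f p) :
    IsSingularPart W f g := by
  obtain ⟨c, hc, rfl, e⟩ := h
  refine ⟨c, hc.trans hVW, rfl, fun p hp => ?_⟩
  by_cases hpV : p ∈ V
  · exact e p hpV
  · exact ExtendsAt.sub (hf p ⟨hp, hpV⟩) (analyticAt_principalSum fun h => hpV (hc h)).extendsAt

end IsSingularPart

/-- Induction on the pole order, removing the leading term at each step. The vanishing of `a k` for
`n ≤ k` is what later bounds the dimension of the kernel space. -/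
theorem exists_principalPart_of_extendsAt {f : ℂ → E} {p : ℂ} {n : ℕ}
    (hn : ExtendsAt (fun z => (z - p) ^ n • f z) p) :
    ∃ a : ℕ →₀ E, (∀ k, n ≤ k → a k = 0) ∧
      ExtendsAt (f - principalSum (Finsupp.single p a)) p := by
  induction n generalizing f with
  | zero =>
    refine ⟨0, fun _ _ => rfl, ?_⟩
    simp only [pow_zero, one_smul] at hn
    rwa [Finsupp.single_zero, principalSum_zero, sub_zero]
  | succ n ih =>
    obtain ⟨g, hg, e⟩ := hn
    -- After removal of the leading term, `(z - p) ^ n` times the remainder is the difference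
    -- quotient of `g` at `p`, which is holomorphic there.
    have h1 : ExtendsAt (fun z => (z - p) ^ n •
        (f - principalSum (Finsupp.single p (Finsupp.single n (g p)))) z) p := by
      obtain ⟨q, hq⟩ := hg
      refine ⟨dslope g p, hq.has_fpower_series_dslope_fslope.analyticAt, ?_⟩
      filter_upwards [e, self_mem_nhdsWithin] with z hz hzp
      have h0 : z - p ≠ 0 := sub_ne_zero.2 hzp
      rw [dslope_of_ne _ hzp, slope_def_module, ← hz, Pi.sub_apply, principalSum_single,
        Finsupp.sum_single_index (by simp), smul_sub, smul_sub, smul_smul, smul_smul]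
      congr 2
      · field_simp
        ring
      · rw [inv_pow]
        field_simp
        ring
    obtain ⟨a, ha0, ha⟩ := ih h1
    refine ⟨Finsupp.single n (g p) + a, fun k hk => ?_, ?_⟩
    · rw [Finsupp.add_apply, ha0 k (by omega), Finsupp.single_eq_of_ne (by omega), add_zero]
    · rwa [Finsupp.single_add, principalSum_add, ← sub_sub]

theorem exists_principalPart {f : ℂ → E} {p : ℂ} (hf : MeromorphicAt f p) :
    ∃ a : ℕ →₀ E, ExtendsAt (f - principalSum (Finsupp.single p a)) p := by
  obtain ⟨n, hn⟩ := hf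
  obtain ⟨a, -, ha⟩ := exists_principalPart_of_extendsAt hn.extendsAt
  exact ⟨a, ha⟩

theorem exists_isSingularPart {V : Set ℂ} {f : ℂ → E} (Z : Finset ℂ) (hZ : (Z : Set ℂ) ⊆ V)
    (hf : ∀ p ∈ Z, MeromorphicAt f p) (hf' : ∀ p ∈ V, p ∉ Z → ExtendsAt f p) :
    ∃ g, IsSingularPart V f g := by
  classical
  choose a ha using fun p : Z => exists_principalPart (hf p p.2)
  let c : ℂ →₀ ℕ →₀ E := Finsupp.indicator Z fun p hp => a ⟨p, hp⟩
  have hc : c.support ⊆ Z := Finsupp.support_indicator_subset _ _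
  refine ⟨_, c, fun p hp => hZ (hc hp), rfl, fun p hp => ?_⟩
  by_cases hpZ : p ∈ Z
  · rw [principalSum_eq_add_erase c p, ← sub_sub]
    refine ExtendsAt.sub ?_ (analyticAt_principalSum (by simp)).extendsAt
    rw [show c p = a ⟨p, hpZ⟩ from Finsupp.indicator_of_mem hpZ _]
    exact ha ⟨p, hpZ⟩
  · exact (hf' p hp hpZ).sub (analyticAt_principalSum fun h => hpZ (hc h)).extendsAt

theorem singularPart_spec {V : Set ℂ} {f : ℂ → E} (h : ∃ g, IsSingularPart V f g) :
    IsSingularPart V f (singularPart V f) := by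
  obtain ⟨g, hg⟩ := h
  rwa [hg.singularPart_eq]

/-! ### Kernel spaces -/

/-- A holomorphic `Q` maps the discarded holomorphic part of `φ` to a holomorphic function, so an
element of the kernel space can serve as its own witness. This intrinsic description is used
throughout. -/
theorem mem_kernelSpace_iff {V : Set ℂ} {Q : ℂ → E →L[ℂ] F} (hQ : ∀ p ∈ V, AnalyticAt ℂ Q p)
    {g : ℂ → E} :
    g ∈ kernelSpace V Q ↔ IsSingularPart V g g ∧ ExtendsHolomorphically V (fun σ => Q σ (g σ)) := by
  constructor
  · rintro ⟨φ, hφ, hQφ, hs⟩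
    refine ⟨hs.self, fun p hp => ?_⟩
    refine ExtendsAt.congr (ExtendsAt.sub (hQφ p hp)
      (ExtendsAt.clm_apply (hQ p hp) (hs.extends_sub p hp))) (Eventually.of_forall fun σ => ?_)
    simp
  · rintro ⟨hs, he⟩
    exact ⟨g, fun p hp => hs.meromorphicAt hp, he, hs⟩

theorem singularPart_mem_kernelSpace {V : Set ℂ} {Q : ℂ → E →L[ℂ] F} {f g : ℂ → E}
    (h : IsSingularPart V f g) (hQ : ExtendsHolomorphically V (fun σ => Q σ (f σ))) :
    g ∈ kernelSpace V Q := ⟨f, fun _ hp => h.meromorphicAt hp, hQ, h⟩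

end SingularParts

/-! ### Jordan chains of a nilpotent endomorphism. -/

section Jordan

open Polynomial DirectSum

variable {V : Type*} [AddCommGroup V] [Module ℂ V]

/-- With `X` acting as `T`, the space is an `X`-power torsion module over the principal ideal domain
`ℂ[X]`, hence a direct sum of modules `ℂ[X] ⧸ (X ^ L j)`. The chains start at the classes of `1`.
Trivial summands with `L j = 0` are still possible here. -/
theorem exists_cyclic_generators [FiniteDimensional ℂ V] {T : Module.End ℂ V} (hT : IsNilpotent T) :
    ∃ (J : ℕ) (L : Fin J → ℕ) (v : Fin J → V), (∀ j, (T ^ L j) (v j) = 0) ∧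
      LinearIndependent ℂ (fun i : Σ j : Fin J, Fin (L j) => (T ^ (i.2 : ℕ)) (v i.1)) ∧
      ⊤ ≤ Submodule.span ℂ (range fun i : Σ j : Fin J, Fin (L j) => (T ^ (i.2 : ℕ)) (v i.1)) := by
  classical
  obtain ⟨N, hN⟩ := hT
  let M := Module.AEval' T
  let of := Module.AEval'.of T
  have hX : ∀ (n : ℕ) (x : V), (X ^ n : ℂ[X]) • of x = of ((T ^ n) x) := by
    intro n x
    induction n with
    | zero => simp
    | succ n ih =>
      rw [pow_succ', mul_smul, ih, Module.AEval'.X_smul_of, pow_succ', Module.End.mul_apply]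
  have htors : Module.IsTorsion' M (Submonoid.powers (X : ℂ[X])) := by
    intro x
    refine ⟨⟨X ^ N, N, rfl⟩, ?_⟩
    obtain ⟨x, rfl⟩ := of.surjective x
    change (X ^ N : ℂ[X]) • of x = 0
    rw [hX, hN]; simp
  obtain ⟨J, L, ⟨Φ⟩⟩ := Module.torsion_by_prime_power_decomposition (M := M)
    Polynomial.irreducible_X htors
  let w : Fin J → M := fun j =>
    Φ.symm (DirectSum.lof ℂ[X] (Fin J) (fun i => ℂ[X] ⧸ ℂ[X] ∙ (X : ℂ[X]) ^ L i) j
      (Submodule.Quotient.mk 1))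
  let v : Fin J → V := fun j => of.symm (w j)
  have hv : ∀ j (p : ℂ[X]), Φ (p • of (v j)) =
      DirectSum.lof ℂ[X] (Fin J) (fun i => ℂ[X] ⧸ ℂ[X] ∙ (X : ℂ[X]) ^ L i) j
        (Submodule.Quotient.mk p) := by
    intro j p
    rw [map_smul]
    simp only [v, w, LinearEquiv.apply_symm_apply]
    rw [← map_smul, ← Submodule.Quotient.mk_smul, smul_eq_mul, mul_one]
  refine ⟨J, L, v, fun j => ?_, ?_, ?_⟩
  · apply of.injective
    rw [← hX, map_zero]
    apply Φ.injective
    rw [hv, map_zero, (Submodule.Quotient.mk_eq_zero _).2 (Submodule.mem_span_singleton_self _),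
      map_zero]
  · rw [Fintype.linearIndependent_iff]
    rintro g hg ⟨j, l⟩
    -- Read in the `j`-th summand, a linear relation says that `X ^ L j` divides a polynomial of
    -- degree less than `L j`.
    have h1 : ∑ j, (∑ l : Fin (L j), C (g ⟨j, l⟩) * X ^ (l : ℕ)) • of (v j) = 0 := by
      have := congrArg of hg
      rw [map_zero, map_sum, Fintype.sum_sigma] at this
      rw [← this]
      refine Finset.sum_congr rfl fun j _ => ?_
      rw [Finset.sum_smul]
      refine Finset.sum_congr rfl fun l _ => ?_
      rw [mul_smul, hX, map_smul, ← Polynomial.algebraMap_eq, algebraMap_smul]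
    have h2 := congrArg (fun x => DirectSum.component ℂ[X] (Fin J)
      (fun i => ℂ[X] ⧸ ℂ[X] ∙ (X : ℂ[X]) ^ L i) j (Φ x)) h1
    simp only [map_sum, hv, map_zero] at h2
    rw [Finset.sum_eq_single j] at h2
    · rw [DirectSum.component.lof_self, Submodule.Quotient.mk_eq_zero,
        Submodule.mem_span_singleton] at h2
      obtain ⟨a, ha⟩ := h2
      have h3 : (X : ℂ[X]) ^ L j ∣ ∑ l : Fin (L j), C (g ⟨j, l⟩) * X ^ (l : ℕ) :=
        ⟨a, by rw [← ha, smul_eq_mul, mul_comm]⟩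
      have h4 := X_pow_dvd_iff.1 h3 l l.2
      rw [finsetSum_coeff, Finset.sum_eq_single l] at h4
      · simpa using h4
      · intro b _ hb
        rw [coeff_C_mul_X_pow, if_neg fun h => hb (Fin.ext h.symm)]
      · simp
    · intro b _ hb
      rw [DirectSum.component.of, dif_neg hb]
    · simp
  · rintro x -
    set S := Submodule.span ℂ (range fun i : Σ j : Fin J, Fin (L j) => (T ^ (i.2 : ℕ)) (v i.1))
    have key : ∀ y, of.symm (Φ.symm y) ∈ S := by
      intro y
      induction y using DirectSum.induction_on with
      | zero => simp
      | add a b ha hb => rw [map_add, map_add]; exact S.add_mem ha hb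
      | of j q =>
        obtain ⟨p, rfl⟩ := Submodule.Quotient.mk_surjective _ q
        -- Truncation of `p` below degree `L j`, a representative of the same class.
        let r : ℂ[X] := ∑ l : Fin (L j), C (p.coeff l) * X ^ (l : ℕ)
        have hpr : (Submodule.Quotient.mk p : ℂ[X] ⧸ ℂ[X] ∙ (X : ℂ[X]) ^ L j) =
            Submodule.Quotient.mk r := by
          rw [Submodule.Quotient.eq, Submodule.mem_span_singleton]
          have : (X : ℂ[X]) ^ L j ∣ p - r := by
            rw [X_pow_dvd_iff]
            intro d hd
            rw [coeff_sub, finsetSum_coeff, Finset.sum_eq_single (⟨d, hd⟩ : Fin (L j))]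
            · simp
            · intro b _ hb
              rw [coeff_C_mul_X_pow, if_neg fun h => hb (Fin.ext h.symm)]
            · simp
          obtain ⟨a, ha⟩ := this
          exact ⟨a, by rw [ha, smul_eq_mul, mul_comm]⟩
        have h1 : Φ.symm (DirectSum.of (fun i => ℂ[X] ⧸ ℂ[X] ∙ (X : ℂ[X]) ^ L i) j
            (Submodule.Quotient.mk p)) = r • of (v j) := by
          rw [hpr, LinearEquiv.symm_apply_eq, hv]; rfl
        have h2 : r • of (v j) = of (∑ l : Fin (L j), p.coeff l • (T ^ (l : ℕ)) (v j)) := by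
          rw [Finset.sum_smul, map_sum]
          refine Finset.sum_congr rfl fun l _ => ?_
          rw [mul_smul, hX, map_smul, ← Polynomial.algebraMap_eq, algebraMap_smul]
        rw [h1, h2, LinearEquiv.symm_apply_apply]
        exact S.sum_mem fun l _ => S.smul_mem _ (Submodule.subset_span ⟨⟨j, l⟩, rfl⟩)
    have := key (Φ (of x))
    rwa [LinearEquiv.symm_apply_apply, LinearEquiv.symm_apply_apply] at this

/-- A nilpotent endomorphism has a Jordan basis; the last vectors of the chains span its kernel,
and the first ones are independent modulo its range. -/
theorem exists_jordan_chains [FiniteDimensional ℂ V] {T : Module.End ℂ V} (hT : IsNilpotent T) :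
    ∃ (J : ℕ) (L : Fin J → ℕ) (v : Fin J → V), (∀ j, 0 < L j) ∧ (∀ j, (T ^ L j) (v j) = 0) ∧
      LinearIndependent ℂ (fun i : Σ j : Fin J, Fin (L j) => (T ^ (i.2 : ℕ)) (v i.1)) ∧
      ⊤ ≤ Submodule.span ℂ (range fun i : Σ j : Fin J, Fin (L j) => (T ^ (i.2 : ℕ)) (v i.1)) ∧
      (∀ x, T x = 0 → x ∈ Submodule.span ℂ (range fun j => (T ^ (L j - 1)) (v j))) ∧
      ∀ (a : Fin J → ℂ) (x : V), T x = ∑ j, a j • v j → a = 0 := by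
  classical
  obtain ⟨J', L', v', h0, hli, hsp⟩ := exists_cyclic_generators hT
  -- Summands of length zero are dropped, so that every chain has a last vector, at position `L j -
  -- 1`.
  let P := {j : Fin J' // 0 < L' j}
  let e : P ≃ Fin (Fintype.card P) := Fintype.equivFin P
  let L : Fin (Fintype.card P) → ℕ := fun j => L' (e.symm j)
  let v : Fin (Fintype.card P) → V := fun j => v' (e.symm j)
  let ψ : (Σ j, Fin (L j)) → (Σ j, Fin (L' j)) := fun i => ⟨e.symm i.1, i.2⟩
  have hψ : Function.Injective ψ := by
    rintro ⟨j, l⟩ ⟨j', l'⟩ h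
    simp only [ψ, Sigma.mk.injEq] at h
    have : j = j' := e.symm.injective (Subtype.ext h.1)
    subst this
    simpa using h
  have hψs : Function.Surjective ψ := by
    rintro ⟨j, l⟩
    obtain ⟨k, hk⟩ := e.symm.surjective ⟨j, (Nat.zero_le _).trans_lt l.2⟩
    have hk' : j = (e.symm k : Fin J') := by rw [hk]
    subst hk'
    exact ⟨⟨k, l⟩, rfl⟩
  have hli' : LinearIndependent ℂ (fun i : Σ j, Fin (L j) => (T ^ (i.2 : ℕ)) (v i.1)) :=
    hli.comp ψ hψ
  have hsp' : ⊤ ≤ Submodule.span ℂ (range fun i : Σ j, Fin (L j) => (T ^ (i.2 : ℕ)) (v i.1)) := by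
    refine hsp.trans (Submodule.span_mono ?_)
    rintro _ ⟨i, rfl⟩
    obtain ⟨k, rfl⟩ := hψs i
    exact ⟨k, rfl⟩
  let b := Module.Basis.mk hli' hsp'
  have hb : ∀ j (l : ℕ) (h : l < L j), b ⟨j, ⟨l, h⟩⟩ = (T ^ l) (v j) := fun j l h => by simp [b]
  have hL : ∀ j, 0 < L j := fun j => (e.symm j).2
  have hT0 : ∀ j, (T ^ L j) (v j) = 0 := fun j => h0 _
  have hTb : ∀ j (l : Fin (L j)), T (b ⟨j, l⟩) = (T ^ ((l : ℕ) + 1)) (v j) := fun j l => by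
    rw [pow_succ', Module.End.mul_apply, ← hb j l l.2]
  -- `T` shifts each chain by one place. Hence the coordinate at position `0` vanishes on the range
  -- of `T`, and the coordinate of `T x` at position `l + 1` is that of `x` at `l`. The first fact
  -- gives the claim on the range, the second the claim on the kernel.
  have hc0 : ∀ j, b.coord ⟨j, ⟨0, hL j⟩⟩ ∘ₗ T = 0 := fun j => by
    refine b.ext fun ⟨k, l⟩ => ?_
    rw [LinearMap.comp_apply, hTb]
    by_cases h : (l : ℕ) + 1 < L k
    · rw [← hb k _ h, Module.Basis.coord_apply, Module.Basis.repr_self, Finsupp.single_apply,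
        if_neg, LinearMap.zero_apply]
      intro h'
      obtain ⟨rfl, h'⟩ := Sigma.mk.inj h'
      simp at h'
    · rw [show (l : ℕ) + 1 = L k by omega, hT0]; simp
  have hc1 : ∀ j (l : ℕ) (h : l + 1 < L j),
      b.coord ⟨j, ⟨l + 1, h⟩⟩ ∘ₗ T = b.coord ⟨j, ⟨l, by omega⟩⟩ := fun j l h => by
    refine b.ext fun ⟨k, m⟩ => ?_
    rw [LinearMap.comp_apply, hTb, Module.Basis.coord_apply, Module.Basis.coord_apply,
      Module.Basis.repr_self, Finsupp.single_apply]
    by_cases h' : (m : ℕ) + 1 < L k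
    · rw [← hb k _ h', Module.Basis.repr_self, Finsupp.single_apply]
      congr 1
      simp only [eq_iff_iff, Sigma.mk.injEq]
      constructor
      · rintro ⟨rfl, h⟩
        simp only [heq_eq_eq, Fin.mk.injEq] at h
        exact ⟨rfl, by simp only [heq_eq_eq]; ext; simpa using h⟩
      · rintro ⟨rfl, h⟩
        simp only [heq_eq_eq] at h
        subst h
        exact ⟨rfl, by simp⟩
    · rw [show (m : ℕ) + 1 = L k by omega, hT0, map_zero, Finsupp.zero_apply, if_neg]
      intro h''
      obtain ⟨rfl, h2⟩ := Sigma.mk.inj h''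
      simp only [heq_eq_eq] at h2
      subst h2
      simp at h'
      omega
  refine ⟨_, L, v, hL, hT0, hli', hsp', fun x hx => ?_, fun a x hx => ?_⟩
  · rw [← b.sum_repr x]
    refine Submodule.sum_mem _ fun ⟨j, l⟩ _ => ?_
    by_cases h : (l : ℕ) + 1 < L j
    · have := LinearMap.congr_fun (hc1 j l h) x
      rw [LinearMap.comp_apply, hx, map_zero, Module.Basis.coord_apply] at this
      rw [← this, zero_smul]
      exact Submodule.zero_mem _
    · refine Submodule.smul_mem _ _ (Submodule.subset_span ⟨j, ?_⟩)
      have hl : L j - 1 = (l : ℕ) := by omega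
      simp only [hl]
      rw [← hb j l l.2]
  · funext j
    have h := LinearMap.congr_fun (hc0 j) x
    rw [LinearMap.comp_apply, hx, map_sum, Finset.sum_eq_single j] at h
    · have h1 : v j = b ⟨j, ⟨0, hL j⟩⟩ := by rw [hb]; simp
      rw [map_smul, h1, Module.Basis.coord_apply, Module.Basis.repr_self] at h
      simpa using h
    · intro k _ hk
      have h1 : v k = b ⟨k, ⟨0, hL k⟩⟩ := by rw [hb]; simp
      rw [map_smul, h1, Module.Basis.coord_apply, Module.Basis.repr_self, Finsupp.single_apply,
        if_neg, smul_zero]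
      intro h'
      exact hk (Sigma.mk.inj h').1
    · simp

end Jordan

/-! ### Meromorphy of inverses of holomorphic operator families. -/

section Inverse

variable {E F : Type*} [NormedAddCommGroup E] [NormedSpace ℂ E]
  [NormedAddCommGroup F] [NormedSpace ℂ F]

theorem analyticAt_inverse [CompleteSpace E] [CompleteSpace F] {A : ℂ → E →L[ℂ] F} {p : ℂ}
    (hA : AnalyticAt ℂ A p) (h : (A p).IsInvertible) :
    AnalyticAt ℂ (fun σ => (A σ).inverse) p := by
  have h1 : ContDiffAt ℂ ω (ContinuousLinearMap.inverse : (E →L[ℂ] F) → F →L[ℂ] E) (A p) :=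
    h.contDiffAt_map_inverse
  exact (h1.comp p hA.contDiffAt).analyticAt

theorem meromorphicAt_operator_apply {A : ℂ → E →L[ℂ] F} {f : ℂ → E} {p : ℂ}
    (hA : MeromorphicAt A p) (hf : MeromorphicAt f p) : MeromorphicAt (fun σ => A σ (f σ)) p := by
  obtain ⟨n, hn⟩ := hA
  obtain ⟨m, hm⟩ := hf
  refine ⟨n + m, (hn.operator_apply hm).congr (Eventually.of_forall fun σ => ?_)⟩
  simp [smul_smul, pow_add, mul_comm]

/-- One invertible value near `p` identifies `F` with `E`; Cramer's rule then writes the inverse as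
adjugate over determinant, both with holomorphic entries. -/
theorem meromorphicAt_inverse [FiniteDimensional ℂ E] {A : ℂ → E →L[ℂ] F} {p : ℂ}
    (hA : AnalyticAt ℂ A p) (h : ∀ᶠ σ in 𝓝[≠] p, (A σ).IsInvertible) :
    MeromorphicAt (fun σ => (A σ).inverse) p := by
  classical
  obtain ⟨σ₀, e₀, -⟩ := h.exists
  let b := Module.finBasis ℂ E
  let M : ℂ → Matrix _ _ ℂ := fun σ =>
    LinearMap.toMatrix b b ((e₀.symm : F →L[ℂ] E) ∘L A σ : E →L[ℂ] E)
  have hM : ∀ i j, AnalyticAt ℂ (fun σ => M σ i j) p := by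
    intro i j
    have : ∀ σ, M σ i j = (LinearMap.toContinuousLinearMap (b.coord i))
        ((e₀.symm : F →L[ℂ] E) (A σ (b j))) := fun σ => by
      simp [M, LinearMap.toMatrix_apply]
    simp only [this]
    exact ((((LinearMap.toContinuousLinearMap (b.coord i)) ∘L
      (e₀.symm : F →L[ℂ] E)).analyticAt _).comp (hA.operator_apply analyticAt_const))
  have hdet : ∀ N : ℂ → Matrix (Fin (Module.finrank ℂ E)) (Fin (Module.finrank ℂ E)) ℂ,
      (∀ i j, AnalyticAt ℂ (fun σ => N σ i j) p) → AnalyticAt ℂ (fun σ => (N σ).det) p := by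
    intro N hN
    simp only [Matrix.det_apply]
    refine Finset.analyticAt_fun_sum _ fun π _ => ?_
    have : AnalyticAt ℂ (fun σ => ∏ i, N σ (π i) i) p :=
      Finset.analyticAt_fun_prod _ fun i _ => hN _ _
    simp only [Units.smul_def, zsmul_eq_mul]
    exact analyticAt_const.mul this
  have hadj : ∀ i j, AnalyticAt ℂ (fun σ => (M σ).adjugate i j) p := by
    intro i j
    simp only [Matrix.adjugate_apply]
    refine hdet _ fun k l => ?_
    by_cases hk : k = j
    · subst hk; simp only [Matrix.updateRow_self]; exact analyticAt_const
    · simp only [Matrix.updateRow_ne hk]; exact hM k l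
  let L : Matrix (Fin (Module.finrank ℂ E)) (Fin (Module.finrank ℂ E)) ℂ →ₗ[ℂ] (F →L[ℂ] E) :=
    { toFun := fun N => LinearMap.toContinuousLinearMap (Matrix.toLin b b N) ∘L
        (e₀.symm : F →L[ℂ] E)
      map_add' := fun N N' => by ext; simp
      map_smul' := fun c N => by ext; simp }
  -- Expansion in matrix units reduces meromorphy of the operator-valued function to that of scalar
  -- entries.
  have hsum : ∀ N, L N = ∑ i, ∑ j, N i j • L (Matrix.single i j 1) := fun N => by
    conv_lhs => rw [Matrix.matrix_eq_sum_single N]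
    simp only [map_sum]
    refine Finset.sum_congr rfl fun i _ => Finset.sum_congr rfl fun j _ => ?_
    rw [← map_smul, Matrix.smul_single, smul_eq_mul, mul_one]
  have hmer : MeromorphicAt (fun σ => L ((M σ).det⁻¹ • (M σ).adjugate)) p := by
    rw [funext fun σ => hsum ((M σ).det⁻¹ • (M σ).adjugate)]
    simp only [Matrix.smul_apply, smul_eq_mul]
    refine MeromorphicAt.fun_sum fun i _ => MeromorphicAt.fun_sum fun j _ => ?_
    exact (((hdet M hM).meromorphicAt.inv.mul (hadj i j).meromorphicAt)).smul
      (MeromorphicAt.const _ _)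
  refine hmer.congr ?_
  filter_upwards [h] with σ hσ
  obtain ⟨e, he⟩ := hσ
  let B : E ≃L[ℂ] E := e.trans e₀.symm
  have hMB : M σ = LinearMap.toMatrix b b (B : E →ₗ[ℂ] E) := by
    simp only [M, ← he]; rfl
  have h1 : LinearMap.toMatrix b b (B.symm : E →ₗ[ℂ] E) * M σ = 1 := by
    rw [hMB, ← LinearMap.toMatrix_comp, ← LinearMap.toMatrix_id b]
    congr 1
    ext x; simp
  have h2 : (M σ).det⁻¹ • (M σ).adjugate = LinearMap.toMatrix b b (B.symm : E →ₗ[ℂ] E) := by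
    rw [← Matrix.inv_eq_left_inv h1, Matrix.inv_def, Ring.inverse_eq_inv']
  rw [h2, ← he]
  ext x
  simp [L, B]

theorem exists_isSingularPart_inverse_apply [FiniteDimensional ℂ E] [CompleteSpace F] {A : ℂ → E →L[ℂ] F}
    {V : Set ℂ} {Z : Set ℂ} (hV : IsOpen V) (hZ : Z.Finite) (hA : ∀ p ∈ V, AnalyticAt ℂ A p)
    (hinv : ∀ p ∈ V, p ∉ Z → (A p).IsInvertible) {b : ℂ → F} (hb : ∀ p ∈ V, AnalyticAt ℂ b p) :
    ∃ g, IsSingularPart V (fun σ => (A σ).inverse (b σ)) g := by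
  classical
  have : CompleteSpace E := FiniteDimensional.complete ℂ E
  have hZV : (Z ∩ V).Finite := hZ.subset inter_subset_left
  refine exists_isSingularPart hZV.toFinset (by simp) (fun p hp => ?_) fun p hp hpZ => ?_
  · have hpV : p ∈ V := by simp at hp; exact hp.2
    refine meromorphicAt_operator_apply (meromorphicAt_inverse (hA p hpV) ?_) (hb p hpV).meromorphicAt
    have h1 : ∀ᶠ σ in 𝓝[≠] p, σ ∈ V := nhdsWithin_le_nhds (hV.mem_nhds hpV)
    have h2 : ∀ᶠ σ in 𝓝[≠] p, σ ∉ Z := by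
      have h3 : (Z \ {p})ᶜ ∈ 𝓝 p :=
        (hZ.subset sdiff_subset).isClosed.isOpen_compl.mem_nhds (by simp)
      filter_upwards [nhdsWithin_le_nhds h3, self_mem_nhdsWithin] with σ h h' hσ
      exact h ⟨hσ, h'⟩
    filter_upwards [h1, h2] with σ h h' using hinv σ h h'
  · have : p ∉ Z := fun h => hpZ (by simp [h, hp])
    exact ((analyticAt_inverse (hA p hp) (hinv p hp this)).operator_apply (hb p hp)).extendsAt

end Inverse

/-! ### Multiplication operators on kernel spaces and the construction of root functions. -/

section Shift

variable {E F : Type*} [NormedAddCommGroup E] [NormedSpace ℂ E]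
  [NormedAddCommGroup F] [NormedSpace ℂ F]

theorem IsSingularPart.exists_smul {V : Set ℂ} {f g : ℂ → E} (h : IsSingularPart V f g)
    {u : ℂ → ℂ} (hu : ∀ p ∈ V, AnalyticAt ℂ u p) :
    ∃ k, IsSingularPart V (fun σ => u σ • f σ) k := by
  have h' := h
  obtain ⟨c, hc, rfl, e⟩ := h'
  refine exists_isSingularPart c.support hc (fun p hp => ?_) fun p hp hpc => ?_
  · exact (hu p (hc hp)).meromorphicAt.smul (h.meromorphicAt (hc hp))
  · refine ExtendsAt.smul (hu p hp) ?_
    have := ExtendsAt.add (e p hp) (analyticAt_principalSum hpc).extendsAt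
    rwa [sub_add_cancel] at this

theorem eventually_isInvertible {X : Type*} [TopologicalSpace X] [CompleteSpace E]
    {A : X → E →L[ℂ] F} {p : X}
    (hA : ContinuousAt A p) (h : (A p).IsInvertible) : ∀ᶠ σ in 𝓝 p, (A σ).IsInvertible := by
  obtain ⟨e, he⟩ := h
  have h1 : range ((↑) : (E ≃L[ℂ] F) → E →L[ℂ] F) ∈ 𝓝 (A p) := by
    rw [← he]; exact e.nhds
  exact hA.tendsto h1

/-- Applying the holomorphic inverse recovers `f` from `A f`. Consequently elements of a kernel
space can have poles only where the operator is not invertible. -/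
theorem extendsAt_of_apply [CompleteSpace E] [CompleteSpace F] {A : ℂ → E →L[ℂ] F} {f : ℂ → E}
    {p : ℂ} (hA : AnalyticAt ℂ A p) (h : (A p).IsInvertible)
    (hf : ExtendsAt (fun σ => A σ (f σ)) p) : ExtendsAt f p := by
  refine (ExtendsAt.clm_apply (analyticAt_inverse hA h) hf).congr ?_
  filter_upwards [(eventually_isInvertible hA.continuousAt h).filter_mono nhdsWithin_le_nhds]
    with σ hσ
  rw [hσ.inverse_apply_self]

variable {V : Set ℂ} {Q : ℂ → E →L[ℂ] F}

/-- Multiplication by a holomorphic function on a kernel space, followed by `𝔰`. -/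
def kernelSpaceMul (hQ : ∀ p ∈ V, AnalyticAt ℂ Q p) (u : ℂ → ℂ) (hu : ∀ p ∈ V, AnalyticAt ℂ u p) :
    Module.End ℂ (kernelSpace V Q) where
  toFun g := ⟨singularPart V fun σ => u σ • (g : ℂ → E) σ, by
    obtain ⟨h1, h2⟩ := (mem_kernelSpace_iff hQ).1 g.2
    refine singularPart_mem_kernelSpace (singularPart_spec (h1.exists_smul hu)) fun p hp => ?_
    exact (ExtendsAt.smul (hu p hp) (h2 p hp)).congr (Eventually.of_forall fun σ => by simp)⟩
  map_add' g g' := by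
    obtain ⟨h1, -⟩ := (mem_kernelSpace_iff hQ).1 g.2
    obtain ⟨h1', -⟩ := (mem_kernelSpace_iff hQ).1 g'.2
    ext1
    refine IsSingularPart.singularPart_eq ?_
    refine ((singularPart_spec (h1.exists_smul hu)).add
      (singularPart_spec (h1'.exists_smul hu))).congr fun p _ => Eventually.of_forall fun σ => ?_
    simp
  map_smul' z g := by
    obtain ⟨h1, -⟩ := (mem_kernelSpace_iff hQ).1 g.2
    ext1
    refine IsSingularPart.singularPart_eq ?_
    refine ((singularPart_spec (h1.exists_smul hu)).const_smul z).congr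
      fun p _ => Eventually.of_forall fun σ => ?_
    simp [smul_comm z]

theorem isSingularPart_kernelSpaceMul (hQ : ∀ p ∈ V, AnalyticAt ℂ Q p) (u : ℂ → ℂ)
    (hu : ∀ p ∈ V, AnalyticAt ℂ u p) (g : kernelSpace V Q) :
    IsSingularPart V (fun σ => u σ • (g : ℂ → E) σ) (kernelSpaceMul hQ u hu g : ℂ → E) :=
  singularPart_spec (((mem_kernelSpace_iff hQ).1 g.2).1.exists_smul hu)

/-- The truncations between successive multiplications discard only holomorphic terms, so a single
truncation at the end gives the same result. -/
theorem isSingularPart_kernelSpaceMul_pow (hQ : ∀ p ∈ V, AnalyticAt ℂ Q p) (u : ℂ → ℂ)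
    (hu : ∀ p ∈ V, AnalyticAt ℂ u p) (g : kernelSpace V Q) (n : ℕ) :
    IsSingularPart V (fun σ => u σ ^ n • (g : ℂ → E) σ)
      ((kernelSpaceMul hQ u hu ^ n) g : kernelSpace V Q) := by
  induction n with
  | zero => simpa using ((mem_kernelSpace_iff hQ).1 g.2).1
  | succ n ih =>
    rw [pow_succ', Module.End.mul_apply]
    have := ih.smul_of_analytic hu (isSingularPart_kernelSpaceMul hQ u hu _)
    simpa [smul_smul, pow_succ'] using this

/-! ### Canonical systems of root functions exist -/

variable {s : ℂ} {ε : ℝ}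

theorem eq_principalSum_single_of_mem_kernelSpace [CompleteSpace E] [CompleteSpace F]
    (hQ : ∀ p ∈ V, AnalyticAt ℂ Q p) (hinv : ∀ p ∈ V, p ≠ s → (Q p).IsInvertible) {g : ℂ → E}
    (hg : g ∈ kernelSpace V Q) : ∃ a : ℕ →₀ E, g = principalSum (Finsupp.single s a) := by
  obtain ⟨⟨c, hc, hgc, -⟩, h2⟩ := (mem_kernelSpace_iff hQ).1 hg
  refine ⟨c s, ?_⟩
  rw [hgc]
  congr 1
  ext1 p
  by_cases hp : p = s
  · rw [hp, Finsupp.single_eq_same]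
  · rw [Finsupp.single_eq_of_ne hp]
    by_contra h
    have hpV : p ∈ V := hc (Finsupp.mem_support_iff.2 h)
    refine h (eq_zero_of_extendsAt_principalSum ?_)
    rw [← hgc]
    exact extendsAt_of_apply (hQ p hpV) (hinv p hpV hp) (h2 p hpV)

/-- The principal part `(σ - s)⁻¹ v` with simple pole. -/
def simplePole (s : ℂ) : E →ₗ[ℂ] (ℂ → E) where
  toFun v := fun σ => (σ - s)⁻¹ • v
  map_add' v w := by ext; simp
  map_smul' z v := by ext; simp [smul_comm z]

theorem simplePole_eq (v : E) :
    simplePole s v = principalSum (Finsupp.single s (Finsupp.single 0 v)) := by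
  ext σ
  rw [principalSum_single, Finsupp.sum_single_index (by simp)]
  simp [simplePole]

/-- The exponent bounds the pole order of `Q⁻¹` at `s`, uniformly in `f`. It yields both finite
dimension of the kernel space and nilpotency of multiplication by `σ - s`. -/
theorem exists_pow_smul_extendsAt [FiniteDimensional ℂ E] [CompleteSpace F]
    (hV : IsOpen V) (hs : s ∈ V)
    (hQ : ∀ p ∈ V, AnalyticAt ℂ Q p) (hinv : ∀ p ∈ V, p ≠ s → (Q p).IsInvertible) :
    ∃ N : ℕ, ∀ f : ℂ → E, ExtendsAt (fun σ => Q σ (f σ)) s →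
      ExtendsAt (fun σ => (σ - s) ^ N • f σ) s := by
  have hev : ∀ᶠ σ in 𝓝[≠] s, (Q σ).IsInvertible := by
    filter_upwards [nhdsWithin_le_nhds (hV.mem_nhds hs), self_mem_nhdsWithin] with σ h h'
      using hinv σ h h'
  obtain ⟨N, hN⟩ := meromorphicAt_inverse (hQ s hs) hev
  refine ⟨N, fun f hf => (ExtendsAt.clm_apply hN hf).congr ?_⟩
  filter_upwards [hev] with σ hσ
  simp [hσ.inverse_apply_self]

theorem finiteDimensional_kernelSpace [FiniteDimensional ℂ E] [CompleteSpace F]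
    (hV : IsOpen V) (hs : s ∈ V)
    (hQ : ∀ p ∈ V, AnalyticAt ℂ Q p) (hinv : ∀ p ∈ V, p ≠ s → (Q p).IsInvertible) :
    FiniteDimensional ℂ (kernelSpace V Q) := by
  have : CompleteSpace E := FiniteDimensional.complete ℂ E
  obtain ⟨N, hN⟩ := exists_pow_smul_extendsAt hV hs hQ hinv
  let Φ : (Fin N → E) →ₗ[ℂ] (ℂ → E) :=
    { toFun := fun a σ => ∑ k : Fin N, ((σ - s)⁻¹) ^ ((k : ℕ) + 1) • a k
      map_add' := fun a b => by ext; simp [Finset.sum_add_distrib]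
      map_smul' := fun z a => by ext; simp [Finset.smul_sum, smul_comm z] }
  refine Submodule.finiteDimensional_of_le (S₂ := LinearMap.range Φ) fun g hg => ?_
  obtain ⟨h1, h2⟩ := (mem_kernelSpace_iff hQ).1 hg
  obtain ⟨a, ha⟩ := eq_principalSum_single_of_mem_kernelSpace hQ hinv hg
  obtain ⟨b, hb0, hb⟩ := exists_principalPart_of_extendsAt (hN g (h2 s hs))
  have hab : a = b := by
    rw [ha, ← principalSum_sub, ← Finsupp.single_sub] at hb
    have := eq_zero_of_extendsAt_principalSum hb
    rw [Finsupp.single_eq_same] at this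
    exact sub_eq_zero.1 this
  refine ⟨fun k => a k, funext fun σ => ?_⟩
  rw [ha, principalSum_single, Finsupp.sum_of_support_subset (s := Finset.range N)]
  · exact (Finset.sum_range fun k => ((σ - s)⁻¹) ^ (k + 1) • a k).symm
  · intro k hk
    by_contra h
    exact (Finsupp.mem_support_iff.1 hk) (hab ▸ hb0 k (by simpa using h))
  · simp

/-- The root functions are the first vectors of Jordan chains of multiplication by `σ - s` on the
kernel space. The last vectors of the chains span the kernel of this operator, which contains all
simple poles `(σ - s)⁻¹ v`; their residues therefore form a basis of `E`. Independence of the first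
vectors modulo the range gives independence of the `β_j` at `s`. -/
theorem exists_canonicalSystem [FiniteDimensional ℂ E] [CompleteSpace F] (hε : 0 < ε)
    (hQ : ∀ p ∈ Metric.ball s ε, AnalyticAt ℂ Q p)
    (hinv : ∀ p ∈ Metric.ball s ε, p ≠ s → (Q p).IsInvertible) (h0 : Q s = 0) :
    Nonempty (CanonicalSystem Q s ε) := by
  classical
  have : CompleteSpace E := FiniteDimensional.complete ℂ E
  set V := Metric.ball s ε with hVdef
  have hV : IsOpen V := Metric.isOpen_ball
  have hs : s ∈ V := Metric.mem_ball_self hε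
  have hfd := finiteDimensional_kernelSpace hV hs hQ hinv
  have hu : ∀ p ∈ V, AnalyticAt ℂ (fun σ : ℂ => σ - s) p := fun p _ =>
    analyticAt_id.sub analyticAt_const
  let T := kernelSpaceMul hQ (fun σ => σ - s) hu
  have hT : ∀ (n : ℕ) (g : kernelSpace V Q), IsSingularPart V (fun σ => (σ - s) ^ n • (g : ℂ → E) σ)
      ((T ^ n) g : kernelSpace V Q) :=
    fun n g => isSingularPart_kernelSpaceMul_pow hQ _ hu g n
  have hK : ∀ g : kernelSpace V Q, IsSingularPart V (g : ℂ → E) g ∧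
      ExtendsHolomorphically V (fun σ => Q σ ((g : ℂ → E) σ)) := fun g =>
    (mem_kernelSpace_iff hQ).1 g.2
  have hsing : ∀ g : kernelSpace V Q, ∃ a : ℕ →₀ E,
      (g : ℂ → E) = principalSum (Finsupp.single s a) := fun g =>
    eq_principalSum_single_of_mem_kernelSpace hQ hinv g.2
  have han : ∀ (g : kernelSpace V Q) (σ : ℂ), σ ≠ s → AnalyticAt ℂ (g : ℂ → E) σ := by
    intro g σ hσ
    obtain ⟨a, ha⟩ := hsing g
    rw [ha]
    refine analyticAt_principalSum fun h => hσ ?_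
    simpa using Finsupp.support_single_subset h
  obtain ⟨N, hN⟩ := exists_pow_smul_extendsAt hV hs hQ hinv
  have hnil : IsNilpotent T := by
    refine ⟨N, LinearMap.ext fun g => Subtype.ext ?_⟩
    refine (hT N g).unique (IsSingularPart.of_extends fun p hp => ?_)
    by_cases hps : p = s
    · rw [hps]; exact hN _ ((hK g).2 s hs)
    · exact ExtendsAt.smul ((analyticAt_id.sub analyticAt_const).pow N) (han g p hps).extendsAt
  obtain ⟨J, L, φ, hL, hTL, hli, hsp, hker, hran⟩ := exists_jordan_chains hnil
  -- leading coefficients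
  have hext : ∀ j, ∃ h : ℂ → E, AnalyticAt ℂ h s ∧
      (fun σ => (σ - s) ^ L j • (φ j : ℂ → E) σ) =ᶠ[𝓝[≠] s] h := fun j => by
    have := hT (L j) (φ j)
    rw [hTL] at this
    exact this.extends_of_zero s hs
  choose h hh hφh using hext
  -- The last vector of a chain is the truncation of `(σ - s) ^ (L j - 1) φ_j`: a simple pole whose
  -- residue is the leading coefficient of `φ_j`.
  have hlast : ∀ j, ((T ^ (L j - 1)) (φ j) : ℂ → E) = simplePole s (h j s) := by
    intro j
    refine (hT _ _).unique ?_
    rw [simplePole_eq]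
    refine (IsSingularPart.principalSum fun p hp => ?_).congr_sub fun p hp => ?_
    · have := Finsupp.support_single_subset hp
      simp only [Finset.mem_singleton] at this
      exact this ▸ hs
    · by_cases hps : p = s
      · subst hps
        refine (extendsAt_inv_smul (f := fun σ => h j σ - h j p) ((hh j).sub analyticAt_const)
          (sub_self _)).congr ?_
        filter_upwards [hφh j, self_mem_nhdsWithin] with σ hσ hσp
        have h0 : σ - p ≠ 0 := sub_ne_zero.2 hσp
        rw [← simplePole_eq, ← hσ, smul_sub, smul_smul]
        simp only [Pi.sub_apply, simplePole, LinearMap.coe_mk, AddHom.coe_mk]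
        congr 2
        rw [← Nat.sub_add_cancel (hL j), pow_succ, Nat.add_sub_cancel]
        field_simp
      · refine ExtendsAt.sub ?_ (analyticAt_principalSum fun h => hps ?_).extendsAt
        · exact ExtendsAt.smul ((analyticAt_id.sub analyticAt_const).pow _) (han _ p hps).extendsAt
        · simpa using Finsupp.support_single_subset h
  -- Since `Q s = 0`, the factor `(σ - s)⁻¹` is absorbed for every `v`.
  have hsimple : ∀ v : E, simplePole s v ∈ kernelSpace V Q := by
    intro v
    rw [mem_kernelSpace_iff hQ]
    constructor
    · rw [simplePole_eq]
      refine IsSingularPart.principalSum fun p hp => ?_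
      have := Finsupp.support_single_subset hp
      simp only [Finset.mem_singleton] at this
      exact this ▸ hs
    · intro p hp
      by_cases hps : p = s
      · subst hps
        refine (extendsAt_inv_smul ((hQ p hp).operator_apply (analyticAt_const (v := v)))
          (by rw [h0]; simp)).congr (Eventually.of_forall fun σ => ?_)
        simp [simplePole]
      · refine ExtendsAt.clm_apply (hQ p hp) (AnalyticAt.extendsAt ?_)
        rw [simplePole_eq]
        exact analyticAt_principalSum fun h => hps (by simpa using Finsupp.support_single_subset h)
  let r : E →ₗ[ℂ] kernelSpace V Q := (simplePole s).codRestrict _ hsimple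
  have hr : Function.Injective r := by
    intro v w hvw
    have h1 : simplePole s v = simplePole s w := congrArg Subtype.val hvw
    have := congrFun h1 (s + 1)
    simpa [simplePole] using this
  have hrφ : ∀ j, (T ^ (L j - 1)) (φ j) = r (h j s) := fun j => Subtype.ext (hlast j)
  have hTr : ∀ v, T (r v) = 0 := by
    intro v
    have h1 := hT 1 (r v)
    rw [pow_one] at h1
    refine Subtype.ext (h1.unique (IsSingularPart.of_extends fun p _ => ?_))
    refine (analyticAt_const (v := v)).extendsAt.congr ?_
    have : ∀ᶠ σ in 𝓝[≠] p, σ ≠ s := by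
      by_cases hps : p = s
      · rw [hps]; exact self_mem_nhdsWithin
      · exact nhdsWithin_le_nhds (isOpen_ne.mem_nhds hps)
    filter_upwards [this] with σ hσ
    have h0 : σ - s ≠ 0 := sub_ne_zero.2 hσ
    simp [r, simplePole, smul_smul, mul_inv_cancel₀ h0]
  have hli1 : LinearIndependent ℂ fun j => (T ^ (L j - 1)) (φ j) :=
    hli.comp (fun j => ⟨j, ⟨L j - 1, Nat.sub_lt (hL j) one_pos⟩⟩)
      fun j j' e => (Sigma.mk.inj e).1
  have hli2 : LinearIndependent ℂ fun j => h j s := by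
    refine LinearIndependent.of_comp r ?_
    convert hli1 using 1
    funext j
    exact (hrφ j).symm
  have hsp2 : ⊤ ≤ Submodule.span ℂ (range fun j => h j s) := by
    rintro v -
    have h1 := hker (r v) (hTr v)
    have h2 : (range fun j => (T ^ (L j - 1)) (φ j)) = r '' range fun j => h j s := by
      rw [← range_comp]
      congr 1
      funext j
      exact hrφ j
    rw [h2, ← Submodule.map_span] at h1
    obtain ⟨w, hw, hwv⟩ := h1
    rwa [← hr hwv]
  let b := Module.Basis.mk hli2 hsp2
  have hβ : ∀ j, ∃ β : ℂ → F, AnalyticOnNhd ℂ β V ∧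
      ∀ σ ∈ V, σ ≠ s → β σ = Q σ ((φ j : ℂ → E) σ) := by
    intro j
    obtain ⟨β, hβ, hβ'⟩ := (hK (φ j)).2.exists_analyticOnNhd
    exact ⟨β, hβ, fun σ hσ hσs => hβ' σ hσ
      ((hQ σ hσ).operator_apply (han (φ j) σ hσs)).continuousAt⟩
  choose β hβ hβ' using hβ
  have hliβ : LinearIndependent ℂ fun j => β j s := by
    rw [Fintype.linearIndependent_iff]
    intro a ha
    -- If `∑ a_j β_j` vanishes at `s`, then `(σ - s)⁻¹ ∑ a_j φ_j` is still mapped by `Q` to a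
    -- holomorphic function. Its singular part lies in the kernel space and `T` sends it to `∑ a_j
    -- φ_j`, which forces `a = 0`.
    have hgex : ∃ g, IsSingularPart V
        (fun σ => (σ - s)⁻¹ • (∑ j, a j • φ j : kernelSpace V Q).1 σ) g := by
      refine exists_isSingularPart {s} (by simpa using hs) (fun p hp => ?_) fun p hp hps => ?_
      · refine MeromorphicAt.smul (((MeromorphicAt.id p).sub (MeromorphicAt.const s p)).inv) ?_
        rw [Finset.mem_singleton.1 hp]
        exact (hK _).1.meromorphicAt hs
      · have hps : p ≠ s := by simpa using hps
        exact ExtendsAt.smul ((analyticAt_id.sub analyticAt_const).inv (sub_ne_zero.2 hps))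
          (han _ p hps).extendsAt
    obtain ⟨g, hg⟩ := hgex
    have hgK : g ∈ kernelSpace V Q := by
      refine singularPart_mem_kernelSpace hg fun p hp => ?_
      by_cases hps : p = s
      · subst hps
        refine (extendsAt_inv_smul (f := fun σ => ∑ j, a j • β j σ)
          (Finset.analyticAt_fun_sum _ fun j _ => analyticAt_const.smul (hβ j p hp)) ha).congr ?_
        filter_upwards [nhdsWithin_le_nhds (hV.mem_nhds hp), self_mem_nhdsWithin] with σ hσ hσp
        have : (∑ j, a j • φ j : kernelSpace V Q).1 σ = ∑ j, a j • (φ j : ℂ → E) σ := by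
          simp
        rw [this, map_smul, map_sum]
        congr 1
        refine Finset.sum_congr rfl fun j _ => ?_
        rw [map_smul, hβ' j σ hσ hσp]
      · exact ExtendsAt.clm_apply (hQ p hp) (ExtendsAt.smul
          ((analyticAt_id.sub analyticAt_const).inv (sub_ne_zero.2 hps)) (han _ p hps).extendsAt)
    have hTg : T ⟨g, hgK⟩ = ∑ j, a j • φ j := by
      refine Subtype.ext ?_
      have h1 := hT 1 ⟨g, hgK⟩
      rw [pow_one] at h1
      have h2 := hg.smul_of_analytic (u := fun σ => (σ - s) ^ 1)
        (fun p _ => (analyticAt_id.sub analyticAt_const).pow 1) h1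
      refine h2.unique ((hK (∑ j, a j • φ j)).1.congr fun p _ => ?_)
      have : ∀ᶠ σ in 𝓝[≠] p, σ ≠ s := by
        by_cases hps : p = s
        · rw [hps]; exact self_mem_nhdsWithin
        · exact nhdsWithin_le_nhds (isOpen_ne.mem_nhds hps)
      filter_upwards [this] with σ hσ
      rw [smul_smul, pow_one, mul_inv_cancel₀ (sub_ne_zero.2 hσ), one_smul]
    exact congrFun (hran a _ hTg)
  -- Any point of the punctured disc would do; invertibility of `Q` there shows that `F` has the
  -- dimension of `E`.
  have hdim : ∃ bF : Module.Basis (Fin J) ℂ F, ∀ j, bF j = β j s := by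
    have hp : s + (ε / 2 : ℝ) ∈ V := by
      simp [hVdef, abs_of_pos hε, hε]
    have hps : s + (ε / 2 : ℝ) ≠ s := by
      simp [hε.ne']
    obtain ⟨e, -⟩ := hinv _ hp hps
    have : FiniteDimensional ℂ F := e.toLinearEquiv.finiteDimensional
    have hc : Fintype.card (Fin J) = Module.finrank ℂ F := by
      rw [← e.toLinearEquiv.finrank_eq, Module.finrank_eq_card_basis b]
    exact ⟨basisOfLinearIndependentOfCardEqFinrank' _ hliβ hc, fun j => by simp⟩
  refine ⟨{
      J := J
      L := L
      L_pos := hL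
      φ := fun j => φ j
      mem := fun j => (φ j).2
      analyticAt := fun j σ hσ => han _ σ hσ
      order := fun j => ?_
      basis := ?_
      leading := ⟨b, fun j => ?_⟩
      β := β
      β_analytic := hβ
      β_eq := hβ'
      β_basis := hdim }⟩
  · rw [meromorphicOrderAt_eq_int_iff ((hK (φ j)).1.meromorphicAt hs)]
    refine ⟨h j, hh j, hli2.ne_zero j, ?_⟩
    filter_upwards [hφh j, self_mem_nhdsWithin] with σ hσ hσs
    rw [← hσ, smul_smul, zpow_neg, zpow_natCast, inv_mul_cancel₀, one_smul]
    exact pow_ne_zero _ (sub_ne_zero.2 hσs)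
  · have hfun : (fun i : Σ j : Fin J, Fin (L j) =>
        singularPart V fun σ => (σ - s) ^ (i.2 : ℕ) • (φ i.1 : ℂ → E) σ) =
        (kernelSpace V Q).subtype ∘ fun i : Σ j : Fin J, Fin (L j) => (T ^ (i.2 : ℕ)) (φ i.1) := by
      funext i
      exact (hT i.2 (φ i.1)).singularPart_eq
    constructor
    · rw [hfun]
      exact hli.map' _ (Submodule.ker_subtype _)
    · rw [hfun, range_comp, ← Submodule.map_span, top_le_iff.1 hsp, Submodule.map_subtype_top]
  · have hbj : b j = h j s := by simp [b]
    rw [hbj]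
    exact ((hh j).continuousAt.tendsto.mono_left nhdsWithin_le_nhds).congr' (hφh j).symm

end Shift

/-! ### Block decomposition and the Schur complement. -/

section BlockAlgebra

variable {F₁ F₂ D₀ : Type*}
  [NormedAddCommGroup F₁] [InnerProductSpace ℂ F₁]
  [NormedAddCommGroup F₂] [InnerProductSpace ℂ F₂] [CompleteSpace F₂]
  [NormedAddCommGroup D₀] [InnerProductSpace ℂ D₀]

omit [CompleteSpace F₂] in
theorem isClosed_kerPerp (ι₀ : D₀ →L[ℂ] F₁) (A₀ : D₀ →L[ℂ] F₂) :
    IsClosed (kerPerp ι₀ A₀ : Set D₀) :=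
  (Submodule.isClosed_orthogonal _).preimage ι₀.continuous

instance completeSpace_kerPerp [CompleteSpace D₀] (ι₀ : D₀ →L[ℂ] F₁) (A₀ : D₀ →L[ℂ] F₂) :
    CompleteSpace (kerPerp ι₀ A₀) := (isClosed_kerPerp ι₀ A₀).completeSpace_coe

/-- The projection of `D₀` onto `ker A₀` along `kerPerp ι₀ A₀`. -/
def kerProj {ι₀ : D₀ →L[ℂ] F₁} (hι : Function.Injective ι₀) (A₀ : D₀ →L[ℂ] F₂)
    [FiniteDimensional ℂ A₀.ker] : D₀ →L[ℂ] A₀.ker :=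
  LinearMap.toContinuousLinearMap
      ((Submodule.equivMapOfInjective (ι₀ : D₀ →ₗ[ℂ] F₁) hι A₀.ker).symm :
        A₀.ker.map (ι₀ : D₀ →ₗ[ℂ] F₁) →ₗ[ℂ] A₀.ker) ∘L
    (A₀.ker.map (ι₀ : D₀ →ₗ[ℂ] F₁)).orthogonalProjectionOnto ∘L ι₀

variable {ι₀ : D₀ →L[ℂ] F₁} (hι : Function.Injective ι₀) (A₀ : D₀ →L[ℂ] F₂)
  [FiniteDimensional ℂ A₀.ker]

omit [CompleteSpace F₂] in
theorem ι_kerProj (d : D₀) : ι₀ (kerProj hι A₀ d) =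
    (A₀.ker.map (ι₀ : D₀ →ₗ[ℂ] F₁)).orthogonalProjectionOnto (ι₀ d) := by
  have := Submodule.coe_equivMapOfInjective_apply (ι₀ : D₀ →ₗ[ℂ] F₁) hι A₀.ker
    (kerProj hι A₀ d)
  rw [ContinuousLinearMap.coe_coe] at this
  rw [← this]
  simp [kerProj]

omit [CompleteSpace F₂] in
theorem sub_kerProj_mem (d : D₀) : d - kerProj hι A₀ d ∈ kerPerp ι₀ A₀ := by
  change ι₀ (d - kerProj hι A₀ d) ∈ (A₀.ker.map (ι₀ : D₀ →ₗ[ℂ] F₁))ᗮ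
  rw [map_sub, ι_kerProj]
  exact Submodule.sub_starProjection_mem_orthogonal _

omit [CompleteSpace F₂] in
theorem kerProj_apply_ker (k : A₀.ker) : kerProj hι A₀ k = k := by
  refine Subtype.ext (hι ?_)
  rw [ι_kerProj]
  exact Submodule.starProjection_eq_self_iff.2 (Submodule.mem_map_of_mem k.2)

omit [CompleteSpace F₂] in
theorem kerProj_apply_kerPerp (w : kerPerp ι₀ A₀) : kerProj hι A₀ w = 0 := by
  refine Subtype.ext (hι ?_)
  have h : (A₀.ker.map (ι₀ : D₀ →ₗ[ℂ] F₁)).orthogonalProjectionOnto (ι₀ w) = 0 :=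
    Submodule.orthogonalProjectionOnto_apply_of_mem_orthogonal w.2
  rw [ι_kerProj, h]
  simp

/-- The projection of `D₀` onto `kerPerp ι₀ A₀` along `ker A₀`. -/
def perpProj : D₀ →L[ℂ] kerPerp ι₀ A₀ :=
  (ContinuousLinearMap.id ℂ D₀ - A₀.ker.subtypeL ∘L kerProj hι A₀).codRestrict _
    (sub_kerProj_mem hι A₀)

omit [CompleteSpace F₂] in
@[simp] theorem coe_perpProj (d : D₀) : (perpProj hι A₀ d : D₀) = d - kerProj hι A₀ d := rfl

omit [CompleteSpace F₂] in
theorem kerProj_add_perpProj (d : D₀) : (kerProj hι A₀ d : D₀) + perpProj hι A₀ d = d := by simp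

variable {A₀}

omit [FiniteDimensional ℂ A₀.ker] in
theorem coe_proj_add_coe_proj (f : F₂) :
    (A₀.rangeᗮ.orthogonalProjectionOnto f : F₂) + A₀.rangeᗮᗮ.orthogonalProjectionOnto f = f :=
  Submodule.starProjection_add_starProjection_orthogonal (K := A₀.rangeᗮ) f

omit [FiniteDimensional ℂ A₀.ker] in
theorem proj₁_apply_add (A : D₀ →L[ℂ] F₂) (k : A₀.ker) (w : kerPerp ι₀ A₀) :
    A₀.rangeᗮ.orthogonalProjectionOnto (A (k + w)) = block₁₁ A₀ A k + block₁₂ ι₀ A₀ A w := by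
  simp [block₁₁, block₁₂]

omit [FiniteDimensional ℂ A₀.ker] in
theorem proj₂_apply_add (A : D₀ →L[ℂ] F₂) (k : A₀.ker) (w : kerPerp ι₀ A₀) :
    A₀.rangeᗮᗮ.orthogonalProjectionOnto (A (k + w)) = block₂₁ A₀ A k + block₂₂ ι₀ A₀ A w := by
  simp [block₂₁, block₂₂]

variable {A : D₀ →L[ℂ] F₂}

omit [FiniteDimensional ℂ A₀.ker] in
-- The correction term cancels the component in the range summand, leaving the Schur complement in
-- the other.
theorem apply_sub_inverse (h22 : (block₂₂ ι₀ A₀ A).IsInvertible) (k : A₀.ker) :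
    A ((k : D₀) - ((block₂₂ ι₀ A₀ A).inverse (block₂₁ A₀ A k) : kerPerp ι₀ A₀)) =
      schurComplement ι₀ A₀ A k := by
  set w : kerPerp ι₀ A₀ := -(block₂₂ ι₀ A₀ A).inverse (block₂₁ A₀ A k) with hw
  have e : (k : D₀) - ((block₂₂ ι₀ A₀ A).inverse (block₂₁ A₀ A k) : kerPerp ι₀ A₀) = k + w := by
    simp [hw, sub_eq_add_neg]
  have h1 := proj₁_apply_add A k w
  have h2 := proj₂_apply_add A k w
  rw [e, ← coe_proj_add_coe_proj (A₀ := A₀) (A (k + w)), h1, h2, hw, map_neg, map_neg,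
    h22.self_apply_inverse]
  simp [schurComplement, sub_eq_add_neg]

include hι in
-- The equation for the range component determines the `kerPerp` component of `d` from its kernel
-- component.
theorem eq_sub_inverse_of_apply_mem (h22 : (block₂₂ ι₀ A₀ A).IsInvertible) {d : D₀}
    (hd : A₀.rangeᗮᗮ.orthogonalProjectionOnto (A d) = 0) :
    d = (kerProj hι A₀ d : D₀) -
      ((block₂₂ ι₀ A₀ A).inverse (block₂₁ A₀ A (kerProj hι A₀ d)) : kerPerp ι₀ A₀) := by
  have h1 := proj₂_apply_add A (kerProj hι A₀ d) (perpProj hι A₀ d)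
  rw [kerProj_add_perpProj, hd] at h1
  have h2 : perpProj hι A₀ d = -(block₂₂ ι₀ A₀ A).inverse (block₂₁ A₀ A (kerProj hι A₀ d)) := by
    rw [← map_neg, eq_comm, h22.inverse_apply_eq, eq_comm, eq_neg_iff_add_eq_zero, add_comm, h1]
  conv_lhs => rw [← kerProj_add_perpProj hι A₀ d, h2]
  simp [sub_eq_add_neg]

include hι in
-- The inverse is explicit: the compression of `A⁻¹` to a map from `(ran A₀)^⊥` to `ker A₀`.
theorem isInvertible_schurComplement (h22 : (block₂₂ ι₀ A₀ A).IsInvertible) (hA : A.IsInvertible) :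
    (schurComplement ι₀ A₀ A).IsInvertible := by
  refine ContinuousLinearMap.IsInvertible.of_inverse
    (g := kerProj hι A₀ ∘L A.inverse ∘L A₀.rangeᗮ.subtypeL) ?_ ?_
  · ext f
    simp only [ContinuousLinearMap.comp_apply, ContinuousLinearMap.id_apply,
      Submodule.subtypeL_apply]
    rw [← apply_sub_inverse h22, ← eq_sub_inverse_of_apply_mem hι h22, hA.self_apply_inverse]
    rw [hA.self_apply_inverse]
    exact Submodule.orthogonalProjectionOnto_orthogonal_apply_eq_zero f.2
  · ext k
    simp only [ContinuousLinearMap.comp_apply, ContinuousLinearMap.id_apply,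
      Submodule.subtypeL_apply]
    rw [← apply_sub_inverse h22, hA.inverse_apply_self, map_sub, kerProj_apply_ker,
      kerProj_apply_kerPerp, sub_zero]

include hι in
-- This is why the frame, built from the inverse of the reduced family, can be expressed by the
-- inverse of the full family.
theorem inverse_apply_eq_of_mem (h22 : (block₂₂ ι₀ A₀ A).IsInvertible) (hA : A.IsInvertible)
    (f : A₀.rangeᗮ) :
    A.inverse f = ((schurComplement ι₀ A₀ A).inverse f : D₀) -
      ((block₂₂ ι₀ A₀ A).inverse (block₂₁ A₀ A ((schurComplement ι₀ A₀ A).inverse f)) :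
        kerPerp ι₀ A₀) := by
  rw [hA.inverse_apply_eq, apply_sub_inverse h22,
    (isInvertible_schurComplement hι h22 hA).self_apply_inverse]

include hι in
-- `A₀` maps a complement of its kernel bijectively onto its range; closedness identifies the range
-- with its double orthogonal, and the open mapping theorem makes the inverse continuous.
theorem isInvertible_block₂₂_self [CompleteSpace D₀]
    (hclosed : IsClosed (A₀.range : Set F₂)) :
    (block₂₂ ι₀ A₀ A₀).IsInvertible := by
  have hrange : A₀.rangeᗮᗮ = A₀.range := by
    have : CompleteSpace A₀.range := hclosed.completeSpace_coe
    exact Submodule.orthogonal_orthogonal _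
  have happ : ∀ w : kerPerp ι₀ A₀, (block₂₂ ι₀ A₀ A₀ w : F₂) = A₀ w := fun w => by
    refine Submodule.starProjection_eq_self_iff.2 ?_
    rw [hrange]; exact ⟨_, rfl⟩
  have hbij : Function.Bijective (block₂₂ ι₀ A₀ A₀) := by
    constructor
    · rw [injective_iff_map_eq_zero]
      intro w hw
      have h1 : A₀ w = 0 := by rw [← happ, hw]; rfl
      have h2 := kerProj_apply_ker hι A₀ ⟨w, h1⟩
      rw [kerProj_apply_kerPerp] at h2
      exact Subtype.ext (congrArg Subtype.val h2).symm
    · intro f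
      have hf : (f : F₂) ∈ A₀.range := hrange.le f.2
      obtain ⟨d, hd⟩ := hf
      refine ⟨perpProj hι A₀ d, Subtype.ext ?_⟩
      have hk : A₀ (kerProj hι A₀ d : D₀) = 0 := (kerProj hι A₀ d).2
      rw [happ, coe_perpProj, map_sub, hk, sub_zero]
      exact hd
  exact ⟨ContinuousLinearEquiv.ofBijective _ (LinearMap.ker_eq_bot.2 hbij.1)
    (LinearMap.range_eq_top.2 hbij.2), by ext; rfl⟩

omit [FiniteDimensional ℂ A₀.ker] in
-- Provides the hypothesis `Q s = 0` of `exists_canonicalSystem`.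
theorem schurComplement_self : schurComplement ι₀ A₀ A₀ = 0 := by
  have h0 : A₀ ∘L A₀.ker.subtypeL = 0 := by ext k; exact k.2
  rw [schurComplement, block₁₁, block₂₁, h0]
  simp

omit [FiniteDimensional ℂ A₀.ker] in
theorem contDiff_block₂₂ {n : WithTop ℕ∞} : ContDiff ℂ n (block₂₂ ι₀ A₀) :=
  contDiff_const.clm_comp (contDiff_id.clm_comp contDiff_const)

omit [FiniteDimensional ℂ A₀.ker] in
-- The order stays free: `ω` will give holomorphy in `σ`, and `0` joint continuity in `(y, σ)`.
theorem contDiffAt_schurComplement [CompleteSpace D₀] {n : WithTop ℕ∞}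
    (h22 : (block₂₂ ι₀ A₀ A).IsInvertible) : ContDiffAt ℂ n (schurComplement ι₀ A₀) A := by
  have h₁₁ : ContDiff ℂ n (block₁₁ A₀) :=
    contDiff_const.clm_comp (contDiff_id.clm_comp contDiff_const)
  have h₁₂ : ContDiff ℂ n (block₁₂ ι₀ A₀) :=
    contDiff_const.clm_comp (contDiff_id.clm_comp contDiff_const)
  have h₂₁ : ContDiff ℂ n (block₂₁ A₀) :=
    contDiff_const.clm_comp (contDiff_id.clm_comp contDiff_const)
  have hinv : ContDiffAt ℂ n (fun B => (block₂₂ ι₀ A₀ B).inverse) A :=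
    h22.contDiffAt_map_inverse.comp A contDiff_block₂₂.contDiffAt
  exact h₁₁.contDiffAt.sub (h₁₂.contDiffAt.clm_comp (hinv.clm_comp h₂₁.contDiffAt))

end BlockAlgebra

/-! ### The vector-valued disc algebra and its multiplication operators. -/

section DiscAlgebra

variable {E F : Type*} [NormedAddCommGroup E] [NormedSpace ℂ E]
  [NormedAddCommGroup F] [NormedSpace ℂ F] {s : ℂ} {r : ℝ}

open Classical in
/-- Extension by zero of a function on the closed disc. -/
def discExtend (f : C(Metric.closedBall s r, E)) (z : ℂ) : E :=
  if h : z ∈ Metric.closedBall s r then f ⟨z, h⟩ else 0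

omit [NormedSpace ℂ E] in
theorem discExtend_of_mem (f : C(Metric.closedBall s r, E)) {z : ℂ}
    (h : z ∈ Metric.closedBall s r) : discExtend f z = f ⟨z, h⟩ := dif_pos h

omit [NormedSpace ℂ E] in
theorem continuousOn_discExtend (f : C(Metric.closedBall s r, E)) :
    ContinuousOn (discExtend f) (Metric.closedBall s r) := by
  rw [continuousOn_iff_continuous_domRestrict]
  convert f.continuous using 1
  ext z
  exact discExtend_of_mem f z.2

variable (E s r) in
/-- The continuous functions on the closed disc which are holomorphic in its interior. -/
def discAlgebra : Submodule ℂ C(Metric.closedBall s r, E) where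
  carrier := {f | DifferentiableOn ℂ (discExtend f) (Metric.ball s r)}
  zero_mem' := by
    refine (differentiableOn_const (0 : E)).congr fun z hz => ?_
    rw [discExtend_of_mem _ (Metric.ball_subset_closedBall hz)]
    rfl
  add_mem' := fun {f g} hf hg => by
    refine (DifferentiableOn.add hf hg).congr fun z hz => ?_
    simp [discExtend_of_mem _ (Metric.ball_subset_closedBall hz)]
  smul_mem' := fun c f hf => by
    refine (DifferentiableOn.const_smul hf c).congr fun z hz => ?_
    simp [discExtend_of_mem _ (Metric.ball_subset_closedBall hz)]

theorem analyticAt_discExtend [CompleteSpace E] (f : discAlgebra E s r) {z : ℂ}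
    (hz : z ∈ Metric.ball s r) : AnalyticAt ℂ (discExtend f.1) z :=
  DifferentiableOn.analyticAt f.2 (Metric.isOpen_ball.mem_nhds hz)

/-- Uniform limits of holomorphic functions are holomorphic. Completeness is needed for the open
mapping theorem on this space. -/
instance [CompleteSpace E] : CompleteSpace (discAlgebra E s r) := by
  refine IsClosed.completeSpace_coe (hs := IsSeqClosed.isClosed fun f g hf hg => ?_)
  have h1 : TendstoUniformlyOn (fun n => discExtend (f n)) (discExtend g) atTop
      (Metric.ball s r) := by
    have h2 := (ContinuousMap.tendsto_iff_tendstoUniformly.1 hg)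
    rw [Metric.tendstoUniformly_iff] at h2
    rw [Metric.tendstoUniformlyOn_iff]
    intro δ hδ
    filter_upwards [h2 δ hδ] with n hn z hz
    rw [discExtend_of_mem _ (Metric.ball_subset_closedBall hz),
      discExtend_of_mem _ (Metric.ball_subset_closedBall hz)]
    exact hn _
  exact h1.tendstoLocallyUniformlyOn.differentiableOn (Eventually.of_forall hf)
    Metric.isOpen_ball

/-- An element of the disc algebra from a function on `ℂ`. -/
def discAlgebra.mk (f : ℂ → E) (hc : ContinuousOn f (Metric.closedBall s r))
    (hd : DifferentiableOn ℂ f (Metric.ball s r)) : discAlgebra E s r :=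
  ⟨⟨fun z => f z, continuousOn_iff_continuous_domRestrict.1 hc⟩, hd.congr fun _ hz =>
    discExtend_of_mem _ (Metric.ball_subset_closedBall hz)⟩

@[simp] theorem discAlgebra.mk_apply (f : ℂ → E) (hc : ContinuousOn f (Metric.closedBall s r))
    (hd : DifferentiableOn ℂ f (Metric.ball s r)) (z : Metric.closedBall s r) :
    (discAlgebra.mk f hc hd).1 z = f z := rfl

theorem continuousOn_closedBall_of_analyticAt {f : ℂ → E}
    (hf : ∀ z ∈ Metric.closedBall s r, AnalyticAt ℂ f z) : ContinuousOn f (Metric.closedBall s r) :=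
  fun z hz => (hf z hz).continuousAt.continuousWithinAt

theorem differentiableOn_ball_of_analyticAt {f : ℂ → E}
    (hf : ∀ z ∈ Metric.closedBall s r, AnalyticAt ℂ f z) : DifferentiableOn ℂ f (Metric.ball s r) :=
  fun z hz => (hf z (Metric.ball_subset_closedBall hz)).differentiableAt.differentiableWithinAt

theorem continuousOn_apply_discExtend {A : ℂ → E →L[ℂ] F}
    (hA : ∀ z ∈ Metric.closedBall s r, AnalyticAt ℂ A z) (u : discAlgebra E s r) :
    ContinuousOn (fun z => A z (discExtend u.1 z)) (Metric.closedBall s r) :=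
  (continuousOn_closedBall_of_analyticAt hA).clm_apply (continuousOn_discExtend u.1)

theorem differentiableOn_apply_discExtend [CompleteSpace E] {A : ℂ → E →L[ℂ] F}
    (hA : ∀ z ∈ Metric.closedBall s r, AnalyticAt ℂ A z) (u : discAlgebra E s r) :
    DifferentiableOn ℂ (fun z => A z (discExtend u.1 z)) (Metric.ball s r) := fun z hz =>
  ((hA z (Metric.ball_subset_closedBall hz)).operator_apply
    (analyticAt_discExtend u hz)).differentiableAt.differentiableWithinAt

/-- A family of operators, holomorphic near the closed disc, acts on the disc algebra. -/
def discMul [CompleteSpace E] (A : ℂ → E →L[ℂ] F)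
    (hA : ∀ z ∈ Metric.closedBall s r, AnalyticAt ℂ A z) :
    discAlgebra E s r →L[ℂ] discAlgebra F s r :=
  have hbd := (isCompact_closedBall s r).exists_bound_of_continuousOn
    (continuousOn_closedBall_of_analyticAt hA)
  LinearMap.mkContinuous
    { toFun := fun u => discAlgebra.mk (fun z => A z (discExtend u.1 z))
        (continuousOn_apply_discExtend hA u) (differentiableOn_apply_discExtend hA u)
      map_add' := fun u v => by
        ext z
        simp [discExtend_of_mem _ z.2]
      map_smul' := fun c u => by
        ext z
        simp [discExtend_of_mem _ z.2] }
    hbd.choose fun u => by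
      -- On an empty disc the chosen bound may be negative, but then `u = 0`.
      have hC0 : 0 ≤ hbd.choose * ‖u‖ := by
        by_cases hne : (Metric.closedBall s r).Nonempty
        · obtain ⟨z, hz⟩ := hne
          exact mul_nonneg ((norm_nonneg _).trans (hbd.choose_spec z hz)) (norm_nonneg _)
        · have : IsEmpty (Metric.closedBall s r) := by
            rwa [isEmpty_coe_sort, ← not_nonempty_iff_eq_empty]
          have : u = 0 := by ext z; exact isEmptyElim z
          simp [this]
      refine (ContinuousMap.norm_le _ hC0).2 fun z => ?_
      refine (ContinuousLinearMap.le_opNorm _ _).trans ?_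
      rw [discExtend_of_mem _ z.2]
      exact mul_le_mul (hbd.choose_spec z z.2) (ContinuousMap.norm_coe_le_norm u.1 _)
        (norm_nonneg _) ((norm_nonneg _).trans (hbd.choose_spec z z.2))

theorem discMul_apply [CompleteSpace E] (A : ℂ → E →L[ℂ] F)
    (hA : ∀ z ∈ Metric.closedBall s r, AnalyticAt ℂ A z) (u : discAlgebra E s r)
    (z : Metric.closedBall s r) : (discMul A hA u).1 z = A z (u.1 z) := by
  change A z (discExtend u.1 z) = _
  rw [discExtend_of_mem _ z.2]

theorem norm_discMul_sub_le [CompleteSpace E] (A A' : ℂ → E →L[ℂ] F)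
    (hA : ∀ z ∈ Metric.closedBall s r, AnalyticAt ℂ A z)
    (hA' : ∀ z ∈ Metric.closedBall s r, AnalyticAt ℂ A' z) {δ : ℝ} (hδ : 0 ≤ δ)
    (h : ∀ z ∈ Metric.closedBall s r, ‖A z - A' z‖ ≤ δ) : ‖discMul A hA - discMul A' hA'‖ ≤ δ := by
  refine ContinuousLinearMap.opNorm_le_bound _ hδ fun u => ?_
  refine (ContinuousMap.norm_le _ (by positivity)).2 fun z => ?_
  have : ((discMul A hA - discMul A' hA') u).1 z = (A z - A' z) (u.1 z) := by
    rw [sub_apply, sub_apply, ← discMul_apply A hA,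
      ← discMul_apply A' hA']
    rfl
  change ‖((discMul A hA - discMul A' hA') u).1 z‖ ≤ _
  rw [this]
  refine (ContinuousLinearMap.le_opNorm _ _).trans ?_
  exact mul_le_mul (h z z.2) (ContinuousMap.norm_coe_le_norm u.1 _) (norm_nonneg _) hδ

end DiscAlgebra

/-! ### Openness of the set of isomorphisms of Banach spaces. -/

section OpenMapping

theorem exists_bijective_of_norm_sub_le {X Y : Type*} [NormedAddCommGroup X] [NormedSpace ℂ X]
    [CompleteSpace X] [NormedAddCommGroup Y] [NormedSpace ℂ Y] [CompleteSpace Y] {Φ : X →L[ℂ] Y}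
    (h : Function.Bijective Φ) :
    ∃ δ > 0, ∀ Φ' : X →L[ℂ] Y, ‖Φ' - Φ‖ ≤ δ → Function.Bijective Φ' := by
  let e : X ≃L[ℂ] Y := ContinuousLinearEquiv.ofBijective Φ (LinearMap.ker_eq_bot.2 h.1)
    (LinearMap.range_eq_top.2 h.2)
  have he : (e : X →L[ℂ] Y) = Φ := rfl
  obtain ⟨δ, hδ, hball⟩ := Metric.mem_nhds_iff.1 e.nhds
  -- The halving passes from an open ball to a non-strict inequality.
  refine ⟨δ / 2, by positivity, fun Φ' hΦ' => ?_⟩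
  obtain ⟨e', he'⟩ := hball (show Φ' ∈ Metric.ball (e : X →L[ℂ] Y) δ by
    rw [he, mem_ball_iff_norm]; exact hΦ'.trans_lt (half_lt_self hδ))
  rw [← he']
  exact e'.bijective

end OpenMapping

/-! ### Stability of bases of kernel spaces under perturbation. -/

section Stability

variable {E F : Type*} [NormedAddCommGroup E] [NormedSpace ℂ E]
  [NormedAddCommGroup F] [NormedSpace ℂ F] {s : ℂ} {r ε : ℝ}

/-- A family of operators, holomorphic on the disc of radius `ε` about `s` and invertible there
except at finitely many points of the concentric disc of radius `r`. -/
structure DiscFamily (A : ℂ → E →L[ℂ] F) (s : ℂ) (r ε : ℝ) (Z : Set ℂ) : Prop where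
  r_pos : 0 < r
  r_lt : r < ε
  analytic : ∀ p ∈ Metric.ball s ε, AnalyticAt ℂ A p
  finite : Z.Finite
  subset : Z ⊆ Metric.ball s r
  invertible : ∀ p ∈ Metric.ball s ε, p ∉ Z → (A p).IsInvertible

theorem _root_.Set.Finite.eventually_notMem_punctured {Z : Set ℂ} (hZ : Z.Finite) (p : ℂ) :
    ∀ᶠ σ in 𝓝[≠] p, σ ∉ Z := by
  have h3 : (Z \ {p})ᶜ ∈ 𝓝 p := (hZ.subset sdiff_subset).isClosed.isOpen_compl.mem_nhds (by simp)
  filter_upwards [nhdsWithin_le_nhds h3, self_mem_nhdsWithin] with σ h h' hσ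
  exact h ⟨hσ, h'⟩

namespace DiscFamily

variable {A : ℂ → E →L[ℂ] F} {Z : Set ℂ} (H : DiscFamily A s r ε Z)

include H

theorem closedBall_subset : Metric.closedBall s r ⊆ Metric.ball s ε :=
  Metric.closedBall_subset_ball H.r_lt

theorem ball_subset : Metric.ball s r ⊆ Metric.ball s ε := Metric.ball_subset_ball H.r_lt.le

theorem eventually_invertible {p : ℂ} (hp : p ∈ Metric.ball s ε) :
    ∀ᶠ σ in 𝓝[≠] p, σ ∈ Metric.ball s ε ∧ σ ∉ Z ∧ (A σ).IsInvertible := by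
  filter_upwards [nhdsWithin_le_nhds (Metric.isOpen_ball.mem_nhds hp),
    H.finite.eventually_notMem_punctured p] with σ h h' using ⟨h, h', H.invertible σ h h'⟩

theorem exists_isSingularPart [FiniteDimensional ℂ E] [CompleteSpace F] {V : Set ℂ} (hV : IsOpen V)
    (hVε : V ⊆ Metric.ball s ε) {b : ℂ → F} (hb : ∀ p ∈ V, AnalyticAt ℂ b p) :
    ∃ g, IsSingularPart V (fun σ => (A σ).inverse (b σ)) g :=
  exists_isSingularPart_inverse_apply hV H.finite (fun p hp => H.analytic p (hVε hp))
    (fun p hp => H.invertible p (hVε hp)) hb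

theorem apply_inverse_extends {V : Set ℂ} (hVε : V ⊆ Metric.ball s ε) {b : ℂ → F}
    (hb : ∀ p ∈ V, AnalyticAt ℂ b p) :
    ExtendsHolomorphically V (fun σ => A σ ((A σ).inverse (b σ))) := fun p hp =>
  (hb p hp).extendsAt.congr <| by
    filter_upwards [H.eventually_invertible (hVε hp)] with σ hσ
    rw [hσ.2.2.self_apply_inverse]

theorem analyticAt_inverse_apply [CompleteSpace E] [CompleteSpace F] {b : ℂ → F} {p : ℂ}
    (hp : p ∈ Metric.ball s ε) (hpZ : p ∉ Z) (hb : AnalyticAt ℂ b p) :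
    AnalyticAt ℂ (fun σ => (A σ).inverse (b σ)) p :=
  (analyticAt_inverse (H.analytic p hp) (H.invertible p hp hpZ)).operator_apply hb

/-- `A⁻¹ β` has removable singularities if and only if `β` lies in the image of the disc algebra. -/
theorem extends_inverse_apply_iff [CompleteSpace E] [CompleteSpace F] {β : ℂ → F}
    (hβ : ∀ p ∈ Metric.ball s ε, AnalyticAt ℂ β p) :
    ExtendsHolomorphically (Metric.ball s ε) (fun σ => (A σ).inverse (β σ)) ↔
      ∃ u : discAlgebra E s r, ∀ z : Metric.closedBall s r, β z = A z (u.1 z) := by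
  constructor
  · intro h
    obtain ⟨g, hg, hgf⟩ := h.exists_analyticOnNhd
    have hAg : ∀ z ∈ Metric.ball s ε, A z (g z) = β z := by
      intro z hz
      have h1 : ∀ᶠ σ in 𝓝[≠] z, A σ (g σ) = β σ := by
        filter_upwards [H.eventually_invertible hz] with σ hσ
        rw [hgf σ hσ.1 (H.analyticAt_inverse_apply hσ.1 hσ.2.1 (hβ σ hσ.1)).continuousAt,
          hσ.2.2.self_apply_inverse]
      have t1 := ((H.analytic z hz).operator_apply (hg z hz)).continuousAt.tendsto.mono_left
        (nhdsWithin_le_nhds (s := {z}ᶜ))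
      have t2 := (hβ z hz).continuousAt.tendsto.mono_left (nhdsWithin_le_nhds (s := {z}ᶜ))
      exact tendsto_nhds_unique (t1.congr' h1) t2
    have hg' := fun z hz => hg z (H.closedBall_subset hz)
    refine ⟨discAlgebra.mk g (continuousOn_closedBall_of_analyticAt hg')
      (differentiableOn_ball_of_analyticAt hg'), fun z => ?_⟩
    rw [discAlgebra.mk_apply, hAg z (H.closedBall_subset z.2)]
  · rintro ⟨u, hu⟩ p hp
    -- Inside radius `r` the extension is `u`; outside there is nothing to extend, since `Z` lies in
    -- the smaller disc.
    by_cases hpr : p ∈ Metric.ball s r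
    · refine ⟨discExtend u.1, analyticAt_discExtend u hpr, ?_⟩
      filter_upwards [H.eventually_invertible hp,
        nhdsWithin_le_nhds (Metric.isOpen_ball.mem_nhds hpr)] with σ hσ hσr
      have hσr' := Metric.ball_subset_closedBall hσr
      rw [hu ⟨σ, hσr'⟩, hσ.2.2.inverse_apply_self, discExtend_of_mem _ hσr']
    · exact (H.analyticAt_inverse_apply hp (fun h => hpr (H.subset h)) (hβ p hp)).extendsAt

/-- A sum of principal parts with poles in the smaller disc is holomorphic elsewhere, so enlarging
the disc imposes no new condition. -/
theorem mem_kernelSpace_of_mem_ball [CompleteSpace E] [CompleteSpace F] {g : ℂ → E}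
    (hg : g ∈ kernelSpace (Metric.ball s r) A) : g ∈ kernelSpace (Metric.ball s ε) A := by
  obtain ⟨h1, h2⟩ := (mem_kernelSpace_iff fun p hp => H.analytic p (H.ball_subset hp)).1 hg
  have h3 : ∀ p ∈ Metric.ball s ε \ Metric.ball s r, AnalyticAt ℂ g p := fun p hp =>
    h1.analyticAt fun h => absurd h hp.2
  refine (mem_kernelSpace_iff H.analytic).2 ⟨h1.mono H.ball_subset fun p hp =>
    (h3 p hp).extendsAt, fun p hp => ?_⟩
  by_cases hpr : p ∈ Metric.ball s r
  · exact h2 p hpr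
  · exact ((H.analytic p hp).operator_apply (h3 p ⟨hp, hpr⟩)).extendsAt

omit H in
/-- The map `(c, u) ↦ ∑ cᵢ bᵢ + A u` on the disc algebra. -/
def frameMap [CompleteSpace E] {ι : Type*} [Fintype ι] (b : ι → discAlgebra F s r)
    (hA : ∀ z ∈ Metric.closedBall s r, AnalyticAt ℂ A z) :
    ((ι → ℂ) × discAlgebra E s r) →L[ℂ] discAlgebra F s r :=
  (LinearMap.toContinuousLinearMap (Fintype.linearCombination ℂ b)).coprod (discMul A hA)

omit H in
theorem frameMap_apply [CompleteSpace E] {ι : Type*} [Fintype ι] (b : ι → discAlgebra F s r)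
    (hA : ∀ z ∈ Metric.closedBall s r, AnalyticAt ℂ A z) (c : ι → ℂ) (u : discAlgebra E s r)
    (z : Metric.closedBall s r) :
    (frameMap b hA (c, u)).1 z = ∑ i, c i • (b i).1 z + A z (u.1 z) := by
  rw [← discMul_apply A hA]
  simp [frameMap, Fintype.linearCombination_apply]

variable {ι : Type*} [Fintype ι] {b : ι → ℂ → F}
  (hb : ∀ i, ∀ p ∈ Metric.ball s ε, AnalyticAt ℂ (b i) p)

/-- The restriction to the closed disc of functions holomorphic on a larger disc. -/
def restrict {β : ℂ → F} (hβ : ∀ p ∈ Metric.ball s ε, AnalyticAt ℂ β p) : discAlgebra F s r :=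
  discAlgebra.mk β
    (continuousOn_closedBall_of_analyticAt fun z hz => hβ z (H.closedBall_subset hz))
    (differentiableOn_ball_of_analyticAt fun z hz => hβ z (H.closedBall_subset hz))

include hb in
theorem isSingularPart_sum [FiniteDimensional ℂ E] [CompleteSpace F] (c : ι → ℂ) :
    IsSingularPart (Metric.ball s ε) (fun σ => (A σ).inverse (∑ i, c i • b i σ))
      (∑ i, c i • singularPart (Metric.ball s ε) fun σ => (A σ).inverse (b i σ)) := by
  refine (IsSingularPart.sum Finset.univ (f := fun i => c i • fun σ => (A σ).inverse (b i σ))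
    fun i _ => (singularPart_spec (H.exists_isSingularPart Metric.isOpen_ball subset_rfl
      (hb i))).const_smul (c i)).congr fun p _ => Eventually.of_forall fun σ => ?_
  simp [map_sum]

omit H in
theorem sum_analytic {β : ι → ℂ → F} {p : ℂ} (hb : ∀ i, AnalyticAt ℂ (β i) p) (c : ι → ℂ) :
    AnalyticAt ℂ (fun σ => ∑ i, c i • β i σ) p :=
  Finset.analyticAt_fun_sum _ fun i _ => analyticAt_const.smul (hb i)

/-- Injectivity: if `∑ cᵢ bᵢ = -A u`, then `∑ cᵢ A⁻¹ bᵢ` has no singular part, so `c = 0` by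
independence, and then `A u = 0` gives `u = 0`. Surjectivity: the singular part of `A⁻¹ h` lies in
the kernel space; after subtraction of a combination of the `bᵢ` from `h`, the function `A⁻¹ (h - ∑
cᵢ bᵢ)` has removable singularities and supplies `u`. -/
theorem bijective_of_isBasisOf [FiniteDimensional ℂ E] [CompleteSpace F]
    (h : IsBasisOf (kernelSpace (Metric.ball s ε) A)
      fun i => singularPart (Metric.ball s ε) fun σ => (A σ).inverse (b i σ)) :
    Function.Bijective (frameMap (fun i => H.restrict (hb i))
      fun z hz => H.analytic z (H.closedBall_subset hz)) := by
  have : CompleteSpace E := FiniteDimensional.complete ℂ E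
  obtain ⟨hli, hsp⟩ := h
  constructor
  · rw [injective_iff_map_eq_zero]
    rintro ⟨c, u⟩ hcu
    have h1 : ∀ z : Metric.closedBall s r, ∑ i, c i • b i z + A z (u.1 z) = 0 := fun z => by
      have := frameMap_apply (fun i => H.restrict (hb i))
        (fun z hz => H.analytic z (H.closedBall_subset hz)) c u z
      rw [hcu] at this
      exact this.symm
    have h2 := (H.extends_inverse_apply_iff (β := fun σ => ∑ i, c i • b i σ) fun p hp =>
      sum_analytic (fun i => hb i p hp) c).2 ⟨-u, fun z => by
        rw [eq_neg_of_add_eq_zero_left (h1 z)]; simp⟩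
    have h3 := (H.isSingularPart_sum hb c).unique (IsSingularPart.of_extends h2)
    have hc : c = 0 := funext (Fintype.linearIndependent_iff.1 hli c h3)
    have hu : u = 0 := by
      -- Off `Z` injectivity of `A z` suffices; at the points of `Z`, interior to the disc,
      -- continuity takes over.
      have h4 : ∀ z : Metric.closedBall s r, (z : ℂ) ∉ Z → u.1 z = 0 := fun z hz => by
        have := h1 z
        simp only [hc, Pi.zero_apply, zero_smul, Finset.sum_const_zero, zero_add] at this
        exact (H.invertible z (H.closedBall_subset z.2) hz).injective (by rw [this, map_zero])
      ext z
      by_cases hz : (z : ℂ) ∈ Z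
      · have hzr := H.subset hz
        have t1 := (analyticAt_discExtend u hzr).continuousAt.tendsto.mono_left
          (nhdsWithin_le_nhds (s := {(z : ℂ)}ᶜ))
        rw [discExtend_of_mem _ z.2] at t1
        refine tendsto_nhds_unique t1 (tendsto_const_nhds.congr' ?_)
        filter_upwards [H.eventually_invertible (H.ball_subset hzr),
          nhdsWithin_le_nhds (Metric.isOpen_ball.mem_nhds hzr)] with σ hσ hσr
        rw [discExtend_of_mem _ (Metric.ball_subset_closedBall hσr), h4 _ hσ.2.1]
        rfl
      · exact h4 z hz
    rw [hc, hu]; rfl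
  · intro h
    have hdb : ∀ p ∈ Metric.ball s r, AnalyticAt ℂ (discExtend h.1) p := fun p hp =>
      analyticAt_discExtend h hp
    obtain ⟨g, hg⟩ := H.exists_isSingularPart Metric.isOpen_ball H.ball_subset hdb
    have hgK := H.mem_kernelSpace_of_mem_ball
      (singularPart_mem_kernelSpace hg (H.apply_inverse_extends H.ball_subset hdb))
    rw [← hsp, Submodule.mem_span_range_iff_exists_fun] at hgK
    obtain ⟨c, hc⟩ := hgK
    have hext : ExtendsHolomorphically (Metric.ball s r)
        (fun σ => (A σ).inverse (discExtend h.1 σ - ∑ i, c i • b i σ)) := by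
      have h1 := hg.extends_sub
      have h2 := (H.isSingularPart_sum hb c).extends_sub.mono H.ball_subset
      rw [hc] at h2
      intro p hp
      refine ExtendsAt.congr ((h1.sub h2) p hp) (Eventually.of_forall fun σ => ?_)
      simp
    obtain ⟨k, hk, hkf⟩ := hext.exists_analyticOnNhd
    classical
    -- On the boundary circle `h` is merely continuous, so the holomorphic extension `k` is
    -- unavailable there. It is used only at the points of `Z`, all of them interior; elsewhere the
    -- formula itself is continuous up to the boundary.
    let v : ℂ → E := fun z =>
      if z ∈ Z then k z else (A z).inverse (discExtend h.1 z - ∑ i, c i • b i z)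
    have hvk : ∀ z ∈ Metric.ball s r, v z = k z := by
      intro z hz
      by_cases hzZ : z ∈ Z
      · simp [v, hzZ]
      · simp only [v, hzZ, if_false]
        exact (hkf z hz (H.analyticAt_inverse_apply (H.ball_subset hz) hzZ
          ((hdb z hz).sub (sum_analytic (fun i => hb i z (H.ball_subset hz)) c))).continuousAt).symm
    have hvd : DifferentiableOn ℂ v (Metric.ball s r) :=
      DifferentiableOn.congr (fun z hz => (hk z hz).differentiableAt.differentiableWithinAt) hvk
    have hvc : ContinuousOn v (Metric.closedBall s r) := by
      intro z hz
      by_cases hzr : z ∈ Metric.ball s r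
      · exact ((hvd z hzr).continuousWithinAt.continuousAt
          (Metric.isOpen_ball.mem_nhds hzr)).continuousWithinAt
      · have hzZ : z ∉ Z := fun h => hzr (H.subset h)
        have hzε := H.closedBall_subset hz
        have h1 : ContinuousWithinAt
            (fun z => (A z).inverse (discExtend h.1 z - ∑ i, c i • b i z))
            (Metric.closedBall s r) z := by
          refine ContinuousWithinAt.clm_apply (analyticAt_inverse (H.analytic z hzε)
            (H.invertible z hzε hzZ)).continuousAt.continuousWithinAt ?_
          exact (continuousOn_discExtend h.1 z hz).sub
            (sum_analytic (fun i => hb i z hzε) c).continuousAt.continuousWithinAt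
        refine h1.congr_of_eventuallyEq ?_ (by simp [v, hzZ])
        filter_upwards [nhdsWithin_le_nhds (H.finite.isClosed.isOpen_compl.mem_nhds hzZ)] with σ hσ
        simp only [v, if_neg hσ]
    have hAv : ∀ z ∈ Metric.closedBall s r, A z (v z) = discExtend h.1 z - ∑ i, c i • b i z := by
      intro z hz
      by_cases hzZ : z ∈ Z
      · have hzr := H.subset hzZ
        have t1 := ((H.analytic z (H.ball_subset hzr)).operator_apply
          (hk z hzr)).continuousAt.tendsto.mono_left (nhdsWithin_le_nhds (s := {z}ᶜ))
        have t2 := ((hdb z hzr).sub (sum_analytic (fun i => hb i z (H.ball_subset hzr))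
          c)).continuousAt.tendsto.mono_left (nhdsWithin_le_nhds (s := {z}ᶜ))
        rw [hvk z hzr]
        refine tendsto_nhds_unique t1 (t2.congr' ?_)
        filter_upwards [H.eventually_invertible (H.ball_subset hzr),
          nhdsWithin_le_nhds (Metric.isOpen_ball.mem_nhds hzr)] with σ hσ hσr
        rw [← hvk σ hσr]
        simp only [v, if_neg hσ.2.1]
        rw [hσ.2.2.self_apply_inverse]
        rfl
      · simp only [v, if_neg hzZ]
        rw [(H.invertible z (H.closedBall_subset hz) hzZ).self_apply_inverse]
    refine ⟨(c, discAlgebra.mk v hvc hvd), ?_⟩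
    ext z
    rw [frameMap_apply, discAlgebra.mk_apply, hAv z z.2, discExtend_of_mem _ z.2]
    simp [restrict]

/-- For `g` in the kernel space, `β = A g` is holomorphic. Writing `β = ∑ cᵢ bᵢ + A u` and applying
`A⁻¹` shows that `g` and `∑ cᵢ A⁻¹ bᵢ` have the same singular part. Independence follows from
injectivity in the same way. -/
theorem isBasisOf_of_bijective [FiniteDimensional ℂ E] [CompleteSpace F]
    (h : Function.Bijective (frameMap (fun i => H.restrict (hb i))
      fun z hz => H.analytic z (H.closedBall_subset hz))) :
    IsBasisOf (kernelSpace (Metric.ball s ε) A)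
      fun i => singularPart (Metric.ball s ε) fun σ => (A σ).inverse (b i σ) := by
  have : CompleteSpace E := FiniteDimensional.complete ℂ E
  have happ := frameMap_apply (fun i => H.restrict (hb i))
    (fun z hz => H.analytic z (H.closedBall_subset hz))
  constructor
  · rw [Fintype.linearIndependent_iff]
    intro c hc
    have h1 := H.isSingularPart_sum hb c
    rw [hc] at h1
    obtain ⟨u, hu⟩ := (H.extends_inverse_apply_iff fun p hp =>
      sum_analytic (fun i => hb i p hp) c).1 h1.extends_of_zero
    have h2 : ((c, -u) : (ι → ℂ) × discAlgebra E s r) = 0 := by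
      apply h.1
      rw [map_zero]
      ext z
      rw [happ]
      have := hu z
      simp only [restrict, discAlgebra.mk_apply]
      rw [this]
      simp
    exact congrFun (congrArg Prod.fst h2)
  · apply le_antisymm
    · rw [Submodule.span_le]
      rintro _ ⟨i, rfl⟩
      exact singularPart_mem_kernelSpace
        (singularPart_spec (H.exists_isSingularPart Metric.isOpen_ball subset_rfl (hb i)))
        (H.apply_inverse_extends subset_rfl (hb i))
    · intro g hg
      obtain ⟨h1, h2⟩ := (mem_kernelSpace_iff H.analytic).1 hg
      obtain ⟨β, hβ, hβg⟩ := h2.exists_analyticOnNhd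
      obtain ⟨⟨c, u⟩, hcu⟩ := h.2 (H.restrict hβ)
      have h3 := (H.extends_inverse_apply_iff (β := fun σ => β σ - ∑ i, c i • b i σ) fun p hp =>
        (hβ p hp).sub (sum_analytic (fun i => hb i p hp) c)).2 ⟨u, fun z => by
          have := happ c u z
          rw [hcu] at this
          simp only [restrict, discAlgebra.mk_apply] at this
          rw [this, add_sub_cancel_left]⟩
      have h4 : IsSingularPart (Metric.ball s ε) g
          (∑ i, c i • singularPart (Metric.ball s ε) fun σ => (A σ).inverse (b i σ)) := by
        refine (H.isSingularPart_sum hb c).congr_sub fun p hp => ExtendsAt.congr (h3 p hp) ?_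
        filter_upwards [H.eventually_invertible hp] with σ hσ
        have hgσ : AnalyticAt ℂ g σ := h1.analyticAt fun hσε =>
          extendsAt_of_apply (H.analytic σ hσε) hσ.2.2 (h2 σ hσε)
        have : (A σ).inverse (β σ) = g σ := by
          rw [hβg σ hσ.1 ((H.analytic σ hσ.1).operator_apply hgσ).continuousAt,
            hσ.2.2.inverse_apply_self]
        rw [map_sub, this]
        rfl
      rw [h1.unique h4]
      exact Submodule.sum_mem _ fun i _ => Submodule.smul_mem _ _ (Submodule.subset_span ⟨i, rfl⟩)

include hb in
/-- The property that the `𝔰(A⁻¹ bᵢ)` form a basis of the kernel space of `A` is stable under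
small perturbations of `A`. -/
theorem exists_isBasisOf_of_close [FiniteDimensional ℂ E] [CompleteSpace F]
    (h : IsBasisOf (kernelSpace (Metric.ball s ε) A)
      fun i => singularPart (Metric.ball s ε) fun σ => (A σ).inverse (b i σ)) :
    ∃ δ > 0, ∀ (A' : ℂ → E →L[ℂ] F) (Z' : Set ℂ), DiscFamily A' s r ε Z' →
      (∀ z ∈ Metric.closedBall s r, ‖A' z - A z‖ ≤ δ) →
      IsBasisOf (kernelSpace (Metric.ball s ε) A')
        fun i => singularPart (Metric.ball s ε) fun σ => (A' σ).inverse (b i σ) := by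
  have : CompleteSpace E := FiniteDimensional.complete ℂ E
  have hbij := H.bijective_of_isBasisOf hb h
  set Φ := frameMap (fun i => H.restrict (hb i)) fun z hz => H.analytic z (H.closedBall_subset hz)
    with hΦ
  obtain ⟨δ, hδ, hball⟩ := exists_bijective_of_norm_sub_le hbij
  refine ⟨δ, hδ, fun A' Z' H' hAA' => H'.isBasisOf_of_bijective hb ?_⟩
  set Φ' := frameMap (fun i => H'.restrict (hb i))
    fun z hz => H'.analytic z (H'.closedBall_subset hz) with hΦ'
  -- The summand `∑ cᵢ bᵢ` does not involve the family and cancels. The exceptional sets `Z` and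
  -- `Z'` play no role in the estimate.
  have hdiff : Φ' - Φ = (discMul A' (fun z hz => H'.analytic z (H'.closedBall_subset hz)) -
      discMul A (fun z hz => H.analytic z (H.closedBall_subset hz))) ∘L
        ContinuousLinearMap.snd ℂ (ι → ℂ) (discAlgebra E s r) := by
    refine ContinuousLinearMap.ext fun ⟨c, u⟩ => ?_
    ext z
    simp [hΦ, hΦ', frameMap, restrict]
  refine hball Φ' ?_
  rw [hdiff]
  refine (ContinuousLinearMap.opNorm_comp_le _ _).trans ?_
  have h1 := norm_discMul_sub_le A' A (fun z hz => H'.analytic z (H'.closedBall_subset hz))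
    (fun z hz => H.analytic z (H.closedBall_subset hz)) hδ.le hAA'
  calc _ ≤ δ * 1 := mul_le_mul h1 (ContinuousLinearMap.norm_snd_le ..)
          (ContinuousLinearMap.opNorm_nonneg _) hδ.le
    _ = δ := mul_one _

end DiscFamily

end Stability

/-! ### Cauchy integral formulas for singular parts. -/

section Cauchy

open Metric

variable {E : Type*} [NormedAddCommGroup E] [NormedSpace ℂ E]

/-- Induction on `k` through the partial fraction of `(ζ - σ)⁻¹ (ζ - p)⁻¹`. Leaving the integral of
`(ζ - σ)⁻¹` unevaluated treats `σ` inside the circle (value `2πi`) and outside it (value `0`) at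
once. -/
theorem circleIntegral_inv_mul_pow {s p σ : ℂ} {r : ℝ} (hp : p ∈ ball s r) (hσp : σ ≠ p)
    (hσ : σ ∉ sphere s r) (k : ℕ) :
    (∮ ζ in C(s, r), (ζ - σ)⁻¹ * ((ζ - p)⁻¹) ^ (k + 1)) =
      ((∮ ζ in C(s, r), (ζ - σ)⁻¹) - 2 * Real.pi * Complex.I) * ((σ - p)⁻¹) ^ (k + 1) := by
  have hr : 0 ≤ r := by
    by_contra h
    rw [ball_eq_empty.2 (not_le.1 h).le] at hp
    exact hp
  have hps : p ∉ sphere s r := fun h => by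
    rw [mem_ball] at hp; rw [mem_sphere] at h; exact hp.ne h
  have hd : σ - p ≠ 0 := sub_ne_zero.2 hσp
  have hci : ∀ w ∉ sphere s r, ContinuousOn (fun ζ : ℂ => (ζ - w)⁻¹) (sphere s r) := fun w hw =>
    ContinuousOn.inv₀ (by fun_prop) fun ζ hζ h => hw (sub_eq_zero.1 h ▸ hζ)
  have key : ∀ k : ℕ, (∮ ζ in C(s, r), (ζ - σ)⁻¹ * ((ζ - p)⁻¹) ^ (k + 1)) =
      (σ - p)⁻¹ * ((∮ ζ in C(s, r), (ζ - σ)⁻¹ * ((ζ - p)⁻¹) ^ k) -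
        ∮ ζ in C(s, r), ((ζ - p)⁻¹) ^ (k + 1)) := by
    intro k
    have i1 : CircleIntegrable (fun ζ : ℂ => (ζ - σ)⁻¹ * ((ζ - p)⁻¹) ^ k) s r :=
      ((hci σ hσ).mul ((hci p hps).pow k)).circleIntegrable hr
    have i2 : CircleIntegrable (fun ζ : ℂ => ((ζ - p)⁻¹) ^ (k + 1)) s r :=
      ((hci p hps).pow (k + 1)).circleIntegrable hr
    rw [← circleIntegral.integral_sub i1 i2, ← smul_eq_mul, ← circleIntegral.integral_smul]
    refine circleIntegral.integral_congr hr fun ζ hζ => ?_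
    have h1 : ζ - σ ≠ 0 := fun h => hσ (sub_eq_zero.1 h ▸ hζ)
    have h2 : ζ - p ≠ 0 := fun h => hps (sub_eq_zero.1 h ▸ hζ)
    simp only [smul_eq_mul, pow_succ]
    have : (ζ - σ)⁻¹ * (ζ - p)⁻¹ = (σ - p)⁻¹ * ((ζ - σ)⁻¹ - (ζ - p)⁻¹) := by
      field_simp
      ring
    linear_combination ((ζ - p)⁻¹) ^ k * this
  induction k with
  | zero =>
    rw [key]
    simp only [zero_add, pow_zero, mul_one, pow_one]
    rw [circleIntegral.integral_sub_inv_of_mem_ball hp]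
    ring
  | succ k ih =>
    -- Only the first power of `(ζ - p)⁻¹` has a residue.
    have h0 : (∮ ζ in C(s, r), ((ζ - p)⁻¹) ^ (k + 1 + 1)) = 0 := by
      have := circleIntegral.integral_sub_zpow_of_ne (n := -((k : ℤ) + 1 + 1)) (by omega) s p r
      rw [← this]
      refine circleIntegral.integral_congr hr fun ζ _ => ?_
      rw [zpow_neg, inv_pow]
      norm_cast
    rw [key, ih, h0, sub_zero, pow_succ]
    ring

theorem circleIntegral_principalSum [CompleteSpace E] {s σ : ℂ} {r : ℝ} {c : ℂ →₀ ℕ →₀ E}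
    (hr : 0 ≤ r) (hc : (c.support : Set ℂ) ⊆ ball s r) (hσc : σ ∉ c.support) (hσ : σ ∉ sphere s r) :
    (∮ ζ in C(s, r), (ζ - σ)⁻¹ • KernelBundle.principalSum c ζ) =
      ((∮ ζ in C(s, r), (ζ - σ)⁻¹) - 2 * Real.pi * Complex.I) • principalSum c σ := by
  have hci : ∀ w ∉ sphere s r, ContinuousOn (fun ζ : ℂ => (ζ - w)⁻¹) (sphere s r) := fun w hw =>
    ContinuousOn.inv₀ (by fun_prop) fun ζ hζ h => hw (sub_eq_zero.1 h ▸ hζ)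
  have hps : ∀ p ∈ c.support, p ∉ sphere s r := fun p hp h => by
    have := hc hp
    rw [mem_ball] at this; rw [mem_sphere] at h; exact this.ne h
  have hint : ∀ p ∈ c.support, ∀ (k : ℕ) (v : E), ContinuousOn
      (fun ζ : ℂ => (ζ - σ)⁻¹ • ((ζ - p)⁻¹) ^ (k + 1) • v) (sphere s r) := fun p hp k v =>
    (hci σ hσ).smul (((hci p (hps p hp)).pow _).smul continuousOn_const)
  simp only [principalSum, Finsupp.sum, Finset.smul_sum]
  rw [circleIntegral.integral_fun_sum]
  swap
  · exact fun p hp => (continuousOn_finsetSum _ fun k _ => hint p hp k _).circleIntegrable hr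
  refine Finset.sum_congr rfl fun p hp => ?_
  rw [circleIntegral.integral_fun_sum]
  swap
  · exact fun k _ => (hint p hp k _).circleIntegrable hr
  refine Finset.sum_congr rfl fun k _ => ?_
  simp only [smul_smul]
  rw [circleIntegral.integral_smul_const,
    circleIntegral_inv_mul_pow (hc hp) (fun h => hσc (by rwa [h])) hσ]

theorem circleIntegral_sub_inv_of_notMem_closedBall {s σ : ℂ} {r : ℝ} (hr : 0 ≤ r)
    (hσ : σ ∉ closedBall s r) : (∮ ζ in C(s, r), (ζ - σ)⁻¹) = 0 := by
  refine Complex.circleIntegral_eq_zero_of_differentiable_on_off_countable hr countable_empty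
    (ContinuousOn.inv₀ (by fun_prop) fun ζ hζ h => hσ (sub_eq_zero.1 h ▸ hζ)) fun z hz => ?_
  have : z - σ ≠ 0 := fun h => hσ (sub_eq_zero.1 h ▸ ball_subset_closedBall hz.1)
  fun_prop (disch := assumption)

/-- Cauchy's formula for the singular part at a point inside the contour. -/
theorem IsSingularPart.eq_sub_circleIntegral [CompleteSpace E] {s σ : ℂ} {r ε : ℝ} {f g : ℂ → E}
    (h : IsSingularPart (ball s ε) f g) (hrε : r < ε)
    (hf : ∀ p ∈ ball s ε, p ∉ ball s r → AnalyticAt ℂ f p) (hσ : σ ∈ ball s r)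
    (hfσ : AnalyticAt ℂ f σ) :
    g σ = f σ - (2 * Real.pi * Complex.I : ℂ)⁻¹ • ∮ ζ in C(s, r), (ζ - σ)⁻¹ • f ζ := by
  have hr : 0 < r := pos_of_mem_ball hσ
  have hcl : closedBall s r ⊆ ball s ε := closedBall_subset_ball hrε
  have hsph : ∀ ζ ∈ sphere s r, ζ ∉ ball s r := fun ζ hζ h => by
    rw [mem_ball] at h; rw [mem_sphere] at hζ; exact h.ne hζ
  obtain ⟨k, hk, hkf⟩ := h.extends_sub.exists_analyticOnNhd
  have hgan : ∀ p, (p ∈ ball s ε → AnalyticAt ℂ f p) → AnalyticAt ℂ g p := fun p hp =>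
    h.analyticAt fun hpε => (hp hpε).extendsAt
  have hfg : ∀ p ∈ ball s ε, AnalyticAt ℂ f p → k p = f p - g p := fun p hp hfp =>
    hkf p hp (hfp.sub (hgan p fun _ => hfp)).continuousAt
  have h1 := Complex.circleIntegral_sub_inv_smul_of_differentiable_on_off_countable
    countable_empty hσ (fun z hz => (hk z (hcl hz)).continuousAt.continuousWithinAt)
    fun z hz => (hk z (hcl (ball_subset_closedBall hz.1))).differentiableAt
  have hσs : σ ∉ sphere s r := fun h => hsph σ h hσ
  obtain ⟨c, hc, rfl, -⟩ := id h
  -- As `f` is holomorphic between the contour and the radius `ε`, every pole of its singular part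
  -- is enclosed.
  have hcsub : (c.support : Set ℂ) ⊆ ball s r := fun p hp => by
    by_contra hpr
    have hfp := hf p (hc hp) hpr
    exact (Finsupp.mem_support_iff.1 hp)
      (eq_zero_of_extendsAt_principalSum (hgan p fun _ => hfp).extendsAt)
  have hσc : σ ∉ c.support := fun hp => (Finsupp.mem_support_iff.1 hp)
    (eq_zero_of_extendsAt_principalSum (hgan σ fun _ => hfσ).extendsAt)
  have h2 := circleIntegral_principalSum hr.le hcsub hσc hσs
  rw [circleIntegral.integral_sub_inv_of_mem_ball hσ, sub_self, zero_smul] at h2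
  have hci : ContinuousOn (fun ζ : ℂ => (ζ - σ)⁻¹) (sphere s r) :=
    ContinuousOn.inv₀ (by fun_prop) fun ζ hζ h => hσs (sub_eq_zero.1 h ▸ hζ)
  have hfs : ∀ ζ ∈ sphere s r, AnalyticAt ℂ f ζ := fun ζ hζ =>
    hf ζ (hcl (sphere_subset_closedBall hζ)) (hsph ζ hζ)
  -- With `σ` inside the contour the singular part integrates to zero, so Cauchy's formula for the
  -- holomorphic part can be written with `f`.
  have h3 : (∮ ζ in C(s, r), (ζ - σ)⁻¹ • f ζ) = ∮ ζ in C(s, r), (ζ - σ)⁻¹ • k ζ := by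
    have h4 : (∮ ζ in C(s, r), (ζ - σ)⁻¹ • k ζ) =
        ∮ ζ in C(s, r), ((ζ - σ)⁻¹ • f ζ - (ζ - σ)⁻¹ • KernelBundle.principalSum c ζ) := by
      refine circleIntegral.integral_congr hr.le fun ζ hζ => ?_
      rw [hfg ζ (hcl (sphere_subset_closedBall hζ)) (hfs ζ hζ), smul_sub]
    rw [h4, circleIntegral.integral_sub, h2, sub_zero]
    · exact (hci.smul fun ζ hζ => (hfs ζ hζ).continuousAt.continuousWithinAt).circleIntegrable hr.le
    · exact (hci.smul fun ζ hζ => (hgan ζ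
        fun _ => hfs ζ hζ).continuousAt.continuousWithinAt).circleIntegrable hr.le
  rw [h3, h1, smul_smul, inv_mul_cancel₀ Complex.two_pi_I_ne_zero, one_smul,
    hfg σ (hcl (ball_subset_closedBall hσ)) hfσ, sub_sub_cancel]

/-- Cauchy's formula for the singular part at a point outside the contour. -/
theorem IsSingularPart.eq_neg_circleIntegral [CompleteSpace E] {s σ : ℂ} {r ε : ℝ} {f g : ℂ → E}
    (h : IsSingularPart (ball s ε) f g) (hr : 0 < r) (hrε : r < ε)
    (hf : ∀ p ∈ ball s ε, p ∉ ball s r → AnalyticAt ℂ f p) (hσ : σ ∉ closedBall s r) :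
    g σ = -((2 * Real.pi * Complex.I : ℂ)⁻¹ • ∮ ζ in C(s, r), (ζ - σ)⁻¹ • f ζ) := by
  have hcl : closedBall s r ⊆ ball s ε := closedBall_subset_ball hrε
  have hsph : ∀ ζ ∈ sphere s r, ζ ∉ ball s r := fun ζ hζ h => by
    rw [mem_ball] at h; rw [mem_sphere] at hζ; exact h.ne hζ
  obtain ⟨k, hk, hkf⟩ := h.extends_sub.exists_analyticOnNhd
  have hgan : ∀ p, (p ∈ ball s ε → AnalyticAt ℂ f p) → AnalyticAt ℂ g p := fun p hp =>
    h.analyticAt fun hpε => (hp hpε).extendsAt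
  have hfg : ∀ p ∈ ball s ε, AnalyticAt ℂ f p → k p = f p - g p := fun p hp hfp =>
    hkf p hp (hfp.sub (hgan p fun _ => hfp)).continuousAt
  have hσs : σ ∉ sphere s r := fun h => hσ (sphere_subset_closedBall h)
  obtain ⟨c, hc, rfl, -⟩ := id h
  have hcsub : (c.support : Set ℂ) ⊆ ball s r := fun p hp => by
    by_contra hpr
    have hfp := hf p (hc hp) hpr
    exact (Finsupp.mem_support_iff.1 hp)
      (eq_zero_of_extendsAt_principalSum (hgan p fun _ => hfp).extendsAt)
  have hσc : σ ∉ c.support := fun hp => hσ (ball_subset_closedBall (hcsub hp))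
  have h2 := circleIntegral_principalSum hr.le hcsub hσc hσs
  rw [circleIntegral_sub_inv_of_notMem_closedBall hr.le hσ, zero_sub] at h2
  have hci : ContinuousOn (fun ζ : ℂ => (ζ - σ)⁻¹) (closedBall s r) :=
    ContinuousOn.inv₀ (by fun_prop) fun ζ hζ h => hσ (sub_eq_zero.1 h ▸ hζ)
  have h1 : (∮ ζ in C(s, r), (ζ - σ)⁻¹ • k ζ) = 0 := by
    refine Complex.circleIntegral_eq_zero_of_differentiable_on_off_countable hr.le countable_empty
      (hci.smul fun z hz => (hk z (hcl hz)).continuousAt.continuousWithinAt) fun z hz => ?_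
    have h0 : z - σ ≠ 0 := fun h => hσ (sub_eq_zero.1 h ▸ ball_subset_closedBall hz.1)
    have h1 := (hk z (hcl (ball_subset_closedBall hz.1))).differentiableAt
    exact DifferentiableAt.smul (by fun_prop (disch := assumption)) h1
  have hfs : ∀ ζ ∈ sphere s r, AnalyticAt ℂ f ζ := fun ζ hζ =>
    hf ζ (hcl (sphere_subset_closedBall hζ)) (hsph ζ hζ)
  have hci' := hci.mono sphere_subset_closedBall
  -- With `σ` outside, the holomorphic part integrates to zero instead, and the integral of `f` sees
  -- only the singular part.
  have h3 : (∮ ζ in C(s, r), (ζ - σ)⁻¹ • f ζ) - (∮ ζ in C(s, r), (ζ - σ)⁻¹ • KernelBundle.principalSum c ζ) =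
      ∮ ζ in C(s, r), (ζ - σ)⁻¹ • k ζ := by
    rw [← circleIntegral.integral_sub]
    · refine circleIntegral.integral_congr hr.le fun ζ hζ => ?_
      rw [hfg ζ (hcl (sphere_subset_closedBall hζ)) (hfs ζ hζ), smul_sub]
    · exact (hci'.smul fun ζ hζ => (hfs ζ hζ).continuousAt.continuousWithinAt).circleIntegrable
        hr.le
    · exact (hci'.smul fun ζ hζ => (hgan ζ
        fun _ => hfs ζ hζ).continuousAt.continuousWithinAt).circleIntegrable hr.le
  rw [h1, h2, sub_eq_zero] at h3
  rw [h3, smul_smul, mul_neg, inv_mul_cancel₀ Complex.two_pi_I_ne_zero, neg_one_smul, neg_neg]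

end Cauchy

/-! ### Smooth dependence of integrals on parameters. -/

section Parametric

variable {X : Type} [NormedAddCommGroup X] [NormedSpace ℝ X] [ProperSpace X]

/-- Properness of `X` makes a small closed ball times the interval compact, so the partial
derivative has a constant dominating bound. -/
theorem hasFDerivAt_intervalIntegral_param {G : Type*} [NormedAddCommGroup G] [NormedSpace ℝ G]
    {s : Set X} (hs : IsOpen s) (a b : ℝ) {f : X × ℝ → G}
    (hf : ContDiffOn ℝ ∞ f (s ×ˢ univ)) {x : X} (hx : x ∈ s) :
    HasFDerivAt (fun x => ∫ t in a..b, f (x, t))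
      (∫ t in a..b, (fderiv ℝ f (x, t)) ∘L ContinuousLinearMap.inl ℝ X ℝ) x := by
  have hso : IsOpen (s ×ˢ (univ : Set ℝ)) := hs.prod isOpen_univ
  have hf1 : ContinuousOn (fun p : X × ℝ => fderiv ℝ f p ∘L ContinuousLinearMap.inl ℝ X ℝ)
      (s ×ˢ univ) :=
    (hf.continuousOn_fderiv_of_isOpen hso (by simp)).clm_comp continuousOn_const
  have hslice : ∀ {H : Type _} [NormedAddCommGroup H] {g : X × ℝ → H}, ContinuousOn g (s ×ˢ univ) →
      ∀ y ∈ s, Continuous fun t : ℝ => g (y, t) := fun hg y hy =>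
    hg.comp_continuous (by fun_prop) fun t => ⟨hy, mem_univ t⟩
  obtain ⟨δ, hδ, hball⟩ := Metric.nhds_basis_closedBall.mem_iff.1 (hs.mem_nhds hx)
  obtain ⟨C, hC⟩ := ((isCompact_closedBall x δ).prod
    (isCompact_uIcc (a := a) (b := b))).exists_bound_of_continuousOn
      (hf1.mono (prod_mono hball (subset_univ _)))
  refine intervalIntegral.hasFDerivAt_integral_of_dominated_of_fderiv_le
    (F := fun x t => f (x, t)) (F' := fun x t => fderiv ℝ f (x, t) ∘L ContinuousLinearMap.inl ℝ X ℝ)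
    (bound := fun _ => C)
    (Metric.closedBall_mem_nhds x hδ) ?_ ?_ ?_ ?_ ?_ ?_
  · filter_upwards [hs.mem_nhds hx] with y hy
    exact (hslice hf.continuousOn y hy).aestronglyMeasurable
  · exact (hslice hf.continuousOn x hx).intervalIntegrable _ _
  · exact (hslice hf1 x hx).aestronglyMeasurable
  · exact Eventually.of_forall fun t ht y hy => hC (y, t) ⟨hy, uIoc_subset_uIcc ht⟩
  · exact intervalIntegrable_const
  · refine Eventually.of_forall fun t _ y hy => ?_
    have h1 : DifferentiableAt ℝ f (y, t) :=
      (hf.differentiableOn (by simp)).differentiableAt (hso.mem_nhds ⟨hball hy, mem_univ t⟩)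
    have h2 : HasFDerivAt (fun y : X => (y, t)) (ContinuousLinearMap.inl ℝ X ℝ) y :=
      hasFDerivAt_prodMk_left y t
    exact h1.hasFDerivAt.comp y h2

universe u

/-- Differentiation under the integral sign, to all orders. -/
theorem contDiffOn_intervalIntegral_param {G : Type u} [NormedAddCommGroup G] [NormedSpace ℝ G]
    {s : Set X} (hs : IsOpen s) (a b : ℝ) {f : X × ℝ → G}
    (hf : ContDiffOn ℝ ∞ f (s ×ˢ univ)) :
    ContDiffOn ℝ ∞ (fun x => ∫ t in a..b, f (x, t)) s := by
  rw [contDiffOn_infty]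
  intro n
  -- The derivative is an integral of the same kind with values in `X →L[ℝ] G`; this space remains
  -- in universe `u` because `X : Type`.
  induction n generalizing G with
  | zero =>
    rw [Nat.cast_zero, contDiffOn_zero]
    exact fun x hx =>
      (hasFDerivAt_intervalIntegral_param hs a b hf hx).continuousAt.continuousWithinAt
  | succ n ih =>
    have hso : IsOpen (s ×ˢ (univ : Set ℝ)) := hs.prod isOpen_univ
    have hf1 : ContDiffOn ℝ ∞ (fun p : X × ℝ => fderiv ℝ f p ∘L ContinuousLinearMap.inl ℝ X ℝ)
        (s ×ˢ univ) :=
      ((contDiffOn_infty_iff_fderiv_of_isOpen hso).1 hf).2.clm_comp contDiffOn_const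
    rw [Nat.cast_succ, contDiffOn_succ_iff_fderiv_of_isOpen hs]
    refine ⟨fun x hx =>
      (hasFDerivAt_intervalIntegral_param hs a b hf hx).differentiableAt.differentiableWithinAt,
      by simp, ?_⟩
    exact (ih hf1).congr fun x hx => (hasFDerivAt_intervalIntegral_param hs a b hf hx).fderiv

end Parametric

/-! ### Smooth dependence of singular parts on parameters. -/

section SingularPartSmooth

open Metric

variable {n : ℕ} {Y : Type*} [TopologicalSpace Y]
    [ChartedSpace (EuclideanSpace ℝ (Fin n)) Y] [IsManifold (𝓡 n) ∞ Y]
  {E : Type*} [NormedAddCommGroup E] [NormedSpace ℂ E]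

/-- Smoothness of a Cauchy integral depending on parameters. -/
theorem contMDiffAt_circleIntegral {f : Y × ℂ → E} {Ω : Set (Y × ℂ)}
    (hf : ContMDiffOn ((𝓡 n).prod 𝓘(ℝ, ℂ)) 𝓘(ℝ, E) ∞ f Ω) {s : ℂ} {r : ℝ} (hr : 0 ≤ r) {y₁ : Y}
    {σ₁ : ℂ} (hy : ∀ᶠ y in 𝓝 y₁, ∀ ζ ∈ sphere s r, (y, ζ) ∈ Ω) (hσ : σ₁ ∉ sphere s r) :
    ContMDiffAt ((𝓡 n).prod 𝓘(ℝ, ℂ)) 𝓘(ℝ, E) ∞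
      (fun p : Y × ℂ => ∮ ζ in C(s, r), (ζ - p.2)⁻¹ • f (p.1, ζ)) (y₁, σ₁) := by
  obtain ⟨W, hW, hWo, hyW⟩ := eventually_nhds_iff.1 hy
  -- A chart turns the contour integral into an integral over a fixed interval, with parameters in
  -- an open subset of a finite-dimensional space.
  let χ := extChartAt (𝓡 n) y₁
  let S : Set (EuclideanSpace ℝ (Fin n) × ℂ) := (χ.target ∩ χ.symm ⁻¹' W) ×ˢ (sphere s r)ᶜ
  have hχo : IsOpen (χ.target ∩ χ.symm ⁻¹' W) :=
    (continuousOn_extChartAt_symm y₁).isOpen_inter_preimage (isOpen_extChartAt_target y₁) hWo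
  have hS : IsOpen S := hχo.prod isClosed_sphere.isOpen_compl
  let g : (EuclideanSpace ℝ (Fin n) × ℂ) × ℝ → E := fun q =>
    deriv (circleMap s r) q.2 • (circleMap s r q.2 - q.1.2)⁻¹ • f (χ.symm q.1.1, circleMap s r q.2)
  have hcm : ContDiff ℝ ∞ (circleMap s r) := contDiff_circleMap s r
  have hg : ContDiffOn ℝ ∞ g (S ×ˢ univ) := by
    have h1 : ContDiff ℝ ∞ fun q : (EuclideanSpace ℝ (Fin n) × ℂ) × ℝ => circleMap s r q.2 :=
      hcm.comp contDiff_snd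
    have h2 : ContDiff ℝ ∞ fun q : (EuclideanSpace ℝ (Fin n) × ℂ) × ℝ =>
        deriv (circleMap s r) q.2 := by
      simp only [deriv_circleMap]
      exact ((contDiff_circleMap 0 r).comp contDiff_snd).mul contDiff_const
    have h3 : ContDiffOn ℝ ∞ (fun q : (EuclideanSpace ℝ (Fin n) × ℂ) × ℝ =>
        (circleMap s r q.2 - q.1.2)⁻¹) (S ×ˢ univ) := by
      refine ContDiffOn.inv (h1.sub (contDiff_snd.comp contDiff_fst)).contDiffOn fun q hq h => ?_
      exact hq.1.2 (sub_eq_zero.1 h ▸ circleMap_mem_sphere s hr q.2)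
    have h4 : ContDiffOn ℝ ∞ (fun q : (EuclideanSpace ℝ (Fin n) × ℂ) × ℝ =>
        f (χ.symm q.1.1, circleMap s r q.2)) (S ×ˢ univ) := by
      rw [← contMDiffOn_iff_contDiffOn]
      refine hf.comp (t := Ω) (I' := (𝓡 n).prod 𝓘(ℝ, ℂ)) ?_ fun q hq =>
        hW _ hq.1.1.2 _ (circleMap_mem_sphere s hr q.2)
      refine ContMDiffOn.prodMk ?_ ?_
      · have h5 : ContMDiffOn 𝓘(ℝ, (EuclideanSpace ℝ (Fin n) × ℂ) × ℝ)
            𝓘(ℝ, EuclideanSpace ℝ (Fin n)) ∞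
            (fun q : (EuclideanSpace ℝ (Fin n) × ℂ) × ℝ => q.1.1) (S ×ˢ univ) :=
          (contDiff_fst.comp contDiff_fst).contMDiff.contMDiffOn
        exact (contMDiffOn_extChartAt_symm y₁).comp h5 fun q hq => hq.1.1.1
      · exact h1.contMDiff.contMDiffOn
    exact h2.contDiffOn.smul (h3.smul h4)
  have hF := contDiffOn_intervalIntegral_param hS 0 (2 * Real.pi) hg
  have hmem : (χ y₁, σ₁) ∈ S := by
    refine ⟨⟨mem_extChartAt_target y₁, ?_⟩, hσ⟩
    change χ.symm (χ y₁) ∈ W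
    rw [extChartAt_to_inv]; exact hyW
  have h1 : ContMDiffAt 𝓘(ℝ, EuclideanSpace ℝ (Fin n) × ℂ) 𝓘(ℝ, E) ∞
      (fun x => ∫ t in (0 : ℝ)..2 * Real.pi, g (x, t)) (χ y₁, σ₁) :=
    (hF.contDiffAt (hS.mem_nhds hmem)).contMDiffAt
  have h2 : ContMDiffAt ((𝓡 n).prod 𝓘(ℝ, ℂ)) 𝓘(ℝ, EuclideanSpace ℝ (Fin n) × ℂ) ∞
      (fun p : Y × ℂ => (χ p.1, p.2)) (y₁, σ₁) := by
    refine ContMDiffAt.prodMk_space ?_ contMDiffAt_snd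
    exact (contMDiffAt_extChartAt (x := y₁)).comp (y₁, σ₁) contMDiffAt_fst
  refine (ContMDiffAt.comp (y₁, σ₁) h1 h2).congr_of_eventuallyEq ?_
  have hsrc : ∀ᶠ p : Y × ℂ in 𝓝 (y₁, σ₁), p.1 ∈ χ.source :=
    continuous_fst.continuousAt.eventually (extChartAt_source_mem_nhds (I := 𝓡 n) y₁)
  filter_upwards [hsrc] with p hp
  simp only [circleIntegral, g, Function.comp_apply]
  rw [χ.left_inv hp]

/-- Singular parts of smooth families of meromorphic functions depend smoothly on parameters away
from the singularities. -/
theorem contMDiffAt_singularPart [CompleteSpace E] {f g : Y → ℂ → E} {s : ℂ} {ε ρ : ℝ}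
    (hρ : 0 < ρ) (hρε : ρ < ε) {U : Set Y} (hU : IsOpen U) {Z : Set (Y × ℂ)}
    (hZ : IsClosed Z) (hZρ : ∀ y ∈ U, ∀ σ ∈ ball s ε, (y, σ) ∈ Z → σ ∈ ball s ρ)
    (hf : ContMDiffOn ((𝓡 n).prod 𝓘(ℝ, ℂ)) 𝓘(ℝ, E) ∞ (fun p : Y × ℂ => f p.1 p.2)
      {p | p.1 ∈ U ∧ p.2 ∈ ball s ε ∧ p ∉ Z})
    (han : ∀ y ∈ U, ∀ σ ∈ ball s ε, (y, σ) ∉ Z → AnalyticAt ℂ (f y) σ)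
    (hg : ∀ y ∈ U, IsSingularPart (ball s ε) (f y) (g y)) {y₁ : Y} {σ₁ : ℂ} (hy₁ : y₁ ∈ U)
    (hσ₁ : (y₁, σ₁) ∉ Z) :
    ContMDiffAt ((𝓡 n).prod 𝓘(ℝ, ℂ)) 𝓘(ℝ, E) ∞ (fun p : Y × ℂ => g p.1 p.2) (y₁, σ₁) := by
  set Ω : Set (Y × ℂ) := {p | p.1 ∈ U ∧ p.2 ∈ ball s ε ∧ p ∉ Z} with hΩdef
  have hΩ : IsOpen Ω :=
    (hU.preimage continuous_fst).inter
      ((isOpen_ball.preimage continuous_snd).inter hZ.isOpen_compl)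
  have hsphere : ∀ r, ρ ≤ r → r < ε → ∀ y ∈ U, ∀ ζ ∈ sphere s r, (y, ζ) ∈ Ω := by
    intro r hr hrε y hy ζ hζ
    have hζε : ζ ∈ ball s ε := by rw [mem_ball, mem_sphere.1 hζ]; exact hrε
    refine ⟨hy, hζε, fun hz => ?_⟩
    have := hZρ y hy ζ hζε hz
    rw [mem_ball, mem_sphere.1 hζ] at this
    linarith
  have han' : ∀ r, ρ ≤ r → ∀ y ∈ U, ∀ p ∈ ball s ε, p ∉ ball s r → AnalyticAt ℂ (f y) p :=
    fun r hr y hy p hp hpr => han y hy p hp fun hz =>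
      hpr (ball_subset_ball hr (hZρ y hy p hp hz))
  have hev : ∀ᶠ p : Y × ℂ in 𝓝 (y₁, σ₁), p.1 ∈ U ∧ p ∉ Z :=
    ((hU.preimage continuous_fst).inter hZ.isOpen_compl).mem_nhds ⟨hy₁, hσ₁⟩
  -- For `σ₁` in the closed disc of radius `ρ`, a slightly larger circle encloses it; otherwise the
  -- circle of radius `ρ` leaves it outside. Both circles avoid `Z`.
  by_cases hcase : dist σ₁ s ≤ ρ
  · obtain ⟨r, hr1, hr2⟩ := exists_between hρε
    have hσr : σ₁ ∈ ball s r := mem_ball.2 (hcase.trans_lt hr1)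
    have hC := contMDiffAt_circleIntegral hf (hρ.trans hr1).le (y₁ := y₁) (σ₁ := σ₁)
      (by filter_upwards [hU.mem_nhds hy₁] with y hy using hsphere r hr1.le hr2 y hy)
      (fun h => by rw [mem_sphere] at h; rw [mem_ball] at hσr; exact hσr.ne h)
    have hσε : σ₁ ∈ ball s ε := ball_subset_ball hr2.le hσr
    have hfa : ContMDiffAt ((𝓡 n).prod 𝓘(ℝ, ℂ)) 𝓘(ℝ, E) ∞ (fun p : Y × ℂ => f p.1 p.2) (y₁, σ₁) :=
      hf.contMDiffAt (hΩ.mem_nhds ⟨hy₁, hσε, hσ₁⟩)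
    refine (hfa.sub ((contDiff_const_smul (𝕜 := ℝ)
      ((2 * Real.pi * Complex.I : ℂ)⁻¹)).contMDiff.contMDiffAt.comp (y₁, σ₁) hC)).congr_of_eventuallyEq ?_
    have hev2 : ∀ᶠ p : Y × ℂ in 𝓝 (y₁, σ₁), p.2 ∈ ball s r :=
      continuous_snd.continuousAt.eventually (isOpen_ball.mem_nhds hσr)
    filter_upwards [hev, hev2] with p hp hp2
    exact (hg p.1 hp.1).eq_sub_circleIntegral hr2 (han' r hr1.le p.1 hp.1) hp2
      (han p.1 hp.1 p.2 (ball_subset_ball hr2.le hp2) hp.2)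
  · have hσr : σ₁ ∉ closedBall s ρ := hcase
    have hC := contMDiffAt_circleIntegral hf hρ.le (y₁ := y₁) (σ₁ := σ₁)
      (by filter_upwards [hU.mem_nhds hy₁] with y hy using hsphere ρ le_rfl hρε y hy)
      (fun h => hσr (sphere_subset_closedBall h))
    refine (((contDiff_const_smul (𝕜 := ℝ)
      ((2 * Real.pi * Complex.I : ℂ)⁻¹)).contMDiff.contMDiffAt.comp (y₁, σ₁) hC).neg).congr_of_eventuallyEq ?_
    have hnhds : (closedBall s ρ)ᶜ ∈ 𝓝 σ₁ := isClosed_closedBall.isOpen_compl.mem_nhds hσr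
    have hev2 : ∀ᶠ p : Y × ℂ in 𝓝 (y₁, σ₁), p.2 ∉ closedBall s ρ :=
      (continuous_snd.tendsto (y₁, σ₁)).eventually hnhds
    filter_upwards [hev, hev2] with p hp hp2
    exact (hg p.1 hp.1).eq_neg_circleIntegral hρ hρε (han' ρ le_rfl p.1 hp.1) hp2

end SingularPartSmooth

namespace FredholmFamily

/-! ### The Fredholm family in trivializations. -/

section Basic

variable {n : ℕ} {Y : Type*} [TopologicalSpace Y] [ChartedSpace (EuclideanSpace ℝ (Fin n)) Y]
  {F₁ : Type*} [NormedAddCommGroup F₁] [InnerProductSpace ℂ F₁]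
  {F₂ : Type*} [NormedAddCommGroup F₂] [InnerProductSpace ℂ F₂] [CompleteSpace F₂]
  {D₀ : Type*} [NormedAddCommGroup D₀] [InnerProductSpace ℂ D₀] [CompleteSpace D₀]
  {H₁ : Y → Type*} [∀ y, NormedAddCommGroup (H₁ y)] [∀ y, InnerProductSpace ℂ (H₁ y)]
  {H₂ : Y → Type*} [∀ y, NormedAddCommGroup (H₂ y)] [∀ y, InnerProductSpace ℂ (H₂ y)]
  {D : Y → Type*} [∀ y, NormedAddCommGroup (D y)] [∀ y, InnerProductSpace ℂ (D y)]
  {S : FredholmFamily n Y F₁ F₂ D₀ H₁ H₂ D}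
  {e₁ : PairTriv S.B₁.ι S.B₁.ι₀} {e₂ : UnitaryTriv F₂ H₂} {y₀ : Y}

omit [CompleteSpace F₂] [CompleteSpace D₀] in
theorem ι₀_injective (hy : y₀ ∈ e₁.base) : Function.Injective S.B₁.ι₀ := by
  intro a b h
  have h1 : ∀ d, S.B₁.ι₀ d = e₁.map y₀ (S.B₁.ι y₀ ((e₁.mapD y₀).symm d)) := fun d => by
    rw [← e₁.compat y₀ hy, ContinuousLinearEquiv.apply_symm_apply]
  rw [h1, h1] at h
  exact (e₁.mapD y₀).symm.injective (S.B₁.ι_injective y₀ ((e₁.map y₀).injective h))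

omit [CompleteSpace F₂] [CompleteSpace D₀] in
theorem isInvertible_loc_iff {y : Y} {σ : ℂ} :
    (S.loc e₁ e₂ y σ).IsInvertible ↔ (S.P y σ).IsInvertible := by
  rw [loc, ContinuousLinearMap.isInvertible_equiv_comp, ContinuousLinearMap.isInvertible_comp_equiv]

omit [CompleteSpace F₂] [CompleteSpace D₀] in
theorem loc_apply (y : Y) (σ : ℂ) (d : D₀) :
    S.loc e₁ e₂ y σ d = e₂.map y (S.P y σ ((e₁.mapD y).symm d)) := rfl

omit [CompleteSpace D₀] in
theorem analyticAt_loc (y : Y) {σ : ℂ} (hσ : σ ∈ S.Sig) : AnalyticAt ℂ (S.loc e₁ e₂ y) σ := by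
  have : DifferentiableOn ℂ (S.loc e₁ e₂ y) S.Sig :=
    (differentiableOn_const _).clm_comp ((S.holomorphic y).clm_comp (differentiableOn_const _))
  exact this.analyticAt (S.isOpen_Sig.mem_nhds hσ)

omit [CompleteSpace F₂] [CompleteSpace D₀] in
theorem contMDiffOn_loc (he₁ : e₁ ∈ S.B₁.atlas) (he₂ : e₂ ∈ S.B₂.atlas) :
    ContMDiffOn ((𝓡 n).prod 𝓘(ℝ, ℂ)) 𝓘(ℝ, D₀ →L[ℂ] F₂) ∞
      (fun p : Y × ℂ => S.loc e₁ e₂ p.1 p.2) ((e₁.base ∩ e₂.base) ×ˢ S.Sig) :=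
  S.smooth e₁ he₁ e₂ he₂

omit [CompleteSpace F₂] [CompleteSpace D₀] in
theorem isOpen_domain : IsOpen ((e₁.base ∩ e₂.base) ×ˢ S.Sig) :=
  (e₁.isOpen_base.inter e₂.isOpen_base).prod S.isOpen_Sig

omit [CompleteSpace F₂] [CompleteSpace D₀] in
theorem continuousAt_loc (he₁ : e₁ ∈ S.B₁.atlas) (he₂ : e₂ ∈ S.B₂.atlas) {y : Y} {σ : ℂ}
    (h₁ : y ∈ e₁.base) (h₂ : y ∈ e₂.base) (hσ : σ ∈ S.Sig) :
    ContinuousAt (fun p : Y × ℂ => S.loc e₁ e₂ p.1 p.2) (y, σ) :=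
  (contMDiffOn_loc he₁ he₂).continuousOn.continuousAt (isOpen_domain.mem_nhds ⟨⟨h₁, h₂⟩, hσ⟩)

omit [CompleteSpace F₂] [CompleteSpace D₀] in
theorem isClosed_singE : IsClosed S.singE := S.isClosed_sing

omit [CompleteSpace F₂] [CompleteSpace D₀] in
theorem isInvertible_loc {y : Y} {σ : ℂ} (hσ : σ ∈ S.Sig) (h : σ ∉ S.singB y) :
    (S.loc e₁ e₂ y σ).IsInvertible := by
  rw [isInvertible_loc_iff]
  by_contra h'
  exact h ⟨hσ, h'⟩

omit [CompleteSpace F₂] [CompleteSpace D₀] in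
theorem finiteDimensional_Ks {s : ℂ} (hs : s ∈ S.Sig) :
    FiniteDimensional ℂ (S.Ks e₁ e₂ y₀ s) := by
  have := (S.fredholm y₀ s hs).finite_ker
  have hmem : ∀ x : S.Ks e₁ e₂ y₀ s, (e₁.mapD y₀).symm x ∈ (S.P y₀ s).ker := fun x =>
    (e₂.map y₀).injective ((x.2 : S.loc e₁ e₂ y₀ s x = 0).trans (map_zero _).symm)
  let f : S.Ks e₁ e₂ y₀ s →ₗ[ℂ] (S.P y₀ s).ker :=
    (((e₁.mapD y₀).symm : D₀ →ₗ[ℂ] D y₀) ∘ₗ (S.Ks e₁ e₂ y₀ s).subtype).codRestrict _ hmem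
  refine FiniteDimensional.of_injective f fun x x' h => ?_
  exact Subtype.ext ((e₁.mapD y₀).symm.injective (congrArg Subtype.val h))

omit [CompleteSpace F₂] [CompleteSpace D₀] in
theorem isClosed_range_loc {s : ℂ} (hs : s ∈ S.Sig) :
    IsClosed ((S.loc e₁ e₂ y₀ s).range : Set F₂) := by
  have h1 : ((S.loc e₁ e₂ y₀ s).range : Set F₂) = e₂.map y₀ '' ((S.P y₀ s).range : Set (H₂ y₀)) := by
    ext f
    constructor
    · rintro ⟨d, rfl⟩
      exact ⟨_, ⟨(e₁.mapD y₀).symm d, rfl⟩, rfl⟩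
    · rintro ⟨_, ⟨d, rfl⟩, rfl⟩
      exact ⟨e₁.mapD y₀ d, by
        change S.loc e₁ e₂ y₀ s (e₁.mapD y₀ d) = _
        rw [loc_apply, ContinuousLinearEquiv.symm_apply_apply]; rfl⟩
  rw [h1]
  exact (e₂.map y₀).toHomeomorph.isClosedMap _ (S.fredholm y₀ s hs).isClosed_range

theorem isInvertible_corner_self (hy : y₀ ∈ e₁.base) {s : ℂ} (hs : s ∈ S.Sig) :
    (S.corner e₁ e₂ y₀ s y₀ s).IsInvertible := by
  have := finiteDimensional_Ks (e₁ := e₁) (e₂ := e₂) (y₀ := y₀) hs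
  exact isInvertible_block₂₂_self (ι₀_injective hy) (isClosed_range_loc hs)

theorem eventually_isInvertible_corner (he₁ : e₁ ∈ S.B₁.atlas) (he₂ : e₂ ∈ S.B₂.atlas) {s : ℂ}
    {y : Y} {σ : ℂ} (h₁ : y ∈ e₁.base) (h₂ : y ∈ e₂.base) (hσ : σ ∈ S.Sig)
    (h : (S.corner e₁ e₂ y₀ s y σ).IsInvertible) :
    ∀ᶠ p : Y × ℂ in 𝓝 (y, σ), (S.corner e₁ e₂ y₀ s p.1 p.2).IsInvertible := by
  have hc : ContinuousAt (fun p : Y × ℂ => S.corner e₁ e₂ y₀ s p.1 p.2) (y, σ) :=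
    (contDiff_block₂₂ (n := 0)).continuous.continuousAt.comp (continuousAt_loc he₁ he₂ h₁ h₂ hσ)
  exact KernelBundle.eventually_isInvertible hc h

end Basic

/-! ### Existence of admissible neighborhoods. -/

section AdmissibleNeighborhoods

variable {n : ℕ} {Y : Type*} [TopologicalSpace Y] [ChartedSpace (EuclideanSpace ℝ (Fin n)) Y]
  {F₁ : Type*} [NormedAddCommGroup F₁] [InnerProductSpace ℂ F₁]
  {F₂ : Type*} [NormedAddCommGroup F₂] [InnerProductSpace ℂ F₂] [CompleteSpace F₂]
  {D₀ : Type*} [NormedAddCommGroup D₀] [InnerProductSpace ℂ D₀]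
  {H₁ : Y → Type*} [∀ y, NormedAddCommGroup (H₁ y)] [∀ y, InnerProductSpace ℂ (H₁ y)]
  {H₂ : Y → Type*} [∀ y, NormedAddCommGroup (H₂ y)] [∀ y, InnerProductSpace ℂ (H₂ y)]
  {D : Y → Type*} [∀ y, NormedAddCommGroup (D y)] [∀ y, InnerProductSpace ℂ (D y)]
  {S : FredholmFamily n Y F₁ F₂ D₀ H₁ H₂ D}
  {e₁ : PairTriv S.B₁.ι S.B₁.ι₀} {e₂ : UnitaryTriv F₂ H₂} {y₀ : Y}

omit [ChartedSpace (EuclideanSpace ℝ (Fin n)) Y] in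
theorem exists_isConnected_open_subset (n : ℕ) [ChartedSpace (EuclideanSpace ℝ (Fin n)) Y]
    {y₀ : Y} {N : Set Y} (hN : N ∈ 𝓝 y₀) :
    ∃ U ⊆ N, IsOpen U ∧ IsConnected U ∧ y₀ ∈ U := by
  have : LocallyConnectedSpace Y := ChartedSpace.locallyConnectedSpace (EuclideanSpace ℝ (Fin n)) Y
  have hy : y₀ ∈ interior N := mem_interior_iff_mem_nhds.2 hN
  exact ⟨connectedComponentIn (interior N) y₀,
    (connectedComponentIn_subset _ _).trans interior_subset, isOpen_interior.connectedComponentIn,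
    isConnected_connectedComponentIn_iff.2 hy, mem_connectedComponentIn hy⟩

theorem Admissible.mono {ε : ℝ} {U U' : Set Y} (h : S.Admissible e₁ e₂ y₀ ε U) (hU : U' ⊆ U)
    (ho : IsOpen U') (hc : IsConnected U') (hy : y₀ ∈ U') : S.Admissible e₁ e₂ y₀ ε U' where
  ε_pos := h.ε_pos
  isOpen := ho
  isConnected := hc
  mem := hy
  subset₁ := hU.trans h.subset₁
  subset₂ := hU.trans h.subset₂
  disjoint := h.disjoint
  ball_subset := h.ball_subset
  corner_base := h.corner_base
  corner := fun s hs y hyU => h.corner s hs y (hU hyU)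
  sing_subset := fun y hyU => h.sing_subset y (hU hyU)

theorem _root_.Set.Finite.exists_pairwiseDisjoint_ball {Z : Set ℂ} (hZ : Z.Finite) :
    ∃ ε₀ > 0, ∀ ε < ε₀, Z.PairwiseDisjoint fun s => Metric.ball s ε := by
  classical
  by_cases hne : Z.Nontrivial
  · have hpos := hZ.infsep_pos_iff_nontrivial.2 hne
    refine ⟨Z.infsep / 2, by positivity, fun ε hε s hs t ht hst => ?_⟩
    refine Metric.ball_disjoint_ball ?_
    have h2 : Z.infsep ≤ dist s t := Set.infsep_le_dist_of_mem hs ht hst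
    linarith
  · exact ⟨1, one_pos, fun ε _ => (not_nontrivial_iff.1 hne).pairwise _⟩

/-- Admissible neighborhoods exist for small `ε`, if the singular sets are locally bounded. -/
theorem exists_admissible [CompleteSpace D₀] (he₁ : e₁ ∈ S.B₁.atlas) (hy₁ : y₀ ∈ e₁.base)
    (he₂ : e₂ ∈ S.B₂.atlas) (hy₂ : y₀ ∈ e₂.base)
    (hbd : ∃ V ∈ 𝓝 y₀, Bornology.IsBounded (⋃ y ∈ V, S.singB y)) :
    ∃ ε₀ > 0, ∀ ε : ℝ, 0 < ε → ε < ε₀ → ∀ N ∈ 𝓝 y₀, ∃ U ⊆ N, S.Admissible e₁ e₂ y₀ ε U := by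
  obtain ⟨V, hV, hVbd⟩ := hbd
  obtain ⟨R, hR⟩ := hVbd.subset_closedBall 0
  obtain ⟨ε₁, hε₁, hdisj⟩ := (S.finite_sing y₀).exists_pairwiseDisjoint_ball
  have hloc : ∀ s ∈ S.singB y₀, ∀ᶠ ε in 𝓝[>] (0 : ℝ), Metric.ball s (2 * ε) ⊆
      S.Sig ∩ {σ | (S.corner e₁ e₂ y₀ s y₀ σ).IsInvertible} := by
    intro s hs
    have h1 := eventually_isInvertible_corner he₁ he₂ hy₁ hy₂ hs.1
      (isInvertible_corner_self (e₂ := e₂) hy₁ hs.1)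
    have h2 : ∀ᶠ σ in 𝓝 s, (S.corner e₁ e₂ y₀ s y₀ σ).IsInvertible :=
      (Continuous.prodMk_right y₀).continuousAt.eventually h1
    obtain ⟨δ, hδ, hball⟩ := Metric.mem_nhds_iff.1 (inter_mem (S.isOpen_Sig.mem_nhds hs.1) h2)
    filter_upwards [Ioo_mem_nhdsGT (show (0 : ℝ) < δ / 2 by positivity)] with ε hε
    exact (Metric.ball_subset_ball (by linarith [hε.2])).trans hball
  have hall : ∀ᶠ ε in 𝓝[>] (0 : ℝ), ∀ s ∈ S.singB y₀, Metric.ball s (2 * ε) ⊆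
      S.Sig ∩ {σ | (S.corner e₁ e₂ y₀ s y₀ σ).IsInvertible} :=
    (eventually_all_finite (S.finite_sing y₀)).2 hloc
  obtain ⟨ε₂, hε₂, hsub⟩ := mem_nhdsGT_iff_exists_Ioo_subset.1 hall
  -- Disjointness is needed for the radius `2 * ε`, hence `ε₁ / 2`; the bound `ε₂` handles the
  -- inclusion in `Sig` and the invertibility of the corner.
  refine ⟨min (ε₁ / 2) ε₂, lt_min (by positivity) hε₂, fun ε hε0 hε N hN => ?_⟩
  have hεε₂ := hsub ⟨hε0, hε.trans_le (min_le_right _ _)⟩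
  have hεε₁ : 2 * ε < ε₁ := by linarith [hε.trans_le (min_le_left _ _)]
  have hcorner : ∀ᶠ y in 𝓝 y₀, ∀ s ∈ S.singB y₀, ∀ σ ∈ Metric.closedBall s ε,
      (S.corner e₁ e₂ y₀ s y σ).IsInvertible := by
    refine (eventually_all_finite (S.finite_sing y₀)).2 fun s hs => ?_
    refine (isCompact_closedBall s ε).eventually_forall_of_forall_eventually fun σ hσ => ?_
    have hσ' := hεε₂ s hs (Metric.closedBall_subset_ball (by linarith) hσ)
    exact eventually_isInvertible_corner he₁ he₂ hy₁ hy₂ hσ'.1 hσ'.2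
  -- Local boundedness confines all singular points to one compact disc. Off the half-size discs
  -- this leaves a compact set without singular points at `y₀`, and closedness of `sing_e` keeps it
  -- free of them for nearby `y`.
  have hsing : ∀ᶠ y in 𝓝 y₀, ∀ σ ∈ Metric.closedBall 0 R \ ⋃ s ∈ S.singB y₀, Metric.ball s (ε / 2),
      (y, σ) ∉ S.singE := by
    have hK : IsCompact (Metric.closedBall (0 : ℂ) R \ ⋃ s ∈ S.singB y₀, Metric.ball s (ε / 2)) :=
      (isCompact_closedBall 0 R).diff (isOpen_biUnion fun _ _ => Metric.isOpen_ball)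
    refine hK.eventually_forall_of_forall_eventually fun σ hσ => ?_
    have : (y₀, σ) ∉ S.singE := fun h => hσ.2
      (mem_iUnion₂.2 ⟨σ, h, Metric.mem_ball_self (by positivity)⟩)
    exact isClosed_singE.isOpen_compl.mem_nhds this
  obtain ⟨U, hUN, hUo, hUc, hyU⟩ := exists_isConnected_open_subset n
    (inter_mem (inter_mem hN (inter_mem (e₁.isOpen_base.mem_nhds hy₁) (e₂.isOpen_base.mem_nhds hy₂)))
      (inter_mem hV (hcorner.and hsing)))
  refine ⟨U, fun y hy => (hUN hy).1.1, ?_⟩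
  exact
    { ε_pos := hε0
      isOpen := hUo
      isConnected := hUc
      mem := hyU
      subset₁ := fun y hy => (hUN hy).1.2.1
      subset₂ := fun y hy => (hUN hy).1.2.2
      disjoint := hdisj _ hεε₁
      ball_subset := fun s hs => (hεε₂ s hs).trans inter_subset_left
      corner_base := fun s hs σ hσ => (hεε₂ s hs hσ).2
      corner := fun s hs y hy σ hσ =>
        (hUN hy).2.2.1 s hs σ (Metric.ball_subset_closedBall hσ)
      sing_subset := fun y hy σ hσ => by
        by_contra hnot
        exact (hUN hy).2.2.2 σ ⟨hR (mem_iUnion₂.2 ⟨y, (hUN hy).2.1, hσ⟩), hnot⟩ hσ }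

end AdmissibleNeighborhoods

end FredholmFamily

theorem _root_.IsCompact.eventually_norm_sub_lt {X Z E F : Type*} [TopologicalSpace X]
    [TopologicalSpace Z] [NormedAddCommGroup E] [NormedSpace ℂ E] [NormedAddCommGroup F]
    [NormedSpace ℂ F] {A : X → Z → E →L[ℂ] F} {K : Set Z} (hK : IsCompact K) {x₀ : X}
    (hA : ∀ z ∈ K, ContinuousAt (fun p : X × Z => A p.1 p.2) (x₀, z)) {δ : ℝ} (hδ : 0 < δ) :
    ∀ᶠ x in 𝓝 x₀, ∀ z ∈ K, ‖A x z - A x₀ z‖ < δ := by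
  refine hK.eventually_forall_of_forall_eventually fun z hz => ?_
  have h2 : ContinuousAt (fun p : X × Z => A x₀ p.2) (x₀, z) :=
    ContinuousAt.comp (f := fun p : X × Z => (x₀, p.2)) (g := fun p : X × Z => A p.1 p.2)
      (hA z hz) (continuousAt_const.prodMk continuousAt_snd)
  exact ((hA z hz).sub h2).norm.eventually_lt continuousAt_const (by simpa using hδ)

namespace FredholmFamily

/-! ### The reduced family on the discs and its bases near `y₀`. -/

section ReducedFamily

variable {n : ℕ} {Y : Type*} [TopologicalSpace Y] [ChartedSpace (EuclideanSpace ℝ (Fin n)) Y]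
  {F₁ : Type*} [NormedAddCommGroup F₁] [InnerProductSpace ℂ F₁]
  {F₂ : Type*} [NormedAddCommGroup F₂] [InnerProductSpace ℂ F₂] [CompleteSpace F₂]
  {D₀ : Type*} [NormedAddCommGroup D₀] [InnerProductSpace ℂ D₀] [CompleteSpace D₀]
  {H₁ : Y → Type*} [∀ y, NormedAddCommGroup (H₁ y)] [∀ y, InnerProductSpace ℂ (H₁ y)]
  {H₂ : Y → Type*} [∀ y, NormedAddCommGroup (H₂ y)] [∀ y, InnerProductSpace ℂ (H₂ y)]
  {D : Y → Type*} [∀ y, NormedAddCommGroup (D y)] [∀ y, InnerProductSpace ℂ (D y)]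
  {S : FredholmFamily n Y F₁ F₂ D₀ H₁ H₂ D}
  {e₁ : PairTriv S.B₁.ι S.B₁.ι₀} {e₂ : UnitaryTriv F₂ H₂} {y₀ : Y} {ε : ℝ} {U : Set Y}

namespace Admissible

variable (h : S.Admissible e₁ e₂ y₀ ε U) {y : Y} {s σ : ℂ}
include h

omit [CompleteSpace D₀]

theorem ball_subset_Sig (hs : s ∈ S.singB y₀) : Metric.ball s ε ⊆ S.Sig :=
  (Metric.ball_subset_ball (by linarith [h.ε_pos])).trans (h.ball_subset s hs)

theorem eq_of_mem_ball {s' : ℂ} (hs : s ∈ S.singB y₀) (hs' : s' ∈ S.singB y₀)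
    (hσ : σ ∈ Metric.ball s ε) (hσ' : σ ∈ Metric.ball s' ε) : s = s' := by
  by_contra hne
  have hsub : ∀ t : ℂ, Metric.ball t ε ⊆ Metric.ball t (2 * ε) := fun t =>
    Metric.ball_subset_ball (by linarith [h.ε_pos])
  exact (Set.disjoint_left.1 (h.disjoint hs hs' hne)) (hsub s hσ) (hsub s' hσ')

theorem exists_mem_ball (hy : y ∈ U) (hσ : σ ∈ S.singB y) :
    ∃ s ∈ S.singB y₀, σ ∈ Metric.ball s (ε / 2) := by
  simpa using h.sing_subset y hy hσ

theorem mem_ball_half (hy : y ∈ U) (hs : s ∈ S.singB y₀) (hσ : σ ∈ S.singB y)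
    (hσs : σ ∈ Metric.ball s ε) : σ ∈ Metric.ball s (ε / 2) := by
  obtain ⟨s', hs', hσ'⟩ := h.exists_mem_ball hy hσ
  rwa [h.eq_of_mem_ball hs hs' hσs (Metric.ball_subset_ball (by linarith [h.ε_pos]) hσ')]

theorem ι₀_injective : Function.Injective S.B₁.ι₀ :=
  FredholmFamily.ι₀_injective (h.subset₁ h.mem)

theorem isInvertible_reduced (hy : y ∈ U) (hs : s ∈ S.singB y₀) (hσ : σ ∈ Metric.ball s ε)
    (hσ' : σ ∉ S.singB y) : (S.reduced e₁ e₂ y₀ s y σ).IsInvertible := by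
  have := finiteDimensional_Ks (e₁ := e₁) (e₂ := e₂) (y₀ := y₀) hs.1
  exact isInvertible_schurComplement h.ι₀_injective (h.corner s hs y hy σ hσ)
    (isInvertible_loc (h.ball_subset_Sig hs hσ) hσ')

variable [CompleteSpace D₀]

theorem analyticAt_reduced (hy : y ∈ U) (hs : s ∈ S.singB y₀) (hσ : σ ∈ Metric.ball s ε) :
    AnalyticAt ℂ (S.reduced e₁ e₂ y₀ s y) σ :=
  (ContDiffAt.comp σ (contDiffAt_schurComplement (n := ω) (h.corner s hs y hy σ hσ))
    (analyticAt_loc y (h.ball_subset_Sig hs hσ)).contDiffAt).analyticAt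

theorem continuousAt_reduced (he₁ : e₁ ∈ S.B₁.atlas) (he₂ : e₂ ∈ S.B₂.atlas) (hy : y ∈ U)
    (hs : s ∈ S.singB y₀) (hσ : σ ∈ Metric.ball s ε) :
    ContinuousAt (fun p : Y × ℂ => S.reduced e₁ e₂ y₀ s p.1 p.2) (y, σ) :=
  ContinuousAt.comp (f := fun p : Y × ℂ => S.loc e₁ e₂ p.1 p.2)
    (contDiffAt_schurComplement (n := 0) (h.corner s hs y hy σ hσ)).continuousAt
    (continuousAt_loc he₁ he₂ (h.subset₁ hy) (h.subset₂ hy) (h.ball_subset_Sig hs hσ))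

/-- Any radius strictly between `ε / 2`, which confines the singular points, and `ε` would serve; `3
/ 4 * ε` is one. -/
theorem discFamily (hy : y ∈ U) (hs : s ∈ S.singB y₀) :
    DiscFamily (S.reduced e₁ e₂ y₀ s y) s (3 / 4 * ε) ε (S.singB y ∩ Metric.ball s ε) where
  r_pos := by linarith [h.ε_pos]
  r_lt := by linarith [h.ε_pos]
  analytic := fun p hp => h.analyticAt_reduced hy hs hp
  finite := (S.finite_sing y).subset inter_subset_left
  subset := fun p hp => Metric.ball_subset_ball (by linarith [h.ε_pos])
    (h.mem_ball_half hy hs hp.1 hp.2)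
  invertible := fun p hp hpZ => h.isInvertible_reduced hy hs hp fun h' => hpZ ⟨h', hp⟩

/-- At `y₀` the disc about `s` contains no singular point other than `s`, and the reduced family
vanishes at `s`. -/
theorem nonempty_rootSystems : Nonempty (S.RootSystems e₁ e₂ y₀ ε) := by
  refine ⟨fun s => Classical.choice ?_⟩
  have := finiteDimensional_Ks (e₁ := e₁) (e₂ := e₂) (y₀ := y₀) s.2.1
  refine exists_canonicalSystem h.ε_pos (fun p hp => h.analyticAt_reduced h.mem s.2 hp)
    (fun p hp hps => h.isInvertible_reduced h.mem s.2 hp fun hp' => hps ?_) schurComplement_self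
  exact h.eq_of_mem_ball hp' s.2 (Metric.mem_ball_self h.ε_pos) hp

end Admissible

variable (C : S.RootSystems e₁ e₂ y₀ ε)

/-- The functions `(σ - s) ^ ℓ β_{s,j}(σ)`. -/
def rootSymbol (s : S.singB y₀) (i : LocalIndex C s) (σ : ℂ) : S.RsPerp e₁ e₂ y₀ s :=
  (σ - (s : ℂ)) ^ (i.2 : ℕ) • (C s).β i.1 σ

omit [CompleteSpace D₀] in
theorem analyticAt_rootSymbol (s : S.singB y₀) (i : LocalIndex C s) {σ : ℂ}
    (hσ : σ ∈ Metric.ball (s : ℂ) ε) : AnalyticAt ℂ (rootSymbol C s i) σ :=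
  ((analyticAt_id.sub analyticAt_const).pow _).smul ((C s).β_analytic i.1 σ hσ)

omit [CompleteSpace D₀] in
theorem reducedFrame_eq (s : S.singB y₀) (i : LocalIndex C s) (y : Y) :
    reducedFrame C s i y = singularPart (Metric.ball (s : ℂ) ε) fun σ =>
      (S.reduced e₁ e₂ y₀ s y σ).inverse (rootSymbol C s i σ) := by
  simp only [reducedFrame, rootSymbol, map_smul]

variable {C}

theorem Admissible.isSingularPart_reducedFrame (h : S.Admissible e₁ e₂ y₀ ε U) {y : Y} (hy : y ∈ U)
    (s : S.singB y₀) (i : LocalIndex C s) :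
    IsSingularPart (Metric.ball (s : ℂ) ε)
      (fun σ => (S.reduced e₁ e₂ y₀ s y σ).inverse (rootSymbol C s i σ))
      (reducedFrame C s i y) := by
  have := finiteDimensional_Ks (e₁ := e₁) (e₂ := e₂) (y₀ := y₀) s.2.1
  rw [reducedFrame_eq]
  exact singularPart_spec ((h.discFamily hy s.2).exists_isSingularPart Metric.isOpen_ball
    subset_rfl fun p hp => analyticAt_rootSymbol C s i hp)

/-- At `y₀` the inverse of the reduced family sends `β_j` back to `φ_{j,0}`, so these functions are
the basis built into the canonical system. -/
theorem Admissible.isBasisOf_reducedFrame_base (h : S.Admissible e₁ e₂ y₀ ε U) (s : S.singB y₀) :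
    IsBasisOf (reducedK e₁ e₂ y₀ ε (s : ℂ) y₀) fun i : LocalIndex C s => reducedFrame C s i y₀ := by
  have key : (fun i : LocalIndex C s => reducedFrame C s i y₀) = fun i =>
      singularPart (Metric.ball (s : ℂ) ε) fun σ => (σ - s) ^ (i.2 : ℕ) • (C s).φ i.1 σ := by
    funext i
    refine ((h.isSingularPart_reducedFrame h.mem s i).congr fun p hp => ?_).singularPart_eq.symm
    filter_upwards [(h.discFamily h.mem s.2).eventually_invertible hp] with σ ⟨hσ, hσZ, hinv⟩
    have hne : σ ≠ s := by
      rintro rfl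
      exact hσZ ⟨s.2, hσ⟩
    rw [rootSymbol, map_smul, (C s).β_eq i.1 σ hσ hne, hinv.inverse_apply_self]
  rw [key]
  exact (C s).basis

/-- Joint continuity and compactness make the reduced families uniformly close on the closed disc;
stability of bases then applies with the symbols `(σ - s) ^ ℓ β_j` kept fixed. -/
theorem Admissible.eventually_isBasisOf (h : S.Admissible e₁ e₂ y₀ ε U) (he₁ : e₁ ∈ S.B₁.atlas)
    (he₂ : e₂ ∈ S.B₂.atlas) (s : S.singB y₀) :
    ∀ᶠ y in 𝓝 y₀, IsBasisOf (reducedK e₁ e₂ y₀ ε (s : ℂ) y)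
      fun i : LocalIndex C s => reducedFrame C s i y := by
  have := finiteDimensional_Ks (e₁ := e₁) (e₂ := e₂) (y₀ := y₀) s.2.1
  have hbase := h.isBasisOf_reducedFrame_base (C := C) s
  simp only [reducedFrame_eq] at hbase ⊢
  obtain ⟨δ, hδ, hclose⟩ := (h.discFamily h.mem s.2).exists_isBasisOf_of_close
    (fun i p hp => analyticAt_rootSymbol C s i hp) hbase
  have hsub : Metric.closedBall (s : ℂ) (3 / 4 * ε) ⊆ Metric.ball (s : ℂ) ε :=
    (h.discFamily h.mem s.2).closedBall_subset
  have hev : ∀ᶠ y in 𝓝 y₀, ∀ z ∈ Metric.closedBall (s : ℂ) (3 / 4 * ε),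
      ‖S.reduced e₁ e₂ y₀ s y z - S.reduced e₁ e₂ y₀ s y₀ z‖ < δ := by
    exact (isCompact_closedBall _ _).eventually_norm_sub_lt
      (fun z hz => h.continuousAt_reduced he₁ he₂ h.mem s.2 (hsub hz)) hδ
  filter_upwards [hev, h.isOpen.mem_nhds h.mem] with y hy hyU
  exact hclose _ _ (h.discFamily hyU s.2) fun z hz => (hy z hz).le

theorem Admissible.exists_reducedBasisOn (h : S.Admissible e₁ e₂ y₀ ε U) (he₁ : e₁ ∈ S.B₁.atlas)
    (he₂ : e₂ ∈ S.B₂.atlas) (C : S.RootSystems e₁ e₂ y₀ ε) :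
    ∃ U' ⊆ U, S.Admissible e₁ e₂ y₀ ε U' ∧ ReducedBasisOn C U' := by
  have hev := eventually_all.2 fun s => h.eventually_isBasisOf (C := C) he₁ he₂ s
  obtain ⟨U', hU', ho, hc, hy⟩ := exists_isConnected_open_subset n
    (inter_mem (h.isOpen.mem_nhds h.mem) hev)
  exact ⟨U', fun y hy => (hU' hy).1, h.mono (fun y hy => (hU' hy).1) ho hc hy,
    fun y hy => (hU' hy).2⟩

end ReducedFamily

end FredholmFamily

/-! ### Singular parts under holomorphic operator families. -/

namespace IsSingularPart

variable {E F : Type*} [NormedAddCommGroup E] [NormedSpace ℂ E]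
  [NormedAddCommGroup F] [NormedSpace ℂ F] {V : Set ℂ}

theorem neg {f g : ℂ → E} (h : IsSingularPart V f g) : IsSingularPart V (-f) (-g) := by
  simpa using h.const_smul (-1)

theorem sub {f f' g g' : ℂ → E} (h : IsSingularPart V f g) (h' : IsSingularPart V f' g') :
    IsSingularPart V (f - f') (g - g') := by
  rw [sub_eq_add_neg, sub_eq_add_neg]
  exact h.add h'.neg

theorem extendsAt_of_notMem {f : ℂ → E} {c : ℂ →₀ ℕ →₀ E}
    (e : ExtendsHolomorphically V (f - KernelBundle.principalSum c)) {p : ℂ} (hp : p ∈ V)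
    (hpc : p ∉ c.support) : ExtendsAt f p := by
  have := ExtendsAt.add (e p hp) (analyticAt_principalSum hpc).extendsAt
  rwa [sub_add_cancel] at this

theorem exists_clm_apply {f g : ℂ → E} (h : IsSingularPart V f g) {A : ℂ → E →L[ℂ] F}
    (hA : ∀ p ∈ V, AnalyticAt ℂ A p) : ∃ k, IsSingularPart V (fun σ => A σ (f σ)) k := by
  have h' := h
  obtain ⟨c, hc, rfl, e⟩ := h'
  exact exists_isSingularPart c.support hc
    (fun p hp => meromorphicAt_operator_apply (hA p (hc hp)).meromorphicAt
      (h.meromorphicAt (hc hp)))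
    fun p hp hpc => ExtendsAt.clm_apply (hA p hp) (extendsAt_of_notMem e hp hpc)

theorem clm_apply_of_analytic {f g : ℂ → E} {k : ℂ → F} (h : IsSingularPart V f g)
    {A : ℂ → E →L[ℂ] F} (hA : ∀ p ∈ V, AnalyticAt ℂ A p)
    (h' : IsSingularPart V (fun σ => A σ (g σ)) k) : IsSingularPart V (fun σ => A σ (f σ)) k :=
  h'.congr_sub fun p hp => ExtendsAt.congr (ExtendsAt.clm_apply (hA p hp) (h.extends_sub p hp))
    (Eventually.of_forall fun σ => by simp)

/-- The singular part in `V` of a sum of principal parts consists of the terms with pole in `V`. -/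
theorem filter_principalSum (c : ℂ →₀ ℕ →₀ E) (V : Set ℂ) [DecidablePred (· ∈ V)] :
    IsSingularPart V (KernelBundle.principalSum c)
      (KernelBundle.principalSum (c.filter (· ∈ V))) := by
  refine ⟨_, fun p hp => ?_, rfl, fun p hp => ?_⟩
  · rw [Finset.mem_coe, Finsupp.support_filter, Finset.mem_filter] at hp
    exact hp.2
  · have h1 : KernelBundle.principalSum c - KernelBundle.principalSum (c.filter (· ∈ V)) =
        KernelBundle.principalSum (c.filter fun q => ¬ q ∈ V) := by
      rw [sub_eq_iff_eq_add', ← principalSum_add, Finsupp.filter_add_filter_not]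
    rw [h1]
    exact (analyticAt_principalSum (by simp [hp])).extendsAt

end IsSingularPart

/-- Serves to move kernel spaces between a fiber and the model along the trivializations. -/
theorem kernelSpace_map {E F E' F' : Type*} [NormedAddCommGroup E] [NormedSpace ℂ E]
    [NormedAddCommGroup F] [NormedSpace ℂ F] [NormedAddCommGroup E'] [NormedSpace ℂ E']
    [NormedAddCommGroup F'] [NormedSpace ℂ F'] {V : Set ℂ} {Q : ℂ → E →L[ℂ] F}
    {Q' : ℂ → E' →L[ℂ] F'} (L : E →L[ℂ] E') (M : F →L[ℂ] F')
    (hQ : ∀ σ x, Q' σ (L x) = M (Q σ x)) {g : ℂ → E} (hg : g ∈ kernelSpace V Q) :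
    (fun σ => L (g σ)) ∈ kernelSpace V Q' := by
  obtain ⟨φ, hφ, hQφ, hs⟩ := hg
  refine ⟨fun σ => L (φ σ), fun p hp =>
    meromorphicAt_operator_apply (A := fun _ => L) analyticAt_const.meromorphicAt (hφ p hp),
    fun p hp => ?_, hs.clm L⟩
  simp only [hQ]
  exact ExtendsAt.clm M (hQφ p hp)

/-! ### The lift from the kernel of the reference operator. -/

section BlockAlgebra

variable {F₁ F₂ D₀ : Type*}
  [NormedAddCommGroup F₁] [InnerProductSpace ℂ F₁]
  [NormedAddCommGroup F₂] [InnerProductSpace ℂ F₂] [CompleteSpace F₂]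
  [NormedAddCommGroup D₀] [InnerProductSpace ℂ D₀]
  {ι₀ : D₀ →L[ℂ] F₁} (hι : Function.Injective ι₀) {A₀ : D₀ →L[ℂ] F₂}
  [FiniteDimensional ℂ A₀.ker] {A : D₀ →L[ℂ] F₂}

/-- The map `k ↦ k - a₂₂⁻¹ a₂₁ k`, which inverts the reduction to the Schur complement. -/
def schurLift (ι₀ : D₀ →L[ℂ] F₁) (A₀ A : D₀ →L[ℂ] F₂) : A₀.ker →L[ℂ] D₀ :=
  A₀.ker.subtypeL - (kerPerp ι₀ A₀).subtypeL ∘L (block₂₂ ι₀ A₀ A).inverse ∘L block₂₁ A₀ A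

omit [FiniteDimensional ℂ A₀.ker] in
theorem schurLift_apply (k : A₀.ker) : schurLift ι₀ A₀ A k =
    (k : D₀) - ((block₂₂ ι₀ A₀ A).inverse (block₂₁ A₀ A k) : kerPerp ι₀ A₀) := rfl

omit [FiniteDimensional ℂ A₀.ker] in
theorem apply_schurLift (h22 : (block₂₂ ι₀ A₀ A).IsInvertible) (k : A₀.ker) :
    A (schurLift ι₀ A₀ A k) = schurComplement ι₀ A₀ A k := apply_sub_inverse h22 k

theorem kerProj_schurLift (k : A₀.ker) : kerProj hι A₀ (schurLift ι₀ A₀ A k) = k := by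
  rw [schurLift_apply, map_sub, kerProj_apply_ker, kerProj_apply_kerPerp, sub_zero]

/-- The error made by projecting and lifting depends only on `A d`. Hence for a function `g` with `A
g` holomorphic this error is holomorphic. -/
theorem sub_schurLift_kerProj (h22 : (block₂₂ ι₀ A₀ A).IsInvertible) (d : D₀) :
    d - schurLift ι₀ A₀ A (kerProj hι A₀ d) =
      ((block₂₂ ι₀ A₀ A).inverse (A₀.rangeᗮᗮ.orthogonalProjectionOnto (A d)) : kerPerp ι₀ A₀) := by
  have h2 := proj₂_apply_add A (kerProj hι A₀ d) (perpProj hι A₀ d)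
  rw [kerProj_add_perpProj] at h2
  rw [h2, map_add, h22.inverse_apply_self, schurLift_apply, Submodule.coe_add, coe_perpProj]
  abel

/-- The right side is built from `A d` alone, so the projection of a function made holomorphic by
`A` is made holomorphic by the Schur complement. -/
theorem schurComplement_kerProj (h22 : (block₂₂ ι₀ A₀ A).IsInvertible) (d : D₀) :
    (schurComplement ι₀ A₀ A (kerProj hι A₀ d) : F₂) =
      A d - A ((block₂₂ ι₀ A₀ A).inverse (A₀.rangeᗮᗮ.orthogonalProjectionOnto (A d)) :
        kerPerp ι₀ A₀) := by
  rw [← sub_schurLift_kerProj hι h22, map_sub, apply_schurLift h22, sub_sub_cancel]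

omit [FiniteDimensional ℂ A₀.ker] in
theorem contDiffAt_inverse_block₂₂ [CompleteSpace D₀] {n : WithTop ℕ∞}
    (h22 : (block₂₂ ι₀ A₀ A).IsInvertible) :
    ContDiffAt ℂ n (fun B => (block₂₂ ι₀ A₀ B).inverse) A :=
  h22.contDiffAt_map_inverse.comp A contDiff_block₂₂.contDiffAt

omit [FiniteDimensional ℂ A₀.ker] in
theorem contDiffAt_schurLift [CompleteSpace D₀] {n : WithTop ℕ∞}
    (h22 : (block₂₂ ι₀ A₀ A).IsInvertible) : ContDiffAt ℂ n (schurLift ι₀ A₀) A := by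
  have h₂₁ : ContDiff ℂ n (block₂₁ A₀) :=
    contDiff_const.clm_comp (contDiff_id.clm_comp contDiff_const)
  exact contDiffAt_const.sub (contDiffAt_const.clm_comp
    ((contDiffAt_inverse_block₂₂ h22).clm_comp h₂₁.contDiffAt))

end BlockAlgebra

namespace FredholmFamily

/-! ### The local frame in the trivialization. -/

section LocalFrame

variable {n : ℕ} {Y : Type*} [TopologicalSpace Y] [ChartedSpace (EuclideanSpace ℝ (Fin n)) Y]
  {F₁ : Type*} [NormedAddCommGroup F₁] [InnerProductSpace ℂ F₁]
  {F₂ : Type*} [NormedAddCommGroup F₂] [InnerProductSpace ℂ F₂] [CompleteSpace F₂]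
  {D₀ : Type*} [NormedAddCommGroup D₀] [InnerProductSpace ℂ D₀] [CompleteSpace D₀]
  {H₁ : Y → Type*} [∀ y, NormedAddCommGroup (H₁ y)] [∀ y, InnerProductSpace ℂ (H₁ y)]
  {H₂ : Y → Type*} [∀ y, NormedAddCommGroup (H₂ y)] [∀ y, InnerProductSpace ℂ (H₂ y)]
  {D : Y → Type*} [∀ y, NormedAddCommGroup (D y)] [∀ y, InnerProductSpace ℂ (D y)]
  {S : FredholmFamily n Y F₁ F₂ D₀ H₁ H₂ D}
  {e₁ : PairTriv S.B₁.ι S.B₁.ι₀} {e₂ : UnitaryTriv F₂ H₂} {y₀ : Y} {ε : ℝ} {U : Set Y}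

omit [CompleteSpace F₂] [CompleteSpace D₀] in
theorem mem_K_iff {y : Y} {g : ℂ → D y} :
    g ∈ S.K y ↔ (fun σ => e₁.mapD y (g σ)) ∈ kernelSpace S.Sig (S.loc e₁ e₂ y) := by
  constructor
  · exact kernelSpace_map (e₁.mapD y : D y →L[ℂ] D₀)
      ((e₂.map y).toContinuousLinearEquiv : H₂ y →L[ℂ] F₂) fun σ x => by simp [loc]
  · intro hg
    have := kernelSpace_map (Q' := S.P y) ((e₁.mapD y).symm : D₀ →L[ℂ] D y)
      ((e₂.map y).symm.toContinuousLinearEquiv : F₂ →L[ℂ] H₂ y) (fun σ x => by simp [loc]) hg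
    simp only [ContinuousLinearEquiv.coe_coe, ContinuousLinearEquiv.symm_apply_apply] at this
    exact this

variable (C : S.RootSystems e₁ e₂ y₀ ε)

/-- The frame, in the trivialization. -/
def locFrame (i : FrameIndex C) (y : Y) (σ : ℂ) : D₀ := e₁.mapD y (frame C i y σ)

variable {C}

namespace Admissible

variable (h : S.Admissible e₁ e₂ y₀ ε U) {y : Y} {s σ : ℂ}
include h

theorem analyticAt_schurLift (hy : y ∈ U) (hs : s ∈ S.singB y₀) (hσ : σ ∈ Metric.ball s ε) :
    AnalyticAt ℂ (fun σ => schurLift S.B₁.ι₀ (S.loc e₁ e₂ y₀ s) (S.loc e₁ e₂ y σ)) σ :=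
  (ContDiffAt.comp σ (contDiffAt_schurLift (n := ω) (h.corner s hs y hy σ hσ))
    (analyticAt_loc y (h.ball_subset_Sig hs hσ)).contDiffAt).analyticAt

theorem analyticAt_inverse_corner (hy : y ∈ U) (hs : s ∈ S.singB y₀) (hσ : σ ∈ Metric.ball s ε) :
    AnalyticAt ℂ (fun σ => (S.corner e₁ e₂ y₀ s y σ).inverse) σ :=
  (ContDiffAt.comp σ (contDiffAt_inverse_block₂₂ (n := ω) (h.corner s hs y hy σ hσ))
    (analyticAt_loc y (h.ball_subset_Sig hs hσ)).contDiffAt).analyticAt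

/-- The `K_s`-component is its own singular part, so the truncation of the second term alone amounts
to truncating the whole lift. -/
theorem isSingularPart_locFrame (hy : y ∈ U) (i : FrameIndex C) :
    IsSingularPart (Metric.ball (i.1 : ℂ) ε)
      (fun σ => schurLift S.B₁.ι₀ (S.loc e₁ e₂ y₀ i.1) (S.loc e₁ e₂ y σ)
        (reducedFrame C i.1 i.2 y σ)) (locFrame C i y) := by
  have hk := (h.isSingularPart_reducedFrame hy i.1 i.2).self
  have hk' := hk.clm (S.Ks e₁ e₂ y₀ i.1).subtypeL
  obtain ⟨g, hg⟩ := hk.exists_clm_apply fun p hp => h.analyticAt_schurLift hy i.1.2 hp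
  have hw := singularPart_spec ⟨_, hk'.sub hg⟩
  have hres := hk'.sub hw
  convert hres using 1
  · funext σ
    simp
  · funext σ
    rw [locFrame, frame, ContinuousLinearEquiv.apply_symm_apply, Pi.sub_apply]
    congr 3
    funext ζ
    rw [Pi.sub_apply, schurLift_apply, Submodule.subtypeL_apply, sub_sub_cancel]
    rfl

/-- The lift of the inverse of the reduced family is the inverse of the full family on `R_s^⊥`. This
formula gives membership in the kernel space, the location of the poles, and smoothness. -/
theorem isSingularPart_inverse_locFrame (hy : y ∈ U) (i : FrameIndex C) :
    IsSingularPart (Metric.ball (i.1 : ℂ) ε)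
      (fun σ => (S.loc e₁ e₂ y σ).inverse (rootSymbol C i.1 i.2 σ : F₂)) (locFrame C i y) := by
  have := finiteDimensional_Ks (e₁ := e₁) (e₂ := e₂) (y₀ := y₀) i.1.2.1
  refine ((h.isSingularPart_reducedFrame hy i.1 i.2).clm_apply_of_analytic
    (fun p hp => h.analyticAt_schurLift hy i.1.2 hp)
    (h.isSingularPart_locFrame hy i)).congr fun p hp => ?_
  filter_upwards [(h.discFamily hy i.1.2).eventually_invertible hp] with σ ⟨hσ, hσZ, _⟩
  exact inverse_apply_eq_of_mem h.ι₀_injective (h.corner i.1 i.1.2 y hy σ hσ)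
    (isInvertible_loc (h.ball_subset_Sig i.1.2 hσ) fun h' => hσZ ⟨h', hσ⟩) _

theorem isSingularPart_locFrame_self (hy : y ∈ U) (i : FrameIndex C) :
    IsSingularPart (Metric.ball (i.1 : ℂ) ε) (locFrame C i y) (locFrame C i y) :=
  (h.isSingularPart_locFrame hy i).self

theorem analyticAt_locFrame_of_notMem_ball (hy : y ∈ U) (i : FrameIndex C)
    (hσ : σ ∉ Metric.ball (i.1 : ℂ) ε) : AnalyticAt ℂ (locFrame C i y) σ :=
  (h.isSingularPart_locFrame_self hy i).analyticAt fun h' => absurd h' hσ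

theorem analyticAt_inverse_rootSymbol (i : FrameIndex C)
    (hσ : σ ∈ Metric.ball (i.1 : ℂ) ε) (hσ' : σ ∉ S.singB y) :
    AnalyticAt ℂ (fun σ => (S.loc e₁ e₂ y σ).inverse (rootSymbol C i.1 i.2 σ : F₂)) σ := by
  have hSig := h.ball_subset_Sig i.1.2 hσ
  exact (analyticAt_inverse (analyticAt_loc y hSig) (isInvertible_loc hSig hσ')).operator_apply
    (((S.RsPerp e₁ e₂ y₀ i.1).subtypeL.analyticAt _).comp (analyticAt_rootSymbol C i.1 i.2 hσ))

theorem analyticAt_locFrame (hy : y ∈ U) (i : FrameIndex C) (hσ : σ ∉ S.singB y) :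
    AnalyticAt ℂ (locFrame C i y) σ :=
  (h.isSingularPart_inverse_locFrame hy i).analyticAt fun h' =>
    (h.analyticAt_inverse_rootSymbol i h' hσ).extendsAt

/-- Projection undoes the lift and commutes with taking singular parts; independence of the frame
will be read off after projecting. -/
theorem kerProj_locFrame [∀ s : S.singB y₀, FiniteDimensional ℂ (S.Ks e₁ e₂ y₀ s)] (hy : y ∈ U)
    (i : FrameIndex C) (σ : ℂ) :
    kerProj h.ι₀_injective (S.loc e₁ e₂ y₀ i.1) (locFrame C i y σ) =
      reducedFrame C i.1 i.2 y σ := by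
  have h1 := (h.isSingularPart_locFrame hy i).clm
    (kerProj h.ι₀_injective (S.loc e₁ e₂ y₀ i.1))
  simp only [kerProj_schurLift] at h1
  exact congrFun (h1.unique (h.isSingularPart_reducedFrame hy i.1 i.2).self) σ

theorem extendsHolomorphically_loc_locFrame (hy : y ∈ U) (i : FrameIndex C) :
    ExtendsHolomorphically (Metric.ball (i.1 : ℂ) ε)
      (fun σ => S.loc e₁ e₂ y σ (locFrame C i y σ)) := by
  have hP : ∀ p ∈ Metric.ball (i.1 : ℂ) ε, AnalyticAt ℂ (S.loc e₁ e₂ y) p := fun p hp =>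
    analyticAt_loc y (h.ball_subset_Sig i.1.2 hp)
  refine ((mem_kernelSpace_iff hP).1 (singularPart_mem_kernelSpace
    (h.isSingularPart_inverse_locFrame hy i) fun p hp => ?_)).2
  refine ExtendsAt.congr (((S.RsPerp e₁ e₂ y₀ i.1).subtypeL.analyticAt _).comp
    (analyticAt_rootSymbol C i.1 i.2 hp)).extendsAt ?_
  filter_upwards [(h.discFamily hy i.1.2).eventually_invertible hp] with σ ⟨hσ, hσZ, _⟩
  exact (isInvertible_loc (h.ball_subset_Sig i.1.2 hσ) fun h' => hσZ ⟨h', hσ⟩).self_apply_inverse _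

theorem locFrame_mem (hy : y ∈ U) (i : FrameIndex C) :
    locFrame C i y ∈ kernelSpace S.Sig (S.loc e₁ e₂ y) := by
  rw [mem_kernelSpace_iff fun p hp => analyticAt_loc y hp]
  refine ⟨(h.isSingularPart_locFrame_self hy i).mono (h.ball_subset_Sig i.1.2) fun p hp =>
    (h.analyticAt_locFrame_of_notMem_ball hy i hp.2).extendsAt, fun p hp => ?_⟩
  by_cases hpb : p ∈ Metric.ball (i.1 : ℂ) ε
  · exact h.extendsHolomorphically_loc_locFrame hy i p hpb
  · exact (AnalyticAt.operator_apply (analyticAt_loc y hp)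
      (h.analyticAt_locFrame_of_notMem_ball hy i hpb)).extendsAt

end Admissible

end LocalFrame

end FredholmFamily

namespace FredholmFamily

/-! ### The frame is a basis of each fiber. -/

section FrameBasis

variable {n : ℕ} {Y : Type*} [TopologicalSpace Y] [ChartedSpace (EuclideanSpace ℝ (Fin n)) Y]
  {F₁ : Type*} [NormedAddCommGroup F₁] [InnerProductSpace ℂ F₁]
  {F₂ : Type*} [NormedAddCommGroup F₂] [InnerProductSpace ℂ F₂] [CompleteSpace F₂]
  {D₀ : Type*} [NormedAddCommGroup D₀] [InnerProductSpace ℂ D₀] [CompleteSpace D₀]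
  {H₁ : Y → Type*} [∀ y, NormedAddCommGroup (H₁ y)] [∀ y, InnerProductSpace ℂ (H₁ y)]
  {H₂ : Y → Type*} [∀ y, NormedAddCommGroup (H₂ y)] [∀ y, InnerProductSpace ℂ (H₂ y)]
  {D : Y → Type*} [∀ y, NormedAddCommGroup (D y)] [∀ y, InnerProductSpace ℂ (D y)]
  {S : FredholmFamily n Y F₁ F₂ D₀ H₁ H₂ D}
  {e₁ : PairTriv S.B₁.ι S.B₁.ι₀} {e₂ : UnitaryTriv F₂ H₂} {y₀ : Y} {ε : ℝ} {U : Set Y}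
  {C : S.RootSystems e₁ e₂ y₀ ε}

namespace Admissible

variable (h : S.Admissible e₁ e₂ y₀ ε U) {y : Y} {s : ℂ}
include h

/-- By `sub_schurLift_kerProj` the difference is a holomorphic operator applied to `P g`. Thus `g`
is determined by its projection to `K_s`. -/
theorem isSingularPart_schurLift_kerProj (hy : y ∈ U) (hs : s ∈ S.singB y₀)
    [FiniteDimensional ℂ (S.Ks e₁ e₂ y₀ s)] {g : ℂ → D₀}
    (hg : g ∈ kernelSpace (Metric.ball s ε) (S.loc e₁ e₂ y)) :
    IsSingularPart (Metric.ball s ε) (fun σ => schurLift S.B₁.ι₀ (S.loc e₁ e₂ y₀ s)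
      (S.loc e₁ e₂ y σ) (kerProj h.ι₀_injective (S.loc e₁ e₂ y₀ s) (g σ))) g := by
  obtain ⟨hg1, hg2⟩ := (mem_kernelSpace_iff fun p hp =>
    analyticAt_loc y (h.ball_subset_Sig hs hp)).1 hg
  refine hg1.congr_sub fun p hp => ?_
  have h1 := ExtendsAt.clm (kerPerp S.B₁.ι₀ (S.loc e₁ e₂ y₀ s)).subtypeL
    (ExtendsAt.clm_apply (h.analyticAt_inverse_corner hy hs hp)
      (ExtendsAt.clm (S.RsPerp e₁ e₂ y₀ s)ᗮ.orthogonalProjectionOnto (hg2 p hp)))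
  refine h1.neg.congr ?_
  filter_upwards [nhdsWithin_le_nhds (Metric.isOpen_ball.mem_nhds hp)] with σ hσ
  rw [Pi.sub_apply, ← neg_sub, sub_schurLift_kerProj h.ι₀_injective (h.corner s hs y hy σ hσ)]
  rfl

theorem kerProj_mem_reducedK (hy : y ∈ U) (hs : s ∈ S.singB y₀)
    [FiniteDimensional ℂ (S.Ks e₁ e₂ y₀ s)] {g : ℂ → D₀}
    (hg : g ∈ kernelSpace (Metric.ball s ε) (S.loc e₁ e₂ y)) :
    (fun σ => kerProj h.ι₀_injective (S.loc e₁ e₂ y₀ s) (g σ)) ∈ reducedK e₁ e₂ y₀ ε s y := by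
  obtain ⟨hg1, hg2⟩ := (mem_kernelSpace_iff fun p hp =>
    analyticAt_loc y (h.ball_subset_Sig hs hp)).1 hg
  refine (mem_kernelSpace_iff fun p hp => h.analyticAt_reduced hy hs hp).2
    ⟨hg1.clm _, fun p hp => ?_⟩
  have h1 := ExtendsAt.clm_apply (analyticAt_loc (e₁ := e₁) (e₂ := e₂) y (h.ball_subset_Sig hs hp))
    (ExtendsAt.clm (kerPerp S.B₁.ι₀ (S.loc e₁ e₂ y₀ s)).subtypeL
      (ExtendsAt.clm_apply (h.analyticAt_inverse_corner hy hs hp)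
        (ExtendsAt.clm (S.RsPerp e₁ e₂ y₀ s)ᗮ.orthogonalProjectionOnto (hg2 p hp))))
  refine (ExtendsAt.clm (S.RsPerp e₁ e₂ y₀ s).orthogonalProjectionOnto
    (ExtendsAt.sub (hg2 p hp) h1)).congr ?_
  filter_upwards [nhdsWithin_le_nhds (Metric.isOpen_ball.mem_nhds hp)] with σ hσ
  have h2 := schurComplement_kerProj h.ι₀_injective (h.corner s hs y hy σ hσ) (g σ)
  exact (Submodule.orthogonalProjectionOnto_mem_subspace_eq_self _).symm.trans
    (congrArg (S.RsPerp e₁ e₂ y₀ s).orthogonalProjectionOnto h2)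

/-- The projection of `g` expands in the reduced basis; lifting this expansion and truncating
recovers `g`. -/
theorem exists_eq_sum_locFrame_of_mem_ball (hB : ReducedBasisOn C U) (hy : y ∈ U)
    (s : S.singB y₀) {g : ℂ → D₀}
    (hg : g ∈ kernelSpace (Metric.ball (s : ℂ) ε) (S.loc e₁ e₂ y)) :
    ∃ c : LocalIndex C s → ℂ, g = ∑ i, c i • locFrame C ⟨s, i⟩ y := by
  have := finiteDimensional_Ks (e₁ := e₁) (e₂ := e₂) (y₀ := y₀) s.2.1
  have hk := h.kerProj_mem_reducedK hy s.2 hg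
  rw [← (hB y hy s).2, Submodule.mem_span_range_iff_exists_fun] at hk
  obtain ⟨c, hc⟩ := hk
  refine ⟨c, (h.isSingularPart_schurLift_kerProj hy s.2 hg).unique ?_⟩
  have h1 : IsSingularPart (Metric.ball (s : ℂ) ε)
      (∑ i, c i • fun σ => schurLift S.B₁.ι₀ (S.loc e₁ e₂ y₀ s) (S.loc e₁ e₂ y σ)
        (reducedFrame C s i y σ)) (∑ i, c i • locFrame C ⟨s, i⟩ y) :=
    IsSingularPart.sum _ fun i _ => (h.isSingularPart_locFrame (C := C) hy ⟨s, i⟩).const_smul (c i)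
  convert h1 using 1
  funext σ
  rw [← congrFun hc σ]
  simp

/-- The poles of `g` are singular points, so each lies in exactly one of the discs. Grouping the
principal parts by disc reduces to the local expansions. -/
theorem exists_eq_sum_locFrame (hB : ReducedBasisOn C U) (hy : y ∈ U) {g : ℂ → D₀}
    (hg : g ∈ kernelSpace S.Sig (S.loc e₁ e₂ y)) :
    ∃ c : FrameIndex C → ℂ, g = ∑ i, c i • locFrame C i y := by
  classical
  obtain ⟨hg1, hg2⟩ := (mem_kernelSpace_iff fun p hp => analyticAt_loc y hp).1 hg
  obtain ⟨a, ha, rfl, -⟩ := hg1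
  have hsupp : ∀ p ∈ a.support, p ∈ S.singB y := fun p hp => by
    by_contra hps
    exact Finsupp.mem_support_iff.1 hp (eq_zero_of_extendsAt_principalSum
      (extendsAt_of_apply (analyticAt_loc y (ha hp)) (isInvertible_loc (ha hp) hps) (hg2 p (ha hp))))
  have hsplit : a = ∑ s : S.singB y₀, a.filter (· ∈ Metric.ball (s : ℂ) ε) := by
    ext1 p
    rw [Finsupp.finsetSum_apply]
    by_cases hp : p ∈ a.support
    · obtain ⟨s, hs, hps⟩ := h.exists_mem_ball hy (hsupp p hp)
      have hps' : p ∈ Metric.ball s ε := Metric.ball_subset_ball (by linarith [h.ε_pos]) hps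
      rw [Finset.sum_eq_single ⟨s, hs⟩, Finsupp.filter_apply_pos _ _ hps']
      · intro t _ hts
        refine Finsupp.filter_apply_neg _ _ fun hpt => hts (Subtype.ext ?_)
        exact h.eq_of_mem_ball t.2 hs hpt hps'
      · simp
    · rw [Finsupp.notMem_support_iff.1 hp, eq_comm]
      refine Finset.sum_eq_zero fun s _ => Finsupp.notMem_support_iff.1 fun h' => hp ?_
      rw [Finsupp.support_filter, Finset.mem_filter] at h'
      exact h'.1
  have hloc : ∀ s : S.singB y₀, ∃ c : LocalIndex C s → ℂ,
      principalSum (a.filter (· ∈ Metric.ball (s : ℂ) ε)) = ∑ i, c i • locFrame C ⟨s, i⟩ y := by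
    intro s
    refine h.exists_eq_sum_locFrame_of_mem_ball hB hy s ?_
    exact singularPart_mem_kernelSpace (IsSingularPart.filter_principalSum a _)
      (hg2.mono (h.ball_subset_Sig s.2))
  choose c hc using hloc
  refine ⟨fun i => c i.1 i.2, ?_⟩
  conv_lhs => rw [hsplit]
  rw [principalSum_sum, Fintype.sum_sigma]
  exact Finset.sum_congr rfl fun s _ => hc s

theorem linearIndependent_locFrame (hB : ReducedBasisOn C U) (hy : y ∈ U) :
    LinearIndependent ℂ fun i => locFrame C i y := by
  classical
  have hfd : ∀ s : S.singB y₀, FiniteDimensional ℂ (S.Ks e₁ e₂ y₀ s) := fun s =>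
    finiteDimensional_Ks s.2.1
  rw [Fintype.linearIndependent_iff]
  rintro c hc ⟨s, i⟩
  set G : S.singB y₀ → ℂ → D₀ := fun s => ∑ i, c ⟨s, i⟩ • locFrame C ⟨s, i⟩ y with hG
  have hsum : ∑ s, G s = 0 := by rw [← hc, Fintype.sum_sigma]
  have hGs : ∀ s : S.singB y₀, IsSingularPart (Metric.ball (s : ℂ) ε) (G s) (G s) := fun s =>
    IsSingularPart.sum _ fun i _ => (h.isSingularPart_locFrame_self hy ⟨s, i⟩).const_smul _
  -- By the relation, the part belonging to `s` is minus the sum of the others, which have no poles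
  -- in the disc about `s`.
  have hext : ExtendsHolomorphically (Metric.ball (s : ℂ) ε) (G s) := by
    intro p hp
    have h1 : G s = -∑ t ∈ Finset.univ.erase s, G t := by
      rw [eq_neg_iff_add_eq_zero, Finset.add_sum_erase _ _ (Finset.mem_univ s), hsum]
    have h2 : AnalyticAt ℂ (∑ t ∈ Finset.univ.erase s, G t) p := by
      refine Finset.analyticAt_sum _ fun t ht => (hGs t).analyticAt fun hpt => ?_
      exact absurd (Subtype.ext (h.eq_of_mem_ball t.2 s.2 hpt hp)) (Finset.ne_of_mem_erase ht)
    rw [h1]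
    exact h2.neg.extendsAt
  have hG0 : G s = 0 := (hGs s).unique (IsSingularPart.of_extends hext)
  refine Fintype.linearIndependent_iff.1 (hB y hy s).1 (fun i => c ⟨s, i⟩) ?_ i
  funext σ
  have := congrArg (kerProj h.ι₀_injective (S.loc e₁ e₂ y₀ s)) (congrFun hG0 σ)
  simp only [hG, Finset.sum_apply, Pi.smul_apply, map_sum, map_smul, Pi.zero_apply, map_zero] at this
  rw [Finset.sum_apply, Pi.zero_apply, ← this]
  exact Finset.sum_congr rfl fun i _ => congrArg (c ⟨s, i⟩ • ·)
    (h.kerProj_locFrame hy ⟨s, i⟩ σ).symm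

theorem frame_mem_K (hy : y ∈ U) (i : FrameIndex C) : frame C i y ∈ S.K y :=
  (mem_K_iff (e₁ := e₁) (e₂ := e₂)).2 (h.locFrame_mem hy i)

theorem exists_eq_sum_frame (hB : ReducedBasisOn C U) (hy : y ∈ U) {g : ℂ → D y}
    (hg : g ∈ S.K y) : ∃ c : FrameIndex C → ℂ, g = ∑ i, c i • frame C i y := by
  obtain ⟨c, hc⟩ := h.exists_eq_sum_locFrame hB hy ((mem_K_iff (e₁ := e₁) (e₂ := e₂)).1 hg)
  refine ⟨c, funext fun σ => (e₁.mapD y).injective ?_⟩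
  rw [congrFun hc σ]
  simp [locFrame]

theorem isBasisOf_frame (hB : ReducedBasisOn C U) (hy : y ∈ U) :
    IsBasisOf (S.K y) fun i => frame C i y := by
  refine ⟨?_, le_antisymm ?_ fun g hg => ?_⟩
  · rw [Fintype.linearIndependent_iff]
    intro c hc
    refine Fintype.linearIndependent_iff.1 (h.linearIndependent_locFrame hB hy) c (funext fun σ => ?_)
    have := congrArg (e₁.mapD y) (congrFun hc σ)
    simpa [locFrame] using this
  · rw [Submodule.span_le]
    rintro _ ⟨i, rfl⟩
    exact h.frame_mem_K hy i
  · obtain ⟨c, rfl⟩ := h.exists_eq_sum_frame hB hy hg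
    exact Submodule.sum_mem _ fun i _ => Submodule.smul_mem _ _ (Submodule.subset_span ⟨i, rfl⟩)

end Admissible

end FrameBasis

end FredholmFamily

/-! ### Real smoothness of complex linear operations, and dual systems of evaluations. -/

section SmoothMaps

variable {EM HM M : Type*} [NormedAddCommGroup EM] [NormedSpace ℝ EM] [TopologicalSpace HM]
  {I : ModelWithCorners ℝ EM HM} [TopologicalSpace M] [ChartedSpace HM M]
  {E F : Type*} [NormedAddCommGroup E] [NormedSpace ℂ E] [NormedAddCommGroup F] [NormedSpace ℂ F]

theorem _root_.ContMDiffAt.complex_clm_apply {A : M → E →L[ℂ] F} {g : M → E} {x : M}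
    (hA : ContMDiffAt I 𝓘(ℝ, E →L[ℂ] F) ∞ A x) (hg : ContMDiffAt I 𝓘(ℝ, E) ∞ g x) :
    ContMDiffAt I 𝓘(ℝ, F) ∞ (fun p => A p (g p)) x := by
  have h1 : ContDiff ℂ ∞ fun q : (E →L[ℂ] F) × E => q.1 q.2 := isBoundedBilinearMap_apply.contDiff
  exact (h1.restrict_scalars ℝ).contMDiff.contMDiffAt.comp x (hA.prodMk_space hg)

theorem _root_.ContMDiffAt.complex_inverse [CompleteSpace E] {A : M → E →L[ℂ] F} {x : M}
    (hA : ContMDiffAt I 𝓘(ℝ, E →L[ℂ] F) ∞ A x) (h : (A x).IsInvertible) :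
    ContMDiffAt I 𝓘(ℝ, F →L[ℂ] E) ∞ (fun p => (A p).inverse) x := by
  have h1 : ContDiffAt ℂ ∞ (ContinuousLinearMap.inverse : (E →L[ℂ] F) → F →L[ℂ] E) (A x) :=
    h.contDiffAt_map_inverse
  exact (h1.restrict_scalars ℝ).contMDiffAt.comp x hA

theorem _root_.ContMDiffAt.complex_clm (L : E →L[ℂ] F) {g : M → E} {x : M}
    (hg : ContMDiffAt I 𝓘(ℝ, E) ∞ g x) : ContMDiffAt I 𝓘(ℝ, F) ∞ (fun p => L (g p)) x :=
  ((L.contDiff (n := ∞)).restrict_scalars ℝ).contMDiff.contMDiffAt.comp x hg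

end SmoothMaps

/-- Finitely many functions, linearly independent on a set `P`, admit a dual system of finite
linear combinations of evaluations of functionals at points of `P`. -/
theorem exists_dual_evaluations {ι X E : Type*} [Fintype ι] [DecidableEq ι]
    [NormedAddCommGroup E] [NormedSpace ℂ E] {v : ι → X → E} {P : Set X}
    (hv : ∀ c : ι → ℂ, (∀ σ ∈ P, ∑ i, c i • v i σ = 0) → c = 0) (j : ι) :
    ∃ a : (E →L[ℂ] ℂ) × P →₀ ℂ, ∀ i, (a.sum fun q z => z * q.1 (v i q.2)) = if i = j then 1 else 0 := by
  -- A functional on `ι → ℂ` killing all these vectors has coordinates forming a linear relation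
  -- among the `v i` on `P`, since continuous functionals separate points of `E`.
  have hspan : Submodule.span ℂ (range fun (q : (E →L[ℂ] ℂ) × P) i => q.1 (v i q.2)) = ⊤ := by
    by_contra hne
    obtain ⟨f, hf0, hf⟩ := Submodule.exists_le_ker_of_lt_top _ (lt_top_iff_ne_top.2 hne)
    refine hf0 ?_
    have h1 : ∀ x : ι → ℂ, f x = ∑ i, x i • f (Pi.single i 1) := fun x => by
      conv_lhs => rw [pi_eq_sum_univ' x, map_sum]
      exact Finset.sum_congr rfl fun i _ => by
        rw [map_smul]
    have h2 := hv (fun i => f (Pi.single i 1)) fun σ hσ => by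
      refine SeparatingDual.eq_zero_of_forall_dual_eq_zero (R := ℂ) fun ℓ => ?_
      have h3 : f (fun i => ℓ (v i σ)) = 0 := hf (Submodule.subset_span ⟨(ℓ, ⟨σ, hσ⟩), rfl⟩)
      rw [h1] at h3
      rw [map_sum, ← h3]
      exact Finset.sum_congr rfl fun i _ => by rw [map_smul, smul_eq_mul, smul_eq_mul, mul_comm]
    refine LinearMap.ext fun x => ?_
    rw [h1]
    exact Finset.sum_eq_zero fun i _ => by rw [congrFun h2 i]; simp
  have hmem : (Pi.single j 1 : ι → ℂ) ∈
      Submodule.span ℂ (range fun (q : (E →L[ℂ] ℂ) × P) i => q.1 (v i q.2)) := by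
    rw [hspan]; trivial
  obtain ⟨a, ha⟩ := (Finsupp.mem_span_range_iff_exists_finsupp).1 hmem
  refine ⟨a, fun i => ?_⟩
  have := congrFun ha i
  rw [Pi.single_apply] at this
  rw [← this, Finsupp.sum, Finsupp.sum, Finset.sum_apply]
  rfl

namespace FredholmFamily

/-! ### Smoothness of the frame. -/

section SmoothFrame

variable {n : ℕ} {Y : Type*} [TopologicalSpace Y] [ChartedSpace (EuclideanSpace ℝ (Fin n)) Y]
  {F₁ : Type*} [NormedAddCommGroup F₁] [InnerProductSpace ℂ F₁]
  {F₂ : Type*} [NormedAddCommGroup F₂] [InnerProductSpace ℂ F₂] [CompleteSpace F₂]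
  {D₀ : Type*} [NormedAddCommGroup D₀] [InnerProductSpace ℂ D₀] [CompleteSpace D₀]
  {H₁ : Y → Type*} [∀ y, NormedAddCommGroup (H₁ y)] [∀ y, InnerProductSpace ℂ (H₁ y)]
  {H₂ : Y → Type*} [∀ y, NormedAddCommGroup (H₂ y)] [∀ y, InnerProductSpace ℂ (H₂ y)]
  {D : Y → Type*} [∀ y, NormedAddCommGroup (D y)] [∀ y, InnerProductSpace ℂ (D y)]
  {S : FredholmFamily n Y F₁ F₂ D₀ H₁ H₂ D}
  {e₁ : PairTriv S.B₁.ι S.B₁.ι₀} {e₂ : UnitaryTriv F₂ H₂} {y₀ : Y} {ε : ℝ} {U : Set Y}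
  {C : S.RootSystems e₁ e₂ y₀ ε}

namespace Admissible

variable (h : S.Admissible e₁ e₂ y₀ ε U) (he₁ : e₁ ∈ S.B₁.atlas) (he₂ : e₂ ∈ S.B₂.atlas)
  {y : Y} {σ : ℂ}
include h he₁

/-- All singular points in the disc of radius `ε` lie within `ε / 2`, so the Cauchy formulas apply
with `ρ = 3 / 4 * ε` to the inverse of the full family acting on the fixed symbol. -/
theorem contMDiffAt_locFrame [IsManifold (𝓡 n) ∞ Y] (he₂ : e₂ ∈ S.B₂.atlas) (hy : y ∈ U)
    (i : FrameIndex C) (hσ : (y, σ) ∉ S.singE) :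
    ContMDiffAt ((𝓡 n).prod 𝓘(ℝ, ℂ)) 𝓘(ℝ, D₀) ∞
      (fun p : Y × ℂ => locFrame C i p.1 p.2) (y, σ) := by
  refine contMDiffAt_singularPart (s := (i.1 : ℂ)) (ε := ε) (ρ := 3 / 4 * ε)
    (f := fun y σ => (S.loc e₁ e₂ y σ).inverse (rootSymbol C i.1 i.2 σ : F₂))
    (by linarith [h.ε_pos]) (by linarith [h.ε_pos]) h.isOpen isClosed_singE
    (fun y hy σ hσ hs => Metric.ball_subset_ball (by linarith [h.ε_pos])
      (h.mem_ball_half hy i.1.2 hs hσ)) ?_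
    (fun y _ σ hσ hs => h.analyticAt_inverse_rootSymbol i hσ hs)
    (fun y hy => h.isSingularPart_inverse_locFrame hy i) hy hσ
  rintro ⟨y, σ⟩ ⟨hy, hσ, hs⟩
  have hSig := h.ball_subset_Sig i.1.2 hσ
  have h1 := (contMDiffOn_loc he₁ he₂).contMDiffAt
    (isOpen_domain.mem_nhds ⟨⟨h.subset₁ hy, h.subset₂ hy⟩, hSig⟩)
  have h2 : ContDiffAt ℂ ∞ (rootSymbol C i.1 i.2) σ :=
    (analyticAt_rootSymbol C i.1 i.2 hσ).contDiffAt
  have h3 := ContMDiffAt.comp (y, σ) (h2.restrict_scalars ℝ).contMDiffAt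
    (contMDiffAt_snd (I := 𝓡 n) (J := 𝓘(ℝ, ℂ)))
  exact (ContMDiffAt.complex_clm_apply (ContMDiffAt.complex_inverse h1 (isInvertible_loc hSig hs))
    (ContMDiffAt.complex_clm (S.RsPerp e₁ e₂ y₀ i.1).subtypeL h3)).contMDiffWithinAt

theorem frame_mem_smoothSections [IsManifold (𝓡 n) ∞ Y] (he₂ : e₂ ∈ S.B₂.atlas)
    (i : FrameIndex C) : frame C i ∈ S.smoothSections U := by
  refine ⟨fun y hy => h.frame_mem_K hy i, fun y hy σ hσ => ?_, fun e he => ?_⟩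
  · have h1 := ((e₁.mapD y).symm : D₀ →L[ℂ] D y).differentiableAt.comp σ
      (h.analyticAt_locFrame hy i hσ).differentiableAt
    refine (h1.congr_of_eventuallyEq (Eventually.of_forall fun ζ => ?_)).differentiableWithinAt
    simp [locFrame]
  · rintro ⟨y, σ⟩ ⟨⟨hy, hye⟩, hσ⟩
    -- An arbitrary trivialization differs from `e₁` by a smooth transition function.
    have h1 := ((S.B₁.smoothD e₁ he₁ e he).contMDiffAt
      ((e₁.isOpen_base.inter e.isOpen_base).mem_nhds ⟨h.subset₁ hy, hye⟩)).comp (y, σ)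
      (contMDiffAt_fst (I := 𝓡 n) (J := 𝓘(ℝ, ℂ)))
    refine ((ContMDiffAt.complex_clm_apply h1 (h.contMDiffAt_locFrame he₁ he₂ hy i hσ)).congr_of_eventuallyEq
      (Eventually.of_forall fun p => ?_)).contMDiffWithinAt
    simp [locFrame]

end Admissible

end SmoothFrame

end FredholmFamily

/-- Coefficients of a function in a finite system depend smoothly on parameters, if the values at
suitable points do so. -/
theorem contMDiffAt_coefficients {EM HM M : Type*} [NormedAddCommGroup EM] [NormedSpace ℝ EM]
    [TopologicalSpace HM] {I : ModelWithCorners ℝ EM HM} [TopologicalSpace M] [ChartedSpace HM M]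
    {ι X E : Type*} [Fintype ι] [NormedAddCommGroup E] [NormedSpace ℂ E] {P : Set X} {x : M}
    {v : ι → M → X → E} (hv : ∀ i, ∀ σ ∈ P, ContMDiffAt I 𝓘(ℝ, E) ∞ (fun y => v i y σ) x)
    {ψ : M → X → E} (hψ : ∀ σ ∈ P, ContMDiffAt I 𝓘(ℝ, E) ∞ (fun y => ψ y σ) x)
    (hind : ∀ c : ι → ℂ, (∀ σ ∈ P, ∑ i, c i • v i x σ = 0) → c = 0)
    {f : ι → M → ℂ} (hf : ∀ᶠ y in 𝓝 x, ∀ σ, ψ y σ = ∑ i, f i y • v i y σ) (i : ι) :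
    ContMDiffAt I 𝓘(ℝ, ℂ) ∞ (f i) x := by
  classical
  choose a ha using exists_dual_evaluations (v := fun i => v i x) hind
  let Λ : ι → (X → E) →ₗ[ℂ] ℂ := fun j => (a j).sum fun q z =>
    z • (q.1 : E →ₗ[ℂ] ℂ) ∘ₗ LinearMap.proj (q.2 : X)
  have hΛ : ∀ j w, Λ j w = (a j).sum fun q z => z * q.1 (w q.2) := fun j w => by
    simp [Λ, Finsupp.sum]
  have hΛs : ∀ {w : M → X → E}, (∀ σ ∈ P, ContMDiffAt I 𝓘(ℝ, E) ∞ (fun y => w y σ) x) →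
      ∀ j, ContMDiffAt I 𝓘(ℝ, ℂ) ∞ (fun y => Λ j (w y)) x := by
    intro w hw j
    simp only [hΛ, Finsupp.sum]
    refine contMDiffAt_finsetSum fun q _ => ?_
    exact ContMDiffAt.complex_clm ((a j q) • q.1) (hw q.2 q.2.2)
  let B : ι → ι → (ι → ℂ) →L[ℂ] (ι → ℂ) := fun j i =>
    (ContinuousLinearMap.proj i : (ι → ℂ) →L[ℂ] ℂ).smulRight (Pi.single j 1)
  -- The dual functionals are chosen at `x` and then frozen. The matrix `Λ j (v i y)` is smooth in
  -- `y` and is the identity at `x`, so it is invertible nearby, and the coefficients are `T y⁻¹`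
  -- applied to the vector `Λ j (ψ y)`.
  let T : M → (ι → ℂ) →L[ℂ] (ι → ℂ) := fun y => ∑ j, ∑ i, Λ j (v i y) • B j i
  have hTapply : ∀ y c j, T y c j = ∑ i, Λ j (v i y) * c i := by
    intro y c j
    simp [T, B, Finset.sum_apply, Pi.single_apply]
  have hT : ContMDiffAt I 𝓘(ℝ, (ι → ℂ) →L[ℂ] (ι → ℂ)) ∞ T x := by
    refine contMDiffAt_finsetSum fun j _ => contMDiffAt_finsetSum fun i _ => ?_
    exact ContMDiffAt.complex_clm ((ContinuousLinearMap.id ℂ ℂ).smulRight (B j i)) (hΛs (hv i) j)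
  have hTx : T x = ContinuousLinearMap.id ℂ _ := by
    refine ContinuousLinearMap.ext fun c => funext fun j => ?_
    rw [hTapply]
    simp [hΛ, ha]
  have hTinv : (T x).IsInvertible := by
    rw [hTx]
    exact ⟨ContinuousLinearEquiv.refl ℂ _, rfl⟩
  have hr : ContMDiffAt I 𝓘(ℝ, ι → ℂ) ∞ (fun y j => Λ j (ψ y)) x :=
    contMDiffAt_pi_space.2 fun j => hΛs hψ j
  have hres := contMDiffAt_pi_space.1
    (ContMDiffAt.complex_clm_apply (ContMDiffAt.complex_inverse hT hTinv) hr) i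
  refine hres.congr_of_eventuallyEq ?_
  filter_upwards [hf, eventually_isInvertible hT.continuousAt hTinv] with y hy hyinv
  have h1 : (fun j => Λ j (ψ y)) = T y fun i => f i y := by
    funext j
    have h2 : ψ y = ∑ i, f i y • v i y := funext fun σ => by simpa using hy σ
    rw [hTapply, h2, map_sum]
    exact Finset.sum_congr rfl fun i _ => by rw [map_smul, smul_eq_mul, mul_comm]
  rw [h1, hyinv.inverse_apply_self]

namespace FredholmFamily

/-! ### Smooth coefficients of sections. -/

section SmoothCoefficients

variable {n : ℕ} {Y : Type*} [TopologicalSpace Y] [ChartedSpace (EuclideanSpace ℝ (Fin n)) Y]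
  {F₁ : Type*} [NormedAddCommGroup F₁] [InnerProductSpace ℂ F₁]
  {F₂ : Type*} [NormedAddCommGroup F₂] [InnerProductSpace ℂ F₂] [CompleteSpace F₂]
  {D₀ : Type*} [NormedAddCommGroup D₀] [InnerProductSpace ℂ D₀] [CompleteSpace D₀]
  {H₁ : Y → Type*} [∀ y, NormedAddCommGroup (H₁ y)] [∀ y, InnerProductSpace ℂ (H₁ y)]
  {H₂ : Y → Type*} [∀ y, NormedAddCommGroup (H₂ y)] [∀ y, InnerProductSpace ℂ (H₂ y)]
  {D : Y → Type*} [∀ y, NormedAddCommGroup (D y)] [∀ y, InnerProductSpace ℂ (D y)]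
  {S : FredholmFamily n Y F₁ F₂ D₀ H₁ H₂ D}
  {e₁ : PairTriv S.B₁.ι S.B₁.ι₀} {e₂ : UnitaryTriv F₂ H₂} {y₀ : Y} {ε : ℝ} {U : Set Y}
  {C : S.RootSystems e₁ e₂ y₀ ε}

namespace Admissible

variable (h : S.Admissible e₁ e₂ y₀ ε U) {y : Y}
include h

/-- A combination vanishing off a finite set has removable singularities only, and being its own
singular part it is zero. Evaluations at nonsingular points therefore suffice to separate the frame.
-/
theorem eq_zero_of_sum_locFrame (hB : ReducedBasisOn C U) (hy : y ∈ U) {c : FrameIndex C → ℂ}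
    (hc : ∀ σ ∈ (S.singB y)ᶜ, ∑ i, c i • locFrame C i y σ = 0) : c = 0 := by
  have h1 := (mem_kernelSpace_iff fun p hp => analyticAt_loc (e₁ := e₁) (e₂ := e₂) y hp).1
    (Submodule.sum_mem _ fun i (_ : i ∈ Finset.univ) =>
      Submodule.smul_mem _ (c i) (h.locFrame_mem hy i))
  refine funext (Fintype.linearIndependent_iff.1 (h.linearIndependent_locFrame hB hy) c ?_)
  refine h1.1.unique (IsSingularPart.of_extends fun p _ => ⟨0, analyticAt_const, ?_⟩)
  filter_upwards [(S.finite_sing y).eventually_notMem_punctured p] with σ hσ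
  simpa using hc σ hσ

/-- At each `y` the evaluation points are taken outside `sing_b(P_y)`; as `sing_e` is closed, the
section and the frame are smooth near `(y, σ)` for each such `σ`. -/
theorem exists_smooth_coefficients [IsManifold (𝓡 n) ∞ Y] (he₁ : e₁ ∈ S.B₁.atlas)
    (he₂ : e₂ ∈ S.B₂.atlas) (hB : ReducedBasisOn C U) {φ : ∀ y, ℂ → D y}
    (hφ : φ ∈ S.smoothSections U) :
    ∃ f : FrameIndex C → Y → ℂ, (∀ i, ContMDiffOn (𝓡 n) 𝓘(ℝ, ℂ) ∞ (f i) U) ∧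
      ∀ y ∈ U, φ y = ∑ i, f i y • frame C i y := by
  classical
  have hex : ∀ y, ∃ c : FrameIndex C → ℂ, y ∈ U → φ y = ∑ i, c i • frame C i y := fun y => by
    by_cases hy : y ∈ U
    · obtain ⟨c, hc⟩ := h.exists_eq_sum_frame hB hy (hφ.1 y hy)
      exact ⟨c, fun _ => hc⟩
    · exact ⟨0, fun hy' => absurd hy' hy⟩
  choose f hf using hex
  refine ⟨fun i y => f y i, fun i y hy => ContMDiffAt.contMDiffWithinAt ?_, hf⟩
  have hslice : ∀ {g : Y × ℂ → D₀} {σ : ℂ},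
      ContMDiffAt ((𝓡 n).prod 𝓘(ℝ, ℂ)) 𝓘(ℝ, D₀) ∞ g (y, σ) →
      ContMDiffAt (𝓡 n) 𝓘(ℝ, D₀) ∞ (fun y => g (y, σ)) y := fun {g σ} hg =>
    ContMDiffAt.comp (f := fun y : Y => (y, σ)) y hg (contMDiffAt_id.prodMk contMDiffAt_const)
  refine contMDiffAt_coefficients (P := (S.singB y)ᶜ) (v := fun i y σ => locFrame C i y σ)
    (ψ := fun y σ => e₁.mapD y (φ y σ)) (f := fun i y => f y i)
    (fun i σ hσ => hslice (h.contMDiffAt_locFrame he₁ he₂ hy i hσ)) (fun σ hσ => ?_)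
    (fun c hc => h.eq_zero_of_sum_locFrame hB hy hc) ?_ i
  · refine hslice (g := fun p => e₁.mapD p.1 (φ p.1 p.2)) ((hφ.2.2 e₁ he₁).contMDiffAt ?_)
    exact inter_mem ((h.isOpen.inter e₁.isOpen_base).preimage continuous_fst |>.mem_nhds
      ⟨hy, h.subset₁ hy⟩) (isClosed_singE.isOpen_compl.mem_nhds hσ)
  · filter_upwards [h.isOpen.mem_nhds hy] with y' hy' σ
    rw [hf y' hy']
    simp [locFrame]

end Admissible

end SmoothCoefficients

end FredholmFamily

end KernelBundle

end

theorem theorem5p1 {n : ℕ} {Y : Type*} [TopologicalSpace Y] [T2Space Y]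
    [SecondCountableTopology Y] [ConnectedSpace Y]
    [ChartedSpace (EuclideanSpace ℝ (Fin n)) Y] [IsManifold (𝓡 n) ∞ Y]
    {F₁ : Type*} [NormedAddCommGroup F₁] [InnerProductSpace ℂ F₁] [CompleteSpace F₁]
    {F₂ : Type*} [NormedAddCommGroup F₂] [InnerProductSpace ℂ F₂] [CompleteSpace F₂]
    {D₀ : Type*} [NormedAddCommGroup D₀] [InnerProductSpace ℂ D₀] [CompleteSpace D₀]
    {H₁ : Y → Type*} [∀ y, NormedAddCommGroup (H₁ y)] [∀ y, InnerProductSpace ℂ (H₁ y)]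
    {H₂ : Y → Type*} [∀ y, NormedAddCommGroup (H₂ y)] [∀ y, InnerProductSpace ℂ (H₂ y)]
    {D : Y → Type*} [∀ y, NormedAddCommGroup (D y)] [∀ y, InnerProductSpace ℂ (D y)]
    (S : KernelBundle.FredholmFamily n Y F₁ F₂ D₀ H₁ H₂ D) (y₀ : Y)
    (e₁ : KernelBundle.PairTriv S.B₁.ι S.B₁.ι₀) (he₁ : e₁ ∈ S.B₁.atlas) (hy₁ : y₀ ∈ e₁.base)
    (e₂ : KernelBundle.UnitaryTriv F₂ H₂) (he₂ : e₂ ∈ S.B₂.atlas) (hy₂ : y₀ ∈ e₂.base) :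
    -- admissible `ε` and arbitrarily small admissible neighborhoods exist
    ((∃ V ∈ 𝓝 y₀, Bornology.IsBounded (⋃ y ∈ V, S.singB y)) →
      ∃ ε₀ > 0, ∀ ε : ℝ, 0 < ε → ε < ε₀ → ∀ N ∈ 𝓝 y₀, ∃ U ⊆ N, S.Admissible e₁ e₂ y₀ ε U) ∧
    ∀ (ε : ℝ) (U : Set Y), S.Admissible e₁ e₂ y₀ ε U →
      -- canonical systems of root functions exist
      Nonempty (S.RootSystems e₁ e₂ y₀ ε) ∧
      ∀ C : S.RootSystems e₁ e₂ y₀ ε,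
        -- after shrinking `U`, the reduced functions form pointwise bases
        (∃ U' ⊆ U, S.Admissible e₁ e₂ y₀ ε U' ∧
          KernelBundle.FredholmFamily.ReducedBasisOn C U') ∧
        -- over such a `U` the `φ^s_{j,ℓ}` form a smooth frame
        (KernelBundle.FredholmFamily.ReducedBasisOn C U →
          (∀ i, KernelBundle.FredholmFamily.frame C i ∈ S.smoothSections U) ∧
          (∀ y ∈ U, KernelBundle.IsBasisOf (S.K y)
            fun i => KernelBundle.FredholmFamily.frame C i y) ∧
          ∀ φ ∈ S.smoothSections U,
            ∃ f : KernelBundle.FredholmFamily.FrameIndex C → Y → ℂ,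
              (∀ i, ContMDiffOn (𝓡 n) 𝓘(ℝ, ℂ) ∞ (f i) U) ∧
              ∀ y ∈ U, φ y = ∑ i, f i y • KernelBundle.FredholmFamily.frame C i y) := by
  refine ⟨fun hbd => KernelBundle.FredholmFamily.exists_admissible he₁ hy₁ he₂ hy₂ hbd,
    fun ε U h => ⟨h.nonempty_rootSystems, fun C => ⟨?_, fun hB => ⟨?_, ?_, ?_⟩⟩⟩⟩
  · exact h.exists_reducedBasisOn he₁ he₂ C
  · exact fun i => h.frame_mem_smoothSections he₁ he₂ i
  · exact fun y hy => h.isBasisOf_frame hB hy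
  · exact fun φ hφ => h.exists_smooth_coefficients he₁ he₂ hB hφ
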